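/- **Setting.** Let $n\ge 2$, $d\ge 1$. Points $x_0,\dots,x_{n-1}\in\mathbb{R}^d$ (fixed independently of the algorithm's coins) arrive online, $x_i$ at time $i$, together with a deadline $d_i\in\mathbb{N}$, $d_i>i$, at which it leaves; $x_i$ is in the market at the times $i\le t<d_i$. Points leave in order of arrival: $d_0\le d_1\le\dots\le d_{n-1}$ (for instance, all stay equally long). There are no offline points and no roles at first: each point becomes a seller or a buyer at the latest when it leaves. Two points $x_i,x_j$ with $i<j$ may be matched if they are in the market together ($j<d_i$), and the weight of the pair is $\|x_i-x_j\|_2$. Let $\mathrm{opt}_t$ be the maximum weight of a (not necessarily perfect) matching of points that have left before time $t$; for $t>d_{n-1}$ this is the offline optimum of the whole input. Time and space are counted on a real RAM with fair coins (unit cost per arithmetic operation on integers or reals, including square root, logarithm and the rounding up of a real to an integer, per comparison, memory access and coin flip; space is the number of memory cells used). **Data structure.** FastPostponedGreedy draws in Init an $s\times d$ matrix $M$ with independent uniform entries $\pm1/\sqrt{s}$, where $s=\lceil K\epsilon^{-2}\log(n/\delta)\rceil$. When $x_i$ arrives, Update stores $x_i$ and its sketch $\widetilde x_i=Mx_i$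 and puts a seller copy and a buyer copy of $x_i$ with value $w_i=0$ into the market. Then every point $x_k$ with $d_k$ equal to the present time leaves: if its role is undetermined, it is decided by a fair coin; if the seller copy of $x_k$ is tentatively matched to $x_l$, then, if $x_k$ is a seller, the match $(x_k,x_l)$ is finalized, $w_k$ is added to the total value $p$, and $x_l$ becomes a buyer, and, if $x_k$ is a buyer, $x_l$ becomes a seller. Finally Query computes $\widetilde w_j=\|\widetilde x_i-\widetilde x_j\|_2$, and the buyer copy of $x_i$ is tentatively matched to the seller copy $j$ in the market that maximizes $\widetilde w_j-w_j$, if this maximum is positive (replacing an earlier tentative match of $j$), with $w_j\leftarrow\widetilde w_j$. TotalWeight returns $p$. After the last arrival, time goes on and points only leave. **Theorem.** There are absolute constants $K$ and $C$ such that for all $n\ge2$, $d\ge1$, $\epsilon,\delta\in(0,1)$ and every input as above: 1. (Resources, whatever the coins, at every time and after any sequence of calls.) The data structure uses at most $C\,(nd+\epsilon^{-2}(n+d)\log(n/\delta))$ space. Init$(\epsilon,\delta)$ takes time at most $C\epsilon^{-2}d\log(n/\delta)$, each Update (or step of time without arrival) and each Query takes time at most $C\epsilon^{-2}(n+d)\log(n/\delta)$,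 and TotalWeight takes time at most $C$. 2. (Soundness, whatever the coins.) The finalized matches form a matching of sellers with buyers that were in the market together, and each is finalized when its seller, the earlier of the two points, leaves; every point that has left has a role; roles and finalized matches are never revoked. 3. With probability at least $1-\delta$ over the matrix $M$, the following hold at all times $t$ (whatever other calls were made before): (a) whatever the coins that decide roles, Query with any point $x_i$ that has arrived returns, for every point $x_j$ that has arrived, an estimate $\widetilde w_j$ with $(1-\epsilon)\|x_j-x_i\|_2\le\widetilde w_j\le(1+\epsilon)\|x_j-x_i\|_2$; (b) TotalWeight is $\frac{1-\epsilon}{4}$-competitive: the returned value $p$ lies between $(1-\epsilon)$ and $(1+\epsilon)$ times the weight of the finalized matching, and the expectations, over the coins that decide the roles, of $p$ and of the weight of the finalized matching are both at least $\frac{1-\epsilon}{4}\,\mathrm{opt}_t$. -/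

import Mathlib

open scoped ENNReal

noncomputable section

namespace RealRAM

/-! A real random access machine with fair coins. A memory cell is addressed by a name and two
indices and holds a natural number (`NVar`) or a real number (`RVar`); scalars sit at `[0][0]`.
Every operator and every memory access of an expression, every command, every test, every loop
iteration and every coin flip costs one unit of time. -/

/-- Names of the integer registers and arrays. -/
inductive NVar
  | n | d | s          -- number of points, dimension, sketch dimension
  | now | cnt          -- present time, number of points that have arrived
  | cur | due          -- point under consideration, deadline of the arriving point
  | a | i | j | k | l  -- loop counters and a scratch index
  | best | coin
  | deadline           -- deadline[i]
  | role               -- role[i]: 0 undetermined, 1 seller, 2 buyer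
  | mate               -- mate[i]: 0 null, l + 1 if the seller copy of i is tentatively matched to l
  | final              -- final[i]: 0 null, l + 1 if i is irrevocably matched, as a seller, to l
  | market             -- market[i]: 1 if the seller and buyer copies of i are in the market
  deriving DecidableEq

/-- Names of the real registers and arrays. -/
inductive RVar
  | eps | delta        -- precision and failure tolerance
  | scale | acc | inc  -- scratch registers
  | p                  -- matching value
  | out                -- output register
  | input              -- input[k]: coordinates of the arriving point
  | M                  -- M[a][k]: sketching matrix
  | X                  -- X[i][k]: the points
  | Y                  -- Y[i][a]: the sketched points
  | w                  -- w[i]: tentative matching value of the seller copy of i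
  | est                -- est[j]: estimated distance from the queried point to j
  deriving DecidableEq

/-- Machine state: memory, elapsed time, and the set of memory cells written so far. -/
structure State where
  nat : NVar → ℕ → ℕ → ℕ
  real : RVar → ℕ → ℕ → ℝ
  time : ℕ
  cells : Finset ((NVar ⊕ RVar) × ℕ × ℕ)

/-- The blank machine. -/
def State.blank : State := ⟨fun _ _ _ => 0, fun _ _ _ => 0, 0, ∅⟩

def State.tick (σ : State) (c : ℕ) : State := { σ with time := σ.time + c }

def State.writeN (σ : State) (v : NVar) (i j m : ℕ) : State :=
  { σ with
    nat := fun v' i' j' => if v' = v ∧ i' = i ∧ j' = j then m else σ.nat v' i' j'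
    cells := insert (Sum.inl v, i, j) σ.cells }

def State.writeR (σ : State) (v : RVar) (i j : ℕ) (r : ℝ) : State :=
  { σ with
    real := fun v' i' j' => if v' = v ∧ i' = i ∧ j' = j then r else σ.real v' i' j'
    cells := insert (Sum.inr v, i, j) σ.cells }

/-- Space: the number of memory cells written so far. -/
def State.space (σ : State) : ℕ := σ.cells.card

/-- Integer expressions. -/
inductive NExpr
  | lit (m : ℕ)
  | get (v : NVar) (i j : NExpr)
  | add (e f : NExpr)
  | sub (e f : NExpr)

def NExpr.eval (σ : State) : NExpr → ℕ
  | .lit m => m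
  | .get v i j => σ.nat v (i.eval σ) (j.eval σ)
  | .add e f => e.eval σ + f.eval σ
  | .sub e f => e.eval σ - f.eval σ

def NExpr.cost : NExpr → ℕ
  | .lit _ => 1
  | .get _ i j => 1 + i.cost + j.cost
  | .add e f => 1 + e.cost + f.cost
  | .sub e f => 1 + e.cost + f.cost

/-- Real expressions. -/
inductive RExpr
  | lit (m : ℕ)
  | ofN (e : NExpr)
  | get (v : RVar) (i j : NExpr)
  | add (e f : RExpr)
  | sub (e f : RExpr)
  | mul (e f : RExpr)
  | div (e f : RExpr)
  | max (e f : RExpr)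
  | sqrt (e : RExpr)
  | log (e : RExpr)

def RExpr.eval (σ : State) : RExpr → ℝ
  | .lit m => m
  | .ofN e => (e.eval σ : ℝ)
  | .get v i j => σ.real v (i.eval σ) (j.eval σ)
  | .add e f => e.eval σ + f.eval σ
  | .sub e f => e.eval σ - f.eval σ
  | .mul e f => e.eval σ * f.eval σ
  | .div e f => e.eval σ / f.eval σ
  | .max e f => Max.max (e.eval σ) (f.eval σ)
  | .sqrt e => Real.sqrt (e.eval σ)
  | .log e => Real.log (e.eval σ)

def RExpr.cost : RExpr → ℕ
  | .lit _ => 1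
  | .ofN e => 1 + e.cost
  | .get _ i j => 1 + i.cost + j.cost
  | .add e f => 1 + e.cost + f.cost
  | .sub e f => 1 + e.cost + f.cost
  | .mul e f => 1 + e.cost + f.cost
  | .div e f => 1 + e.cost + f.cost
  | .max e f => 1 + e.cost + f.cost
  | .sqrt e => 1 + e.cost
  | .log e => 1 + e.cost

/-- Tests. -/
inductive BExpr
  | eqN (e f : NExpr)
  | ltR (e f : RExpr)

def BExpr.holds (σ : State) : BExpr → Prop
  | .eqN e f => e.eval σ = f.eval σ
  | .ltR e f => e.eval σ < f.eval σ

def BExpr.cost : BExpr → ℕ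
  | .eqN e f => 1 + e.cost + f.cost
  | .ltR e f => 1 + e.cost + f.cost

/-- Commands. `loop v e c` runs `c` for `v = 0, …, m - 1`, where `m` is the value of `e`. -/
inductive Cmd
  | skip
  | setN (v : NVar) (i j e : NExpr)
  | setR (v : RVar) (i j : NExpr) (e : RExpr)
  | ceil (v : NVar) (e : RExpr)
  | flip (v : NVar)
  | seq (c c' : Cmd)
  | ite (b : BExpr) (c c' : Cmd)
  | loop (v : NVar) (e : NExpr) (c : Cmd)

/-- Run `body 0`, …, `body (m - 1)` one after the other. -/
def iterate (body : ℕ → State → PMF State) (σ : State) : ℕ → PMF State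
  | 0 => PMF.pure σ
  | m + 1 => (iterate body σ m).bind (body m)

open Classical in
/-- The law of the state after running a command. -/
def exec : Cmd → State → PMF State
  | .skip, σ => PMF.pure (σ.tick 1)
  | .setN v i j e, σ =>
      PMF.pure ((σ.writeN v (i.eval σ) (j.eval σ) (e.eval σ)).tick
        (1 + i.cost + j.cost + e.cost))
  | .setR v i j e, σ =>
      PMF.pure ((σ.writeR v (i.eval σ) (j.eval σ) (e.eval σ)).tick
        (1 + i.cost + j.cost + e.cost))
  | .ceil v e, σ => PMF.pure ((σ.writeN v 0 0 ⌈e.eval σ⌉₊).tick (1 + e.cost))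
  | .flip v, σ =>
      (PMF.uniformOfFintype Bool).bind fun b =>
        PMF.pure ((σ.writeN v 0 0 (if b = true then 1 else 0)).tick 1)
  | .seq c c', σ => (exec c σ).bind (exec c')
  | .ite b c c', σ =>
      if b.holds σ then exec c (σ.tick (1 + b.cost)) else exec c' (σ.tick (1 + b.cost))
  | .loop v e c, σ =>
      iterate (fun m τ => exec c ((τ.writeN v 0 0 m).tick 1)) (σ.tick (1 + e.cost)) (e.eval σ)

/-- Sequential composition of a list of commands. -/
def block : List Cmd → Cmd
  | [] => .skip
  | c :: cs => .seq c (block cs)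

/-- Scalar registers. -/
def nreg (v : NVar) : NExpr := .get v (.lit 0) (.lit 0)
def rreg (v : RVar) : RExpr := .get v (.lit 0) (.lit 0)
def setNreg (v : NVar) (e : NExpr) : Cmd := .setN v (.lit 0) (.lit 0) e
def setRreg (v : RVar) (e : RExpr) : Cmd := .setR v (.lit 0) (.lit 0) e

/-- Entries of one-dimensional arrays. -/
def nat1 (v : NVar) (i : NExpr) : NExpr := .get v i (.lit 0)
def real1 (v : RVar) (i : NExpr) : RExpr := .get v i (.lit 0)
def setN1 (v : NVar) (i e : NExpr) : Cmd := .setN v i (.lit 0) e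
def setR1 (v : RVar) (i : NExpr) (e : RExpr) : Cmd := .setR v i (.lit 0) e

end RealRAM

namespace FastPostponedGreedy

open RealRAM

/-- `Init`: `s = ⌈K ε⁻² log (n / δ)⌉` and a random sign matrix `M ∈ {-1/√s, 1/√s}^{s × d}`. -/
def init (K : ℕ) : Cmd := block [
  setRreg .p (.lit 0),
  setNreg .now (.lit 0),
  setNreg .cnt (.lit 0),
  .ceil .s (.div
    (.mul (.lit K) (.log (.div (.ofN (nreg .n)) (rreg .delta))))
    (.mul (rreg .eps) (rreg .eps))),
  setRreg .scale (.div (.lit 1) (.sqrt (.ofN (nreg .s)))),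
  .loop .a (nreg .s) (.loop .k (nreg .d) (block [
    .flip .coin,
    .ite (.eqN (nreg .coin) (.lit 1))
      (.setR .M (nreg .a) (nreg .k) (rreg .scale))
      (.setR .M (nreg .a) (nreg .k) (.sub (.lit 0) (rreg .scale)))]))]

/-- First part of `Update`: store the arriving point, sketch it, add its seller and buyer copies. -/
def arrive : Cmd := block [
  setNreg .cur (nreg .cnt),
  setNreg .cnt (.add (nreg .cnt) (.lit 1)),
  .loop .k (nreg .d) (.setR .X (nreg .cur) (nreg .k) (real1 .input (nreg .k))),
  setN1 .deadline (nreg .cur) (nreg .due),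
  setN1 .role (nreg .cur) (.lit 0),
  .loop .a (nreg .s) (block [
    setRreg .acc (.lit 0),
    .loop .k (nreg .d) (setRreg .acc (.add (rreg .acc)
      (.mul (.get .M (nreg .a) (nreg .k)) (.get .X (nreg .cur) (nreg .k))))),
    .setR .Y (nreg .cur) (nreg .a) (rreg .acc)]),
  setN1 .mate (nreg .cur) (.lit 0),
  setN1 .final (nreg .cur) (.lit 0),
  setR1 .w (nreg .cur) (.lit 0),
  setN1 .market (nreg .cur) (.lit 1)]

/-- Second part of `Update`: every point whose deadline is the present time leaves the market.
Its role is decided by a fair coin if it is still undetermined; then its tentative match is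
finalized if it is a seller and dropped if it is a buyer, and the partner gets the other role. -/
def leave : Cmd :=
  .loop .i (nreg .cnt) (.ite (.eqN (nat1 .deadline (nreg .i)) (nreg .now))
    (block [
      .ite (.eqN (nat1 .role (nreg .i)) (.lit 0))
        (block [.flip .coin, setN1 .role (nreg .i) (.add (nreg .coin) (.lit 1))])
        .skip,
      .ite (.eqN (nat1 .mate (nreg .i)) (.lit 0))
        .skip
        (block [
          setNreg .l (.sub (nat1 .mate (nreg .i)) (.lit 1)),
          .ite (.eqN (nat1 .role (nreg .i)) (.lit 1))
            (block [
              setRreg .p (.add (rreg .p) (real1 .w (nreg .i))),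
              setN1 .final (nreg .i) (nat1 .mate (nreg .i)),
              setN1 .role (nreg .l) (.lit 2)])
            (setN1 .role (nreg .l) (.lit 1))]),
      setN1 .market (nreg .i) (.lit 0)])
    .skip)

/-- `Query`: estimate the distances from the point `cur` to all points, from their sketches. -/
def query : Cmd :=
  .loop .j (nreg .cnt) (block [
    setRreg .acc (.lit 0),
    .loop .a (nreg .s) (setRreg .acc (.add (rreg .acc)
      (.mul (.sub (.get .Y (nreg .cur) (nreg .a)) (.get .Y (nreg .j) (nreg .a)))
        (.sub (.get .Y (nreg .cur) (nreg .a)) (.get .Y (nreg .j) (nreg .a)))))),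
    setR1 .est (nreg .j) (.sqrt (rreg .acc))])

/-- Last part of `Update`: the buyer copy of `cur` is tentatively matched to the seller copy in
the market that maximizes `est[j] - w[j]`, if this maximum is positive. -/
def assign : Cmd := block [
  setNreg .best (.lit 0),
  setRreg .inc (.lit 0),
  .loop .j (nreg .cnt) (.ite (.eqN (nat1 .market (nreg .j)) (.lit 1))
    (.ite (.ltR (rreg .inc) (.sub (real1 .est (nreg .j)) (real1 .w (nreg .j))))
      (block [
        setNreg .best (.add (nreg .j) (.lit 1)),
        setRreg .inc (.sub (real1 .est (nreg .j)) (real1 .w (nreg .j)))])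
      .skip)
    .skip),
  .ite (.eqN (nreg .best) (.lit 0))
    .skip
    (block [
      setNreg .j (.sub (nreg .best) (.lit 1)),
      setN1 .mate (nreg .j) (.add (nreg .cur) (.lit 1)),
      setR1 .w (nreg .j) (.max (real1 .w (nreg .j)) (real1 .est (nreg .j)))])]

def advanceClock : Cmd := setNreg .now (.add (nreg .now) (.lit 1))

/-- `Update`. -/
def update : Cmd := block [arrive, leave, query, assign, advanceClock]

/-- The deadline part of `Update` alone, run at the times after the last arrival. -/
def idle : Cmd := block [leave, advanceClock]

/-- `TotalWeight`. -/
def totalWeight : Cmd := setRreg .out (rreg .p)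

/-- An input sequence: point `x i` enters the market at time `i` and leaves it at time
`deadline i`, so it is in the market at the times `i ≤ t < deadline i`. Points leave in the order
of their arrival, as they do when all of them stay for the same time. -/
structure Input (n d : ℕ) where
  x : Fin n → EuclideanSpace ℝ (Fin d)
  deadline : Fin n → ℕ
  arrival_lt_deadline : ∀ i : Fin n, (i : ℕ) < deadline i
  deadline_mono : Monotone deadline

variable {n d : ℕ}

/-- The law of the state after `Init (ε, δ)` on a blank machine. -/
def initLaw (K n d : ℕ) (ε δ : ℝ) : PMF State :=
  exec (init K) ((((State.blank.writeN .n 0 0 n).writeN .d 0 0 d).writeR .eps 0 0 ε).writeR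
    .delta 0 0 δ)

/-- Hand the point `y` and its deadline `t` to the machine. -/
def load (y : EuclideanSpace ℝ (Fin d)) (t : ℕ) (σ : State) : State :=
  (List.finRange d).foldl (fun (τ : State) (k : Fin d) => τ.writeR .input k 0 (y k)) (σ.writeN .due 0 0 t)

/-- Calls to the data structure. `advance` lets one unit of time pass: it calls `Update` on the
arriving point, or only lets points leave if all points have already arrived. -/
inductive Op
  | advance
  | query (i : ℕ)
  | totalWeight

/-- The law of the state after a call at time `t`. -/
def call (I : Input n d) (t : ℕ) : Op → State → PMF State
  | .advance, σ =>
      if h : t < n then exec update (load (I.x ⟨t, h⟩) (I.deadline ⟨t, h⟩) σ) else exec idle σ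
  | .query i, σ => exec query (σ.writeN .cur 0 0 i)
  | .totalWeight, σ => exec totalWeight σ

/-- The present time after a sequence of calls. -/
def elapsed : List Op → ℕ
  | [] => 0
  | .advance :: h => elapsed h + 1
  | .query _ :: h => elapsed h
  | .totalWeight :: h => elapsed h

/-- The law of the state after a sequence of calls (the latest one first), starting at `σ₀`. -/
def run (I : Input n d) (σ₀ : State) : List Op → PMF State
  | [] => PMF.pure σ₀
  | op :: h => (run I σ₀ h).bind (call I (elapsed h) op)

/-- The points that have arrived before time `t`. -/
def arrived (t : ℕ) (i : Fin n) : Prop := (i : ℕ) < t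

/-- The points that have left before time `t`. -/
def Input.left (I : Input n d) (t : ℕ) (i : Fin n) : Prop := I.deadline i < t

/-- Matchings of points that are in the market at the same time; a pair lists the earlier point
first, and no two pairs share a point. -/
def Input.IsMatching (I : Input n d) (S : Finset (Fin n × Fin n)) : Prop :=
  (∀ e ∈ S, e.1 < e.2 ∧ (e.2 : ℕ) < I.deadline e.1) ∧
  ∀ e ∈ S, ∀ f ∈ S, e ≠ f → e.1 ≠ f.1 ∧ e.1 ≠ f.2 ∧ e.2 ≠ f.1 ∧ e.2 ≠ f.2

/-- The weight of a matching; the weight of a pair is the Euclidean distance of its points. -/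
def Input.weight (I : Input n d) (S : Finset (Fin n × Fin n)) : ℝ :=
  ∑ e ∈ S, dist (I.x e.1) (I.x e.2)

/-- The offline optimum: the largest weight of a matching of points that have left before
time `t`. For `t` past all deadlines this is the optimum over the whole input. -/
def Input.opt (I : Input n d) (t : ℕ) : ℝ :=
  sSup {r | ∃ S : Finset (Fin n × Fin n), I.IsMatching S ∧
    (∀ e ∈ S, I.left t e.1 ∧ I.left t e.2) ∧ r = I.weight S}

/-- The role of a point: 0 undetermined, 1 seller, 2 buyer. -/
def role (σ : State) (i : Fin n) : ℕ := σ.nat .role i 0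

/-- The finalized matches (seller, buyer). -/
def matched (n : ℕ) (σ : State) : Finset (Fin n × Fin n) :=
  Finset.univ.filter fun e => σ.nat .final e.1 0 = e.2 + 1

/-- Expectation of a nonnegative quantity. -/
def expect (μ : PMF State) (f : State → ℝ) : ℝ≥0∞ := ∑' σ, μ σ * ENNReal.ofReal (f σ)

/-- The running time allowed for a call. -/
def timeBound (C : ℝ) (n d : ℕ) (ε δ : ℝ) : Op → ℝ
  | .advance => C * (ε⁻¹ ^ 2 * (n + d) * Real.log (n / δ))
  | .query _ => C * (ε⁻¹ ^ 2 * (n + d) * Real.log (n / δ))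
  | .totalWeight => C

/-- Resource bounds and soundness in every state `σ` that is reached after the calls `h`,
whatever the coins. -/
structure Sound (C : ℝ) (ε δ : ℝ) (I : Input n d) (h : List Op) (σ : State) : Prop where
  space : (σ.space : ℝ) ≤ C * (n * d + ε⁻¹ ^ 2 * (n + d) * Real.log (n / δ))
  /-- The finalized matches form a matching of sellers with buyers. -/
  isMatching : I.IsMatching (matched n σ)
  roles : ∀ e ∈ matched n σ, role σ e.1 = 1 ∧ role σ e.2 = 2
  /-- A match is finalized when its first point leaves. -/
  final_left : ∀ e ∈ matched n σ, I.left (elapsed h) e.1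
  /-- Every point that has left has its role. -/
  decided : ∀ i : Fin n, I.left (elapsed h) i → role σ i = 1 ∨ role σ i = 2
  time : ∀ op, ∀ τ ∈ (call I (elapsed h) op σ).support,
    (τ.time : ℝ) ≤ σ.time + timeBound C n d ε δ op
  /-- Roles and finalized matches are irrevocable. -/
  irrevocable : ∀ op, ∀ τ ∈ (call I (elapsed h) op σ).support,
    matched n σ ⊆ matched n τ ∧ ∀ i : Fin n, role σ i ≠ 0 → role τ i = role σ i

/-- Accuracy of `Query`: after the calls `h`, whatever the coins flipped by them, a query with a
point `i` that has arrived estimates all distances to points that have arrived. -/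
def QueryAccurate (ε : ℝ) (I : Input n d) (σ₀ : State) (h : List Op) : Prop :=
  ∀ σ ∈ (run I σ₀ h).support, ∀ i : Fin n, arrived (elapsed h) i →
    ∀ τ ∈ (call I (elapsed h) (.query i) σ).support, ∀ j : Fin n, arrived (elapsed h) j →
      (1 - ε) * dist (I.x j) (I.x i) ≤ τ.real .est j 0 ∧
      τ.real .est j 0 ≤ (1 + ε) * dist (I.x j) (I.x i)

/-- Competitiveness of `TotalWeight` after the calls `h`: the returned value estimates the weight
of the finalized matching, and its expectation over the coins that decide the roles, as well as
that of the weight of the matching, is at least `(1 - ε) / 4` times the offline optimum. -/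
def TotalWeightCompetitive (ε : ℝ) (I : Input n d) (σ₀ : State) (h : List Op) : Prop :=
  (∀ τ ∈ (run I σ₀ (.totalWeight :: h)).support,
    (1 - ε) * I.weight (matched n τ) ≤ τ.real .out 0 0 ∧
    τ.real .out 0 0 ≤ (1 + ε) * I.weight (matched n τ)) ∧
  ENNReal.ofReal ((1 - ε) / 4 * I.opt (elapsed h)) ≤
    expect (run I σ₀ (.totalWeight :: h)) (fun τ => τ.real .out 0 0) ∧
  ENNReal.ofReal ((1 - ε) / 4 * I.opt (elapsed h)) ≤
    expect (run I σ₀ (.totalWeight :: h)) (fun τ => I.weight (matched n τ))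

end FastPostponedGreedy

end

/-! ### Program logic for the machine: reachability, frames, running time, expectation. -/

namespace RealRAM

/-! ### States -/

/-! Once the matrix is fixed, the tentative matching (`tent`) is a deterministic function of the
estimated distances. The role coins only decide which tentative matches count.

Greedy is 2-competitive for the estimates (`tent_competitive`). Let i < j be a pair of some
matching. When j arrives, i is in the market. Either no gain is positive and the value of i already
covers the estimate of the pair, or the best gain is at least this estimate minus the value of i.
Hence the estimate is at most the final value of i plus the growth of the total value caused by j
(`tent_edge`). Summed over the matching, the first terms are at most the total value, and so are the
second ones, by telescoping. The argument restricts to points that have left: as deadlines are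
monotone, a buyer that has left has only raised sellers that have left too.

Roles cost a second factor 2. When i leaves, its tentative buyer l > i has not left and is held by
no other seller, so l is undetermined and can be given the opposite role (`Ledger.leave`). Every
point keeps the marginal probability 1/2 of becoming a seller: i by a fair coin, l by mirroring i
(`Balanced.leaveBody`). By linearity of expectation no independence is needed, and the expected
value of p is half the tentative value of the points that have left. With the greedy bound this
gives the factor 1/4, up to the error of the estimates (`Accurate.opt_le`).

The estimates are accurate by a Johnson-Lindenstrauss argument. The exponential moment of a squared
signed sum is dominated by the Gaussian one (`exp_sq_step`); an expansion to second order gives its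
sharp form for small parameters (`signAvg_exp_le`); rows multiply (`drawMatrix_Ex`); Chernoff bounds
treat both tails (`sketch_concentration`), and a union bound treats all pairs
(`accurate_probability`). The accuracy is chosen as ε/2, because passing from p to the weight of the
matching costs a factor 1 + ε/2.

The program is tied to this process by a Hoare logic on supports (`wp`), whose conclusions hold
whatever the coins. `Sem` says that the memory encodes the process between calls, and `Ledger`
describes roles and finalized matches; soundness is read off from them. Time is bounded by a static
cost (`wp_time`), space by a fixed set of cells (`room`), and the coins are averaged by `Ex`. -/

@[simp] theorem tick_nat (σ : State) (c : ℕ) : (σ.tick c).nat = σ.nat := rfl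
@[simp] theorem tick_real (σ : State) (c : ℕ) : (σ.tick c).real = σ.real := rfl
@[simp] theorem tick_cells (σ : State) (c : ℕ) : (σ.tick c).cells = σ.cells := rfl
@[simp] theorem tick_time (σ : State) (c : ℕ) : (σ.tick c).time = σ.time + c := rfl
@[simp] theorem writeN_real (σ : State) (v : NVar) (i j m : ℕ) :
    (σ.writeN v i j m).real = σ.real := rfl
@[simp] theorem writeR_nat (σ : State) (v : RVar) (i j : ℕ) (r : ℝ) :
    (σ.writeR v i j r).nat = σ.nat := rfl
@[simp] theorem writeN_time (σ : State) (v : NVar) (i j m : ℕ) :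
    (σ.writeN v i j m).time = σ.time := rfl
@[simp] theorem writeR_time (σ : State) (v : RVar) (i j : ℕ) (r : ℝ) :
    (σ.writeR v i j r).time = σ.time := rfl
@[simp] theorem writeN_cells (σ : State) (v : NVar) (i j m : ℕ) :
    (σ.writeN v i j m).cells = insert (Sum.inl v, i, j) σ.cells := rfl
@[simp] theorem writeR_cells (σ : State) (v : RVar) (i j : ℕ) (r : ℝ) :
    (σ.writeR v i j r).cells = insert (Sum.inr v, i, j) σ.cells := rfl

theorem writeN_nat (σ : State) (v v' : NVar) (i j m i' j' : ℕ) :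
    (σ.writeN v i j m).nat v' i' j' = if v' = v ∧ i' = i ∧ j' = j then m else σ.nat v' i' j' := rfl

theorem writeR_real (σ : State) (v v' : RVar) (i j i' j' : ℕ) (r : ℝ) :
    (σ.writeR v i j r).real v' i' j' =
      if v' = v ∧ i' = i ∧ j' = j then r else σ.real v' i' j' := rfl

theorem writeN_nat_of_ne (σ : State) {v v' : NVar} (i j m : ℕ) (h : v' ≠ v) :
    (σ.writeN v i j m).nat v' = σ.nat v' := by
  funext i' j'; simp [writeN_nat, h]

theorem writeR_real_of_ne (σ : State) {v v' : RVar} (i j : ℕ) (r : ℝ) (h : v' ≠ v) :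
    (σ.writeR v i j r).real v' = σ.real v' := by
  funext i' j'; simp [writeR_real, h]

/-! ### Weakest preconditions -/

/-- Every state that `c` can reach from `σ` satisfies `Q`. -/
def wp (c : Cmd) (Q : State → Prop) (σ : State) : Prop := ∀ τ ∈ (exec c σ).support, Q τ

theorem wp_mono {c : Cmd} {Q R : State → Prop} {σ : State} (h : wp c Q σ)
    (hQR : ∀ τ, Q τ → R τ) : wp c R σ := fun τ hτ => hQR τ (h τ hτ)

theorem wp_and {c : Cmd} {Q R : State → Prop} {σ : State} (h : wp c Q σ) (h' : wp c R σ) :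
    wp c (fun τ => Q τ ∧ R τ) σ := fun τ hτ => ⟨h τ hτ, h' τ hτ⟩

@[simp] theorem wp_skip {Q : State → Prop} {σ : State} : wp .skip Q σ ↔ Q (σ.tick 1) := by
  simp [wp, exec]

@[simp] theorem wp_setN {Q : State → Prop} {σ : State} {v : NVar} {i j e : NExpr} :
    wp (.setN v i j e) Q σ ↔ Q ((σ.writeN v (i.eval σ) (j.eval σ) (e.eval σ)).tick
        (1 + i.cost + j.cost + e.cost)) := by
  simp [wp, exec]

@[simp] theorem wp_setR {Q : State → Prop} {σ : State} {v : RVar} {i j : NExpr} {e : RExpr} :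
    wp (.setR v i j e) Q σ ↔ Q ((σ.writeR v (i.eval σ) (j.eval σ) (e.eval σ)).tick
        (1 + i.cost + j.cost + e.cost)) := by
  simp [wp, exec]

@[simp] theorem wp_ceil {Q : State → Prop} {σ : State} {v : NVar} {e : RExpr} :
    wp (.ceil v e) Q σ ↔ Q ((σ.writeN v 0 0 ⌈e.eval σ⌉₊).tick (1 + e.cost)) := by
  simp [wp, exec]

@[simp] theorem wp_flip {Q : State → Prop} {σ : State} {v : NVar} :
    wp (.flip v) Q σ ↔ Q ((σ.writeN v 0 0 1).tick 1) ∧ Q ((σ.writeN v 0 0 0).tick 1) := by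
  simp [wp, exec, and_comm]

@[simp] theorem wp_seq {Q : State → Prop} {σ : State} {c c' : Cmd} :
    wp (.seq c c') Q σ ↔ wp c (wp c' Q) σ := by
  simp only [wp, exec, PMF.mem_support_bind_iff]
  exact ⟨fun h τ hτ ρ hρ => h ρ ⟨τ, hτ, hρ⟩, fun h ρ ⟨τ, hτ, hρ⟩ => h τ hτ ρ hρ⟩

@[simp] theorem wp_ite {Q : State → Prop} {σ : State} {b : BExpr} {c c' : Cmd} :
    wp (.ite b c c') Q σ ↔ (b.holds σ → wp c Q (σ.tick (1 + b.cost))) ∧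
      (¬ b.holds σ → wp c' Q (σ.tick (1 + b.cost))) := by
  by_cases h : b.holds σ <;> simp [wp, exec, h]

theorem wp_block_nil {Q : State → Prop} {σ : State} : wp (block []) Q σ ↔ Q (σ.tick 1) := wp_skip

theorem wp_block_cons {Q : State → Prop} {σ : State} {c : Cmd} {cs : List Cmd} :
    wp (block (c :: cs)) Q σ ↔ wp c (wp (block cs) Q) σ := wp_seq

/-- The invariant carries the iteration index, so it can speak of what the first k rounds have done.
-/
theorem iterate_induction {body : ℕ → State → PMF State} {σ : State} {m : ℕ}
    (J : ℕ → State → Prop) (h0 : J 0 σ)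
    (hs : ∀ k < m, ∀ τ, J k τ → ∀ ρ ∈ (body k τ).support, J (k + 1) ρ) :
    ∀ τ ∈ (iterate body σ m).support, J m τ := by
  induction m with
  | zero => simpa [iterate] using h0
  | succ m ih =>
    intro ρ hρ
    simp only [iterate, PMF.mem_support_bind_iff] at hρ
    obtain ⟨τ, hτ, hρ⟩ := hρ
    exact hs m m.lt_succ_self τ (ih (fun k hk => hs k (by omega)) τ hτ) ρ hρ

theorem wp_loop_of {v : NVar} {e : NExpr} {c : Cmd} {Q : State → Prop} {σ : State}
    (J : ℕ → State → Prop) (h0 : J 0 (σ.tick (1 + e.cost)))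
    (hs : ∀ m < e.eval σ, ∀ τ, J m τ → wp c (J (m + 1)) ((τ.writeN v 0 0 m).tick 1))
    (hQ : ∀ τ, J (e.eval σ) τ → Q τ) : wp (.loop v e c) Q σ := by
  intro τ hτ
  exact hQ τ (iterate_induction J h0 hs τ hτ)

/-! ### Frames -/

/-- The names of the integer cells that a command may write. -/
def Cmd.wN : Cmd → List NVar
  | .skip => []
  | .setN v _ _ _ => [v]
  | .setR _ _ _ _ => []
  | .ceil v _ => [v]
  | .flip v => [v]
  | .seq c c' => c.wN ++ c'.wN
  | .ite _ c c' => c.wN ++ c'.wN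
  | .loop v _ c => v :: c.wN

/-- The names of the real cells that a command may write. -/
def Cmd.wR : Cmd → List RVar
  | .skip => []
  | .setN _ _ _ _ => []
  | .setR v _ _ _ => [v]
  | .ceil _ _ => []
  | .flip _ => []
  | .seq c c' => c.wR ++ c'.wR
  | .ite _ c c' => c.wR ++ c'.wR
  | .loop _ _ c => c.wR

theorem wp_frameN {v : NVar} (c : Cmd) (hv : v ∉ c.wN) (σ : State) :
    wp c (fun τ => τ.nat v = σ.nat v) σ := by
  induction c generalizing σ with
  | skip => simp
  | setN u i j e => simp only [Cmd.wN, List.mem_singleton] at hv; simp [writeN_nat_of_ne _ _ _ _ hv]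
  | setR u i j e => simp
  | ceil u e => simp only [Cmd.wN, List.mem_singleton] at hv; simp [writeN_nat_of_ne _ _ _ _ hv]
  | flip u => simp only [Cmd.wN, List.mem_singleton] at hv; simp [writeN_nat_of_ne _ _ _ _ hv]
  | seq c c' ih ih' =>
    simp only [Cmd.wN, List.mem_append, not_or] at hv
    rw [wp_seq]
    exact wp_mono (ih hv.1 σ) fun τ hτ => wp_mono (ih' hv.2 τ) fun ρ hρ => hρ.trans hτ
  | ite b c c' ih ih' =>
    simp only [Cmd.wN, List.mem_append, not_or] at hv
    rw [wp_ite]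
    exact ⟨fun _ => ih hv.1 _, fun _ => ih' hv.2 _⟩
  | loop u e c ih =>
    simp only [Cmd.wN, List.mem_cons, not_or] at hv
    refine wp_loop_of (fun _ τ => τ.nat v = σ.nat v) rfl (fun m _ τ hτ => ?_) fun _ h => h
    refine wp_mono (ih hv.2 _) fun ρ hρ => ?_
    rw [hρ, tick_nat, writeN_nat_of_ne _ _ _ _ hv.1, hτ]

theorem wp_frameR {v : RVar} (c : Cmd) (hv : v ∉ c.wR) (σ : State) :
    wp c (fun τ => τ.real v = σ.real v) σ := by
  induction c generalizing σ with
  | skip => simp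
  | setN u i j e => simp
  | setR u i j e => simp only [Cmd.wR, List.mem_singleton] at hv; simp [writeR_real_of_ne _ _ _ _ hv]
  | ceil u e => simp
  | flip u => simp
  | seq c c' ih ih' =>
    simp only [Cmd.wR, List.mem_append, not_or] at hv
    rw [wp_seq]
    exact wp_mono (ih hv.1 σ) fun τ hτ => wp_mono (ih' hv.2 τ) fun ρ hρ => hρ.trans hτ
  | ite b c c' ih ih' =>
    simp only [Cmd.wR, List.mem_append, not_or] at hv
    rw [wp_ite]
    exact ⟨fun _ => ih hv.1 _, fun _ => ih' hv.2 _⟩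
  | loop u e c ih =>
    simp only [Cmd.wR] at hv
    refine wp_loop_of (fun _ τ => τ.real v = σ.real v) rfl (fun m _ τ hτ => ?_) fun _ h => h
    exact wp_mono (ih hv _) fun ρ hρ => hρ.trans hτ

/-- The cells that `c` cannot write have the same contents in `σ` and `τ`. -/
structure Frame (c : Cmd) (σ τ : State) : Prop where
  nat : ∀ v, v ∉ c.wN → τ.nat v = σ.nat v
  real : ∀ v, v ∉ c.wR → τ.real v = σ.real v

theorem wp_frame (c : Cmd) (σ : State) : wp c (Frame c σ) σ := fun τ hτ =>
  ⟨fun _ hv => wp_frameN c hv σ τ hτ, fun _ hv => wp_frameR c hv σ τ hτ⟩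

/-- Lets a specification mention only the cells that change; all others come for free from the
syntax of the command. -/
theorem wp_of_frame {c : Cmd} {Q : State → Prop} {σ : State}
    (h : wp c (fun τ => Frame c σ τ → Q τ) σ) : wp c Q σ :=
  fun τ hτ => h τ hτ (wp_frame c σ τ hτ)

/-- Loop rule with an invariant; the cells that the loop cannot write may be assumed unchanged. -/
theorem wp_loop {v : NVar} {e : NExpr} {c : Cmd} {Q : State → Prop} {σ : State}
    (J : ℕ → State → Prop) (h0 : J 0 (σ.tick (1 + e.cost)))
    (hs : ∀ m < e.eval σ, ∀ τ, Frame (.loop v e c) σ τ → J m τ →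
      wp c (J (m + 1)) ((τ.writeN v 0 0 m).tick 1))
    (hQ : ∀ τ, Frame (.loop v e c) σ τ → J (e.eval σ) τ → Q τ) : wp (.loop v e c) Q σ := by
  refine wp_loop_of (fun m τ => Frame (.loop v e c) σ τ ∧ J m τ) ⟨⟨fun _ _ => rfl, fun _ _ => rfl⟩, h0⟩
    (fun m hm τ hτ => ?_) fun τ hτ => hQ τ hτ.1 hτ.2
  refine wp_and (wp_mono (wp_frame c _) fun ρ hρ => ⟨fun u hu => ?_, fun u hu => ?_⟩)
    (hs m hm τ hτ.1 hτ.2)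
  · rw [← hτ.1.nat u hu]
    simp only [Cmd.wN, List.mem_cons, not_or] at hu
    rw [hρ.nat u hu.2, tick_nat, writeN_nat_of_ne _ _ _ _ hu.1]
  · rw [← hτ.1.real u hu]
    exact hρ.real u hu

/-! ### Running time -/

/-- The registers that bound the loops of a command. -/
def Cmd.loopRegs : Cmd → List NVar
  | .seq c c' => c.loopRegs ++ c'.loopRegs
  | .ite _ c c' => c.loopRegs ++ c'.loopRegs
  | .loop _ e c => (match e with | .get u _ _ => [u] | _ => []) ++ c.loopRegs
  | _ => []

/-- Every loop runs up to the value of a register. -/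
def Cmd.RegLoops : Cmd → Prop
  | .seq c c' => c.RegLoops ∧ c'.RegLoops
  | .ite _ c c' => c.RegLoops ∧ c'.RegLoops
  | .loop _ e c => (∃ u, e = nreg u) ∧ c.RegLoops
  | _ => True

/-- Upper bound for the running time of a command whose loop registers are bounded by `B`. -/
def Cmd.cost (B : NVar → ℕ) : Cmd → ℕ
  | .skip => 1
  | .setN _ i j e => 1 + i.cost + j.cost + e.cost
  | .setR _ i j e => 1 + i.cost + j.cost + e.cost
  | .ceil _ e => 1 + e.cost
  | .flip _ => 1
  | .seq c c' => c.cost B + c'.cost B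
  | .ite b c c' => 1 + b.cost + (c.cost B + c'.cost B)
  | .loop _ e c => 1 + e.cost + (match e with | .get u _ _ => B u | _ => 0) * (1 + c.cost B)

/-- The registers that bound loops are never written by the command, so every iteration count can be
bounded in the initial state. A test is charged for both branches, which avoids following the
control flow. -/
theorem wp_time (B : NVar → ℕ) (c : Cmd) (hc : c.RegLoops) (σ : State)
    (hB : ∀ u ∈ c.loopRegs, σ.nat u 0 0 ≤ B u) (hw : ∀ u ∈ c.loopRegs, u ∉ c.wN) :
    wp c (fun τ => τ.time ≤ σ.time + c.cost B) σ := by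
  induction c generalizing σ with
  | skip => simp [Cmd.cost]
  | setN u i j e => simp [Cmd.cost]
  | setR u i j e => simp [Cmd.cost]
  | ceil u e => simp [Cmd.cost]
  | flip u => simp [Cmd.cost]
  | seq c c' ih ih' =>
    simp only [Cmd.loopRegs, List.mem_append, Cmd.wN, not_or] at hB hw
    rw [wp_seq]
    refine wp_mono (wp_and (wp_frame c σ)
      (ih hc.1 σ (fun u hu => hB u (.inl hu)) fun u hu => (hw u (.inl hu)).1)) fun τ hτ => ?_
    refine wp_mono (ih' hc.2 τ (fun u hu => ?_) fun u hu => (hw u (.inr hu)).2) fun ρ hρ => ?_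
    · rw [hτ.1.nat u (hw u (.inr hu)).1]; exact hB u (.inr hu)
    · simp only [Cmd.cost]; omega
  | ite b c c' ih ih' =>
    simp only [Cmd.loopRegs, List.mem_append, Cmd.wN, not_or] at hB hw
    rw [wp_ite]
    refine ⟨fun _ => wp_mono (ih hc.1 _ (fun u hu => hB u (.inl hu)) fun u hu => (hw u (.inl hu)).1)
      fun τ hτ => ?_, fun _ => wp_mono
      (ih' hc.2 _ (fun u hu => hB u (.inr hu)) fun u hu => (hw u (.inr hu)).2) fun τ hτ => ?_⟩ <;>
    · simp only [Cmd.cost, tick_time] at hτ ⊢; omega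
  | loop v e c ih =>
    obtain ⟨⟨u, rfl⟩, hc⟩ := hc
    simp only [Cmd.loopRegs, nreg, List.mem_append, Cmd.wN,
      List.mem_cons, not_or] at hB hw
    refine wp_loop (fun m τ => τ.time ≤ σ.time + (1 + (nreg u).cost + m * (1 + c.cost B)))
      (by simp) (fun m hm τ hF hτ => ?_) fun τ _ hτ => ?_
    · refine wp_mono (ih hc _ (fun x hx => ?_) fun x hx => (hw x (.inr hx)).2) fun ρ hρ => ?_
      · rw [tick_nat, writeN_nat_of_ne _ _ _ _ (hw x (.inr hx)).1, hF.nat x]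
        · exact hB x (.inr hx)
        · simp only [Cmd.wN, List.mem_cons, not_or]; exact hw x (.inr hx)
      · simp only [tick_time, writeN_time] at hρ
        have : (m + 1) * (1 + c.cost B) = m * (1 + c.cost B) + (1 + c.cost B) := by ring
        omega
    · refine hτ.trans ?_
      have := Nat.mul_le_mul_right (1 + c.cost B) (hB u (.inl (by simp)))
      simp only [Cmd.cost, nreg, NExpr.eval] at this ⊢
      omega

/-! ### Expectations -/

/-- Expectation of an extended nonnegative quantity. -/
noncomputable def Ex (μ : PMF State) (f : State → ℝ≥0∞) : ℝ≥0∞ := ∑' σ, μ σ * f σ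

theorem Ex_pure (σ : State) (f : State → ℝ≥0∞) : Ex (PMF.pure σ) f = f σ := by
  classical
  rw [Ex, tsum_eq_single σ]
  · simp
  · intro τ hτ; simp [hτ]

theorem Ex_bind (μ : PMF State) (k : State → PMF State) (f : State → ℝ≥0∞) :
    Ex (μ.bind k) f = Ex μ fun σ => Ex (k σ) f := by
  simp only [Ex, PMF.bind_apply, ← ENNReal.tsum_mul_right, ← ENNReal.tsum_mul_left]
  rw [ENNReal.tsum_comm]
  simp only [mul_assoc]

theorem Ex_mono {μ : PMF State} {f g : State → ℝ≥0∞} (h : ∀ σ ∈ μ.support, f σ ≤ g σ) :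
    Ex μ f ≤ Ex μ g := by
  refine ENNReal.tsum_le_tsum fun σ => ?_
  by_cases hσ : μ σ = 0
  · simp [hσ]
  · gcongr; exact h σ ((PMF.mem_support_iff _ _).2 hσ)

theorem Ex_congr {μ : PMF State} {f g : State → ℝ≥0∞} (h : ∀ σ ∈ μ.support, f σ = g σ) :
    Ex μ f = Ex μ g :=
  le_antisymm (Ex_mono fun σ hσ => (h σ hσ).le) (Ex_mono fun σ hσ => (h σ hσ).ge)

theorem Ex_const (μ : PMF State) (c : ℝ≥0∞) : Ex μ (fun _ => c) = c := by
  rw [Ex, ENNReal.tsum_mul_right, PMF.tsum_coe, one_mul]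

theorem Ex_mul_left (μ : PMF State) (c : ℝ≥0∞) (f : State → ℝ≥0∞) :
    Ex μ (fun σ => c * f σ) = c * Ex μ f := by
  simp only [Ex, ← ENNReal.tsum_mul_left, mul_left_comm]

theorem Ex_mul_right (μ : PMF State) (c : ℝ≥0∞) (f : State → ℝ≥0∞) :
    Ex μ (fun σ => f σ * c) = Ex μ f * c := by
  simp only [Ex, ← ENNReal.tsum_mul_right, mul_assoc]

theorem Ex_add (μ : PMF State) (f g : State → ℝ≥0∞) :
    Ex μ (fun σ => f σ + g σ) = Ex μ f + Ex μ g := by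
  simp only [Ex, mul_add, ENNReal.tsum_add]

/-- The bridge from the Hoare logic to expectations: a quantity that is constant on the reachable
states needs no averaging, since the law has mass one. -/
theorem Ex_eq_of_wp {c : Cmd} {σ : State} {f : State → ℝ≥0∞} {x : ℝ≥0∞}
    (h : wp c (fun τ => f τ = x) σ) : Ex (exec c σ) f = x :=
  (Ex_congr h).trans (Ex_const _ _)

theorem Ex_flip (v : NVar) (σ : State) (f : State → ℝ≥0∞) :
    Ex (exec (.flip v) σ) f =
      (f ((σ.writeN v 0 0 1).tick 1) + f ((σ.writeN v 0 0 0).tick 1)) / 2 := by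
  have : exec (.flip v) σ = (PMF.uniformOfFintype Bool).map
      fun b => (σ.writeN v 0 0 (if b = true then 1 else 0)).tick 1 := rfl
  rw [this, Ex]
  have h (k : Bool → State) : ∑' τ, (PMF.uniformOfFintype Bool).map k τ * f τ =
      ∑ b, 2⁻¹ * f (k b) := by
    simp only [PMF.map_apply, ← ENNReal.tsum_mul_right]
    rw [ENNReal.tsum_comm, tsum_fintype]
    refine Finset.sum_congr rfl fun b _ => ?_
    rw [tsum_eq_single (k b)]
    · simp
    · intro τ hτ; simp [hτ]
  rw [h, Fintype.sum_bool, ← mul_add, div_eq_mul_inv, mul_comm]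
  simp

theorem Ex_seq (c c' : Cmd) (σ : State) (f : State → ℝ≥0∞) :
    Ex (exec (.seq c c') σ) f = Ex (exec c σ) fun τ => Ex (exec c' τ) f := Ex_bind _ _ _

theorem Ex_iterate_succ (body : ℕ → State → PMF State) (σ : State) (m : ℕ) (f : State → ℝ≥0∞) :
    Ex (iterate body σ (m + 1)) f = Ex (iterate body σ m) fun τ => Ex (body m τ) f :=
  Ex_bind _ _ _

/-- Markov's inequality. -/
theorem toOuterMeasure_le_Ex (μ : PMF State) (S : Set State) (f : State → ℝ≥0∞)
    (h : ∀ σ ∈ μ.support, σ ∈ S → 1 ≤ f σ) : μ.toOuterMeasure S ≤ Ex μ f := by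
  rw [PMF.toOuterMeasure_apply, Ex]
  refine ENNReal.tsum_le_tsum fun σ => ?_
  by_cases hσ : μ σ = 0
  · simp [hσ]
  · by_cases hS : σ ∈ S
    · simpa [hS] using mul_le_mul_right (h σ ((PMF.mem_support_iff _ _).2 hσ) hS) (μ σ)
    · simp [hS]

end RealRAM

/-! ### The abstract process: greedy tentative matching and the bookkeeping of roles. -/

namespace FastPostponedGreedy
open RealRAM

/-! ### The tentative matching -/

open Classical in
/-- The first `j < m` in the market with maximal gain, as `j + 1`, and its gain; `(0, 0)` if no
gain is positive. -/
noncomputable def scan (mk : ℕ → Prop) (gain : ℕ → ℝ) : ℕ → ℕ × ℝ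
  | 0 => (0, 0)
  | m + 1 => if mk m ∧ (scan mk gain m).2 < gain m then (m + 1, gain m) else scan mk gain m

theorem scan_spec (mk : ℕ → Prop) (gain : ℕ → ℝ) (m : ℕ) :
    0 ≤ (scan mk gain m).2 ∧ (∀ j < m, mk j → gain j ≤ (scan mk gain m).2) ∧
    (scan mk gain m = (0, 0) ∨
      ∃ j < m, mk j ∧ 0 < gain j ∧ scan mk gain m = (j + 1, gain j)) := by
  induction m with
  | zero => simp [scan]
  | succ m ih =>
    obtain ⟨h0, h1, h2⟩ := ih
    rw [scan]
    split_ifs with h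
    · refine ⟨(h0.trans_lt h.2).le, fun j hj hm => ?_, .inr ⟨m, m.lt_succ_self, h.1, h0.trans_lt h.2, rfl⟩⟩
      rcases Nat.lt_succ_iff_lt_or_eq.1 hj with hj | rfl
      · exact (h1 j hj hm).trans h.2.le
      · exact le_rfl
    · refine ⟨h0, fun j hj hm => ?_, h2.imp_right fun ⟨j, hj, h⟩ => ⟨j, hj.trans m.lt_succ_self, h⟩⟩
      rcases Nat.lt_succ_iff_lt_or_eq.1 hj with hj | rfl
      · exact h1 j hj hm
      · exact not_lt.1 fun h' => h ⟨hm, h'⟩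

/-- The tentative matching: `mate i = l + 1` if the seller copy of `i` is matched to `l`, and the
values of the seller copies. -/
structure Tentative where
  mate : ℕ → ℕ
  w : ℕ → ℝ

/-- The tentative matching after `b = j + 1` has been proposed to buyer `t`. -/
noncomputable def Tentative.assign (T : Tentative) (t b : ℕ) (e : ℕ → ℝ) : Tentative :=
  if b = 0 then T else
    ⟨Function.update T.mate (b - 1) (t + 1), Function.update T.w (b - 1) (max (T.w (b - 1)) (e (b - 1)))⟩

/-- The tentative matching at time `t`, for the estimates `e j i` of the distance of buyer `j`
and seller `i`. It does not depend on the roles. -/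
noncomputable def tent (n : ℕ) (dl : ℕ → ℕ) (e : ℕ → ℕ → ℝ) : ℕ → Tentative
  | 0 => ⟨fun _ => 0, fun _ => 0⟩
  | t + 1 =>
    if t < n then
      (tent n dl e t).assign t
        (scan (fun j => t < dl j) (fun j => e t j - (tent n dl e t).w j) (t + 1)).1 (e t)
    else tent n dl e t

section Tent

variable {n : ℕ} {dl : ℕ → ℕ} {e : ℕ → ℕ → ℝ}

/-- The `max` in `Tentative.assign` makes this immediate, without an appeal to the positivity of the
chosen gain. -/
theorem tent_w_le_succ (t i : ℕ) : (tent n dl e t).w i ≤ (tent n dl e (t + 1)).w i := by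
  rw [tent, Tentative.assign]
  split_ifs
  · exact le_rfl
  · dsimp only
    rw [Function.update_apply]
    split_ifs with h
    · subst h; exact le_max_left _ _
    · exact le_rfl
  · exact le_rfl

theorem tent_w_mono (i : ℕ) : Monotone fun t => (tent n dl e t).w i :=
  monotone_nat_of_le_succ fun t => tent_w_le_succ t i

theorem tent_w_nonneg (t i : ℕ) : 0 ≤ (tent n dl e t).w i := tent_w_mono i (Nat.zero_le t)

/-- The dichotomy behind all later arguments. In the second case the gain is positive, so the `max`
is the new estimate. -/
theorem tent_step (he : ∀ t, e t t = 0) (t : ℕ) :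
    (tent n dl e (t + 1) = tent n dl e t ∧
      (t < n → ∀ i < t, t < dl i → e t i ≤ (tent n dl e t).w i)) ∨
    (t < n ∧ ∃ j < t, t < dl j ∧ (tent n dl e t).w j < e t j ∧
      tent n dl e (t + 1) = ⟨Function.update (tent n dl e t).mate j (t + 1),
        Function.update (tent n dl e t).w j (e t j)⟩ ∧
      ∀ i < t, t < dl i → e t i - (tent n dl e t).w i ≤ e t j - (tent n dl e t).w j) := by
  by_cases ht : t < n
  · obtain ⟨-, h1, h2⟩ := scan_spec (fun j => t < dl j) (fun j => e t j - (tent n dl e t).w j) (t + 1)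
    rw [tent, if_pos ht, Tentative.assign]
    rcases h2 with h2 | ⟨j, hj, hm, hg, h2⟩
    · left
      rw [h2] at h1 ⊢
      exact ⟨if_pos rfl, fun _ i hi hd => by linarith [h1 i (by omega) hd]⟩
    · right
      -- The scan includes the arriving point itself; its estimate is zero and its value
      -- nonnegative, so its gain is not positive.
      have hjt : j ≠ t := by
        rintro rfl
        rw [he] at hg
        linarith [tent_w_nonneg (n := n) (dl := dl) (e := e) j j]
      rw [h2] at h1 ⊢
      refine ⟨ht, j, by omega, hm, by linarith, ?_, fun i hi hd => h1 i (by omega) hd⟩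
      rw [if_neg (by simp), add_tsub_cancel_right, max_eq_right (by linarith)]
  · left
    rw [tent, if_neg ht]
    exact ⟨rfl, fun h => absurd h ht⟩

/-- A step touches only the chosen seller and gives it the arriving buyer together with its
estimate; all other pairs inherit the claims from the previous time. -/
theorem tent_mate (he : ∀ t, e t t = 0) {t i l : ℕ} (h : (tent n dl e t).mate i = l + 1) :
    i < l ∧ l < t ∧ l < n ∧ l < dl i ∧ (tent n dl e t).w i = e l i := by
  induction t with
  | zero => simp [tent] at h
  | succ t ih =>
    rcases tent_step (n := n) (dl := dl) he t with ⟨h', -⟩ | ⟨ht, j, hj, hd, -, h', -⟩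
    · rw [h'] at h ⊢
      obtain ⟨h1, h2, h3⟩ := ih h
      exact ⟨h1, by omega, h3⟩
    · rw [h'] at h ⊢
      by_cases hij : i = j
      · subst hij
        simp only [Function.update_self, add_left_inj] at h ⊢
        subst h
        exact ⟨hj, by omega, ht, hd, rfl⟩
      · simp only [Function.update_of_ne hij] at h ⊢
        obtain ⟨h1, h2, h3⟩ := ih h
        exact ⟨h1, by omega, h3⟩

theorem tent_mate_zero (he : ∀ t, e t t = 0) {t i : ℕ} (h : (tent n dl e t).mate i = 0) :
    (tent n dl e t).w i = 0 := by
  induction t with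
  | zero => rfl
  | succ t ih =>
    rcases tent_step (n := n) (dl := dl) he t with ⟨h', -⟩ | ⟨ht, j, hj, hd, -, h', -⟩
    · rw [h'] at h ⊢; exact ih h
    · rw [h'] at h ⊢
      by_cases hij : i = j
      · subst hij; simp at h
      · simp only [Function.update_of_ne hij] at h ⊢; exact ih h

/-- A buyer is proposed to one seller only, at its arrival. A collision would need an older pair
that already contains the arriving buyer, against the bound on mates in `tent_mate`. -/
theorem tent_mate_inj (he : ∀ t, e t t = 0) {t i i' : ℕ} (h0 : (tent n dl e t).mate i ≠ 0)
    (h : (tent n dl e t).mate i = (tent n dl e t).mate i') : i = i' := by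
  induction t with
  | zero => simp [tent] at h0
  | succ t ih =>
    rcases tent_step (n := n) (dl := dl) he t with ⟨h', -⟩ | ⟨ht, j, hj, hd, -, h', -⟩
    · rw [h'] at h h0; exact ih h0 h
    · have hne (k : ℕ) : (tent n dl e t).mate k ≠ t + 1 := fun hk =>
        lt_irrefl _ (tent_mate he hk).2.1
      rw [h'] at h h0
      by_cases hij : i = j <;> by_cases hij' : i' = j
      · rw [hij, hij']
      · subst hij
        simp only [Function.update_self, Function.update_of_ne hij'] at h
        exact absurd h.symm (hne _)
      · subst hij'
        simp only [Function.update_self, Function.update_of_ne hij] at h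
        exact absurd h (hne _)
      · simp only [Function.update_of_ne hij, Function.update_of_ne hij'] at h h0
        exact ih h0 h

/-- The scan skips sellers whose deadline has come. So what is finalized at a departure stays
correct later. -/
theorem tent_frozen (he : ∀ t, e t t = 0) {t i : ℕ} (h : dl i ≤ t) :
    (tent n dl e (t + 1)).mate i = (tent n dl e t).mate i ∧
      (tent n dl e (t + 1)).w i = (tent n dl e t).w i := by
  rcases tent_step (n := n) (dl := dl) he t with ⟨h', -⟩ | ⟨ht, j, hj, hd, -, h', -⟩
  · rw [h']; exact ⟨rfl, rfl⟩
  · have : i ≠ j := by rintro rfl; omega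
    rw [h']
    simp [Function.update_of_ne this]

theorem tent_unarrived (he : ∀ t, e t t = 0) {t i : ℕ} (h : t ≤ i) :
    (tent n dl e t).mate i = 0 ∧ (tent n dl e t).w i = 0 := by
  have : (tent n dl e t).mate i = 0 := by
    rcases Nat.eq_zero_or_eq_succ_pred ((tent n dl e t).mate i) with h0 | h0
    · exact h0
    · have := tent_mate he h0; omega
  exact ⟨this, tent_mate_zero he this⟩

end Tent

/-! ### Greedy is 2-competitive for the tentative matching -/

section Greedy

variable {n d : ℕ}

/-- Deadlines, indexed by natural numbers. -/
def Input.dl (I : Input n d) (i : ℕ) : ℕ := if h : i < n then I.deadline ⟨i, h⟩ else 0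

theorem Input.dl_fin (I : Input n d) (i : Fin n) : I.dl i = I.deadline i := by
  simp [Input.dl]

theorem Input.lt_dl (I : Input n d) {i : ℕ} (hi : i < n) : i < I.dl i := by
  rw [Input.dl, dif_pos hi]; exact I.arrival_lt_deadline ⟨i, hi⟩

theorem Input.dl_mono (I : Input n d) {i j : ℕ} (hij : i ≤ j) (hj : j < n) : I.dl i ≤ I.dl j := by
  rw [Input.dl, Input.dl, dif_pos hj, dif_pos (by omega)]
  exact I.deadline_mono hij

variable (I : Input n d) {e : ℕ → ℕ → ℝ}

/-- The charging argument. Either the value of i at the arrival of j already covers the estimate, or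
the chosen gain covers the difference; only one seller changes, so this gain is bounded by the sum
of all increments. Monotonicity carries the value of i on to time T. -/
theorem tent_edge (he : ∀ t, e t t = 0) {i j : Fin n} {T : ℕ} (hij : i < j)
    (hj : (j : ℕ) < I.deadline i) (hT : (j : ℕ) ≤ T) :
    e j i ≤ (tent n I.dl e T).w i +
      ∑ k : Fin n, ((tent n I.dl e (j + 1)).w k - (tent n I.dl e j).w k) := by
  have hpos (k : Fin n) : 0 ≤ (tent n I.dl e (j + 1)).w k - (tent n I.dl e j).w k :=
    sub_nonneg.2 (tent_w_le_succ _ _)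
  have hW := tent_w_mono (n := n) (dl := I.dl) (e := e) i hT
  dsimp only at hW
  rw [← I.dl_fin] at hj
  rcases tent_step (n := n) (dl := I.dl) he j with ⟨-, h⟩ | ⟨-, k, hk, -, -, h', h⟩
  · have := h j.2 i hij hj
    have := Finset.sum_nonneg fun k (_ : k ∈ Finset.univ) => hpos k
    linarith
  · have h1 := h i hij hj
    have h2 := Finset.single_le_sum (fun k _ => hpos k) (Finset.mem_univ (⟨k, by omega⟩ : Fin n))
    simp only [h', Function.update_self] at h2 ⊢
    linarith

/-- The seller raised by j arrived before j, hence leaves no later than j. Without monotone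
deadlines the growth caused by j could sit on a seller that is still in the market. -/
theorem tent_gain_of_not_left (he : ∀ t, e t t = 0) {i j : Fin n} {T : ℕ} (hj : I.left T j)
    (hi : ¬ I.left T i) : (tent n I.dl e (j + 1)).w i = (tent n I.dl e j).w i := by
  rcases tent_step (n := n) (dl := I.dl) he j with ⟨h, -⟩ | ⟨-, k, hk, -, -, h', -⟩
  · rw [h]
  · have : (i : ℕ) ≠ k := by
      rintro rfl
      exact hi ((I.deadline_mono (le_of_lt (show i < j from hk))).trans_lt hj)
    rw [h']
    simp [Function.update_of_ne this]

open Classical in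
-- Summing `tent_edge` over the matching: sellers are charged at most once with their value, buyers
-- at most once with the growth they cause.
theorem tent_competitive (he : ∀ t, e t t = 0) {T : ℕ} {S : Finset (Fin n × Fin n)}
    (hS : I.IsMatching S) (hl : ∀ p ∈ S, I.left T p.1 ∧ I.left T p.2) :
    ∑ p ∈ S, e p.2 p.1 ≤ 2 * ∑ i : Fin n, if I.left T i then (tent n I.dl e T).w i else 0 := by
  have hlt (j : Fin n) (hj : I.left T j) : (j : ℕ) < T := (I.arrival_lt_deadline j).trans hj
  -- An endpoint determines its pair in a matching, so a sum over pairs becomes part of a sum over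
  -- the points that have left; used for both endpoints.
  have hinj {f : Fin n × Fin n → Fin n} {g : Fin n → ℝ} (hg : ∀ i, 0 ≤ g i)
      (hf : ∀ p ∈ S, ∀ q ∈ S, f p = f q → p = q) (hfl : ∀ p ∈ S, I.left T (f p)) :
      ∑ p ∈ S, g (f p) ≤ ∑ i : Fin n, if I.left T i then g i else 0 := by
    rw [← Finset.sum_image (f := g) (fun p hp q hq => hf p hp q hq), ← Finset.sum_filter]
    refine Finset.sum_le_sum_of_subset_of_nonneg (fun i hi => ?_) fun i _ _ => hg i
    obtain ⟨p, hp, rfl⟩ := Finset.mem_image.1 hi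
    simpa using hfl p hp
  have h1 : ∑ p ∈ S, (tent n I.dl e T).w p.1 ≤ _ :=
    hinj (f := Prod.fst) (g := fun i => (tent n I.dl e T).w i) (fun i => tent_w_nonneg _ _)
      (fun p hp q hq h => by_contra fun hne => (hS.2 p hp q hq hne).1 h) fun p hp => (hl p hp).1
  have h2 : ∑ p ∈ S, ∑ k : Fin n, ((tent n I.dl e (p.2 + 1)).w k - (tent n I.dl e p.2).w k) ≤ _ :=
    hinj (f := Prod.snd)
      (g := fun j => ∑ k : Fin n, ((tent n I.dl e (j + 1)).w k - (tent n I.dl e j).w k))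
      (fun j => Finset.sum_nonneg fun k _ => sub_nonneg.2 (tent_w_le_succ _ _))
      (fun p hp q hq h => by_contra fun hne => (hS.2 p hp q hq hne).2.2.2 h) fun p hp => (hl p hp).2
  -- After the sums are exchanged, the increments of each seller that has left telescope to its
  -- value at time T; buyers that have not left only omit nonnegative terms.
  have h3 : (∑ j : Fin n, if I.left T j then
      ∑ k : Fin n, ((tent n I.dl e (j + 1)).w k - (tent n I.dl e j).w k) else 0) ≤
      ∑ i : Fin n, if I.left T i then (tent n I.dl e T).w i else 0 := by
    have : ∀ j : Fin n, (if I.left T j then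
        ∑ k : Fin n, ((tent n I.dl e (j + 1)).w k - (tent n I.dl e j).w k) else 0) =
        ∑ k : Fin n, if I.left T j ∧ I.left T k then
          ((tent n I.dl e (j + 1)).w k - (tent n I.dl e j).w k) else 0 := fun j => by
      split_ifs with hj
      · refine Finset.sum_congr rfl fun k _ => ?_
        split_ifs with hk
        · rfl
        · rw [tent_gain_of_not_left I he hj (fun h => hk ⟨hj, h⟩), sub_self]
      · simp [hj]
    simp only [this]
    rw [Finset.sum_comm]
    refine Finset.sum_le_sum fun k _ => ?_
    split_ifs with hk
    · simp only [hk, and_true]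
      rw [← Finset.sum_filter]
      have := Finset.sum_range_sub (fun j => (tent n I.dl e j).w k) T
      have h0 : (tent n I.dl e 0).w k = 0 := rfl
      rw [h0, sub_zero] at this
      rw [← this, ← Finset.sum_image
        (f := fun j : ℕ => (tent n I.dl e (j + 1)).w k - (tent n I.dl e j).w k)
        (g := fun j : Fin n => (j : ℕ)) (fun a _ b _ h => Fin.ext h)]
      refine Finset.sum_le_sum_of_subset_of_nonneg (fun j hj => ?_) fun j _ _ =>
        sub_nonneg.2 (tent_w_le_succ _ _)
      obtain ⟨j, hj', rfl⟩ := Finset.mem_image.1 hj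
      simpa using hlt j (Finset.mem_filter.1 hj').2
    · simp [hk]
  have h4 : ∑ p ∈ S, e p.2 p.1 ≤ ∑ p ∈ S, ((tent n I.dl e T).w p.1 +
      ∑ k : Fin n, ((tent n I.dl e (p.2 + 1)).w k - (tent n I.dl e p.2).w k)) :=
    Finset.sum_le_sum fun p hp =>
      tent_edge I he (hS.1 p hp).1 (hS.1 p hp).2 (hlt _ (hl p hp).2).le
  rw [Finset.sum_add_distrib] at h4
  linarith

end Greedy

/-! ### Roles, finalized matches and the matching value -/

open Classical in
/-- The books of the market: roles, finalized matches and matching value, when the points in `L`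
have left and the tentative matching is `T`. -/
structure Ledger (n : ℕ) (T : Tentative) (L : ℕ → Prop) (role final : ℕ → ℕ) (p : ℝ) : Prop where
  role_le : ∀ i, role i ≤ 2
  decided : ∀ i, L i → role i ≠ 0
  pending : ∀ l, role l ≠ 0 → L l ∨ ∃ i, L i ∧ T.mate i = l + 1
  final_eq : ∀ i, L i → role i = 1 → final i = T.mate i
  buyer : ∀ i, L i → role i = 1 → ∀ l, T.mate i = l + 1 → role l = 2
  of_final : ∀ i, final i ≠ 0 → L i ∧ role i = 1
  value : p = ∑ i ∈ Finset.range n, if L i ∧ role i = 1 then T.w i else 0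

/-- The books read the tentative matching only at points that have left, so new assignments to
sellers still in the market do not disturb them. -/
theorem Ledger.congr {n : ℕ} {T T' : Tentative} {L L' : ℕ → Prop} {role final : ℕ → ℕ} {p : ℝ}
    (h : Ledger n T L role final p) (hL : ∀ i, L i ↔ L' i)
    (hT : ∀ i, L i → T'.mate i = T.mate i ∧ T'.w i = T.w i) : Ledger n T' L' role final p := by
  obtain rfl : L = L' := funext fun i => propext (hL i)
  refine ⟨h.role_le, h.decided, fun l hl => ?_, fun i hi hr => ?_, fun i hi hr l hm => ?_,
    h.of_final, ?_⟩
  · exact (h.pending l hl).imp_right fun ⟨i, hi, hm⟩ => ⟨i, hi, (hT i hi).1.trans hm⟩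
  · rw [(hT i hi).1, h.final_eq i hi hr]
  · exact h.buyer i hi hr l ((hT i hi).1.symm.trans hm)
  · rw [h.value]
    refine Finset.sum_congr rfl fun i _ => ?_
    split_ifs with hi
    · exact (hT i hi.1).2.symm
    · rfl

/-- Point `i` leaves with role `r`. -/
theorem Ledger.leave {n : ℕ} {T : Tentative} {L : ℕ → Prop} {role final : ℕ → ℕ} {p : ℝ}
    (h : Ledger n T L role final p) {i r : ℕ} (hin : i < n) (hi : ¬ L i)
    (hr : r = 1 ∨ r = 2) (hri : role i = 0 ∨ role i = r)
    (hinj : ∀ j, T.mate i ≠ 0 → T.mate i = T.mate j → i = j)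
    (hlt : ∀ l, T.mate i = l + 1 → i < l) (hL : ∀ l, i < l → ¬ L l)
    (hw : T.mate i = 0 → T.w i = 0) {role' final' : ℕ → ℕ} {p' : ℝ}
    (hrole : ∀ k, role' k = if T.mate i ≠ 0 ∧ k = T.mate i - 1 then (if r = 1 then 2 else 1)
      else if k = i then r else role k)
    (hfinal : ∀ k, final' k = if T.mate i ≠ 0 ∧ r = 1 ∧ k = i then T.mate i else final k)
    (hp : p' = p + if T.mate i ≠ 0 ∧ r = 1 then T.w i else 0) :
    Ledger n T (fun k => L k ∨ k = i) role' final' p' ∧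
      (∀ k, role k ≠ 0 → role' k = role k) ∧ (∀ k, final k ≠ 0 → final' k = final k) := by
  -- By `pending`, a partner with a role would have left, although it comes after i, or be
  -- tentatively matched to a seller that has left; by injectivity that seller would be i itself.
  have hmate (l : ℕ) (hl : T.mate i = l + 1) : role l = 0 := by
    by_contra h0
    rcases h.pending l h0 with h1 | ⟨j, hj, hm⟩
    · exact hL l (hlt l hl) h1
    · exact hi (hinj j (by omega) (by omega) ▸ hj)
  have hri' : role' i = r := by
    rw [hrole, if_neg, if_pos rfl]
    rintro ⟨h0, h1⟩
    have := hlt (T.mate i - 1) (by omega)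
    omega
  have hkeep (k : ℕ) (hk : role k ≠ 0) : role' k = role k := by
    rw [hrole, if_neg]
    · split_ifs with hki
      · subst hki; omega
      · rfl
    · rintro ⟨h0, rfl⟩
      exact hk (hmate _ (by omega))
  have hfi : final i = 0 := by
    by_contra h0
    exact hi (h.of_final i h0).1
  refine ⟨⟨fun k => ?_, fun k hk => ?_, fun k hk => ?_, fun k hk hrk => ?_, fun k hk hrk l hl => ?_,
    fun k hk => ?_, ?_⟩, hkeep, fun k hk => ?_⟩
  · rw [hrole]
    have := h.role_le k
    split_ifs <;> omega
  · rcases hk with hk | rfl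
    · rw [hkeep k (h.decided k hk)]; exact h.decided k hk
    · omega
  · rw [hrole] at hk
    split_ifs at hk with h1 h2 h3
    · exact .inr ⟨i, .inr rfl, by omega⟩
    · exact .inr ⟨i, .inr rfl, by omega⟩
    · exact .inl (.inr h3)
    · exact (h.pending k hk).imp .inl fun ⟨j, hj, hm⟩ => ⟨j, .inl hj, hm⟩
  · rw [hfinal]
    rcases hk with hk | rfl
    · rw [if_neg (fun h' : _ ∧ _ ∧ k = i => hi (h'.2.2 ▸ hk)), h.final_eq k hk (by rw [← hkeep k (h.decided k hk), hrk])]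
    · split_ifs with h1
      · rfl
      · rw [hfi]; omega
  · rcases hk with hk | rfl
    · have := h.buyer k hk (by rw [← hkeep k (h.decided k hk), hrk]) l hl
      rw [hkeep l (by omega), this]
    · rw [hrole, if_pos (by omega), if_pos (by omega)]
  · rw [hfinal] at hk
    split_ifs at hk with h1
    · exact ⟨.inr h1.2.2, by rw [h1.2.2, hri', h1.2.1]⟩
    · have := h.of_final k hk
      exact ⟨.inl this.1, by rw [hkeep k (by omega), this.2]⟩
  · rw [hp, h.value, ← Finset.sum_erase_add _ _ (Finset.mem_range.2 hin),
      ← Finset.sum_erase_add (a := i) (Finset.range n) _ (Finset.mem_range.2 hin)]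
    rw [if_neg (fun h' => hi h'.1), add_zero]
    congr 1
    · refine Finset.sum_congr rfl fun k hk => ?_
      have hki := Finset.ne_of_mem_erase hk
      by_cases hLk : L k
      · simp [hLk, hkeep k (h.decided k hLk)]
      · simp [hLk, hki]
    -- A seller without a tentative match has value 0, so not adding to p agrees with the formula.
    · by_cases hr1 : r = 1
      · by_cases h0 : T.mate i = 0
        · simp [h0, hw h0]
        · simp [h0, hr1, hri']
      · simp [hr1, hri']
  · rw [hfinal, if_neg]
    rintro ⟨-, -, rfl⟩
    exact hk hfi

end FastPostponedGreedy

/-! ### What arrival, query and tentative assignment do to the memory. -/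

namespace FastPostponedGreedy
open RealRAM

attribute [local simp] nreg rreg setNreg setRreg nat1 real1 setN1 setR1 NExpr.eval RExpr.eval
  BExpr.holds writeN_nat writeR_real wp_block_nil wp_block_cons

/-! ### Memory cells -/

/-- The integer names. -/
def natNames : Finset NVar := {.n, .d, .s, .now, .cnt, .cur, .due, .a, .i, .j, .k, .l, .best,
  .coin, .deadline, .role, .mate, .final, .market}

/-- The real names. -/
def realNames : Finset RVar := {.eps, .delta, .scale, .acc, .inc, .p, .out, .input, .M, .X, .Y,
  .w, .est}

/-- The cells that the data structure uses. -/
def room (n d s : ℕ) : Finset ((NVar ⊕ RVar) × ℕ × ℕ) :=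
  (natNames.disjSum realNames) ×ˢ Finset.range n ×ˢ {0} ∪
  {Sum.inr .M} ×ˢ Finset.range s ×ˢ Finset.range d ∪
  {Sum.inr .X} ×ˢ Finset.range n ×ˢ Finset.range d ∪
  {Sum.inr .Y} ×ˢ Finset.range n ×ˢ Finset.range s ∪
  {Sum.inr .input} ×ˢ Finset.range d ×ˢ {0}

theorem room_card (n d s : ℕ) : (room n d s).card ≤ 32 * n + s * d + n * d + n * s + d := by
  have hN : natNames.card = 19 := by decide
  have hR : realNames.card = 13 := by decide
  refine (Finset.card_union_le _ _).trans ?_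
  refine (Nat.add_le_add_right (Finset.card_union_le _ _) _).trans ?_
  refine (Nat.add_le_add_right (Nat.add_le_add_right (Finset.card_union_le _ _) _) _).trans ?_
  refine (Nat.add_le_add_right (Nat.add_le_add_right (Nat.add_le_add_right
    (Finset.card_union_le _ _) _) _) _).trans ?_
  simp only [Finset.card_product, Finset.card_disjSum, hN, hR, Finset.card_range,
    Finset.card_singleton]
  omega

variable {n d s : ℕ}

theorem room_nat {v : NVar} {i : ℕ} (hi : i < n) : (Sum.inl v, i, 0) ∈ room n d s := by
  have : v ∈ natNames := by cases v <;> decide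
  simp [room, hi, this]

theorem room_real {v : RVar} {i : ℕ} (hi : i < n) : (Sum.inr v, i, 0) ∈ room n d s := by
  have : v ∈ realNames := by cases v <;> decide
  simp [room, hi, this]

theorem room_M {a k : ℕ} (ha : a < s) (hk : k < d) : (Sum.inr .M, a, k) ∈ room n d s := by
  simp [room, ha, hk]

theorem room_X {i k : ℕ} (hi : i < n) (hk : k < d) : (Sum.inr .X, i, k) ∈ room n d s := by
  simp [room, hi, hk]

theorem room_Y {i a : ℕ} (hi : i < n) (ha : a < s) : (Sum.inr .Y, i, a) ∈ room n d s := by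
  simp [room, hi, ha]

theorem room_input {k : ℕ} (hk : k < d) : (Sum.inr .input, k, 0) ∈ room n d s := by
  simp [room, hk]

/-! ### Loading a point -/

/-- The disjunction in the fifth claim carries the induction: a coordinate written first may be
written again later, but only with the same value. -/
theorem foldl_writeR (y : EuclideanSpace ℝ (Fin d)) (l : List (Fin d)) (σ : State) :
    let τ := l.foldl (fun (τ : State) (k : Fin d) => τ.writeR .input k 0 (y k)) σ
    τ.nat = σ.nat ∧ τ.time = σ.time ∧ (∀ v, v ≠ .input → τ.real v = σ.real v) ∧
    (∀ k ∈ l, τ.real .input k 0 = y k) ∧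
    (∀ k : Fin d, τ.real .input k 0 = σ.real .input k 0 ∨ τ.real .input k 0 = y k) ∧
    (σ.cells ⊆ room n d s → τ.cells ⊆ room n d s) := by
  induction l generalizing σ with
  | nil => simp
  | cons j l ih =>
    obtain ⟨h1, h2, h3, h4, h5, h6⟩ := ih (σ.writeR .input j 0 (y j))
    simp only [List.foldl_cons]
    refine ⟨h1, h2, fun v hv => (h3 v hv).trans (writeR_real_of_ne _ _ _ _ hv), fun k hk => ?_,
      fun k => ?_, fun h => h6 ?_⟩
    · rcases List.mem_cons.1 hk with rfl | hk
      · rcases h5 k with h | h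
        · rw [h]; simp
        · exact h
      · exact h4 k hk
    · rcases h5 k with h | h
      · rw [h, writeR_real]
        split_ifs with hk
        · right; rw [Fin.ext hk.2.1]
        · left; rfl
      · exact .inr h
    · exact Finset.insert_subset (room_input j.2) h

theorem load_spec (y : EuclideanSpace ℝ (Fin d)) (t : ℕ) (σ : State) (hn : 0 < n) :
    (load y t σ).nat = (σ.writeN .due 0 0 t).nat ∧ (load y t σ).time = σ.time ∧
    (∀ v, v ≠ .input → (load y t σ).real v = σ.real v) ∧
    (∀ k : Fin d, (load y t σ).real .input k 0 = y k) ∧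
    (σ.cells ⊆ room n d s → (load y t σ).cells ⊆ room n d s) := by
  obtain ⟨h1, h2, h3, h4, -, h6⟩ := foldl_writeR (n := n) (s := s) y (List.finRange d) (σ.writeN .due 0 0 t)
  exact ⟨h1, h2, h3, fun k => h4 k (List.mem_finRange k),
    fun h => h6 (Finset.insert_subset (room_nat hn) h)⟩

/-! ### Arrival -/

theorem arrive_spec (σ : State) {c : ℕ} (hc : σ.nat .cnt 0 0 = c) (hd : σ.nat .d 0 0 = d)
    (hs : σ.nat .s 0 0 = s) (hcn : c < n) (hcells : σ.cells ⊆ room n d s) :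
    wp arrive (fun τ => τ.nat .cur 0 0 = c ∧ τ.nat .cnt 0 0 = c + 1 ∧
      (∀ i, τ.nat .deadline i 0 = if i = c then σ.nat .due 0 0 else σ.nat .deadline i 0) ∧
      (∀ i, τ.nat .role i 0 = if i = c then 0 else σ.nat .role i 0) ∧
      (∀ i, τ.nat .mate i 0 = if i = c then 0 else σ.nat .mate i 0) ∧
      (∀ i, τ.nat .final i 0 = if i = c then 0 else σ.nat .final i 0) ∧
      (∀ i, τ.nat .market i 0 = if i = c then 1 else σ.nat .market i 0) ∧
      (∀ i, τ.real .w i 0 = if i = c then 0 else σ.real .w i 0) ∧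
      (∀ i a, τ.real .Y i a = if i = c ∧ a < s then
        ∑ k ∈ Finset.range d, σ.real .M a k * σ.real .input k 0 else σ.real .Y i a) ∧
      τ.cells ⊆ room n d s) σ := by
  have hn : 0 < n := by omega
  simp only [arrive, wp_block_cons, setNreg, setN1, setR1, wp_setN]
  refine wp_loop (fun m τ => (∀ k < m, τ.real .X c k = σ.real .input k 0) ∧
    τ.cells ⊆ room n d s) ?_ (fun m hm τ hF hJ => ?_) fun τ hF hJ => ?_
  · refine ⟨by simp, ?_⟩
    simp only [tick_cells, writeN_cells, NExpr.eval]
    exact Finset.insert_subset (room_nat hn) (Finset.insert_subset (room_nat hn) hcells)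
  · have h1 := hF.nat .cur (by decide)
    have h2 := hF.real .input (by decide)
    simp [hd] at hm
    simp only [wp_setR]
    refine ⟨fun k hk => ?_, ?_⟩
    · by_cases hkm : k = m
      · simp [h1, h2, hkm, hc]
      · simp [hkm, h1, hc]; exact hJ.1 k (by omega)
    · simp only [tick_cells, writeN_cells, writeR_cells]
      refine Finset.insert_subset ?_ (Finset.insert_subset (room_nat hn) hJ.2)
      simp [h1, hc]; exact room_X hcn hm
  simp [hd] at hJ
  have fn (v : NVar) (hv : v ≠ .k ∧ v ≠ .cur ∧ v ≠ .cnt) : τ.nat v = σ.nat v := by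
    rw [hF.nat v (by simp [Cmd.wN, hv])]
    funext i j; simp [hv]
  have fr (v : RVar) (hv : v ≠ .X) : τ.real v = σ.real v := by
    rw [hF.real v (by simp [Cmd.wR, hv])]
    funext i j; simp
  have hcur : τ.nat .cur 0 0 = c := by rw [hF.nat .cur (by decide)]; simp [hc]
  have hcnt : τ.nat .cnt 0 0 = c + 1 := by rw [hF.nat .cnt (by decide)]; simp [hc]
  obtain ⟨hX, hcells'⟩ := hJ
  simp only [wp_block_cons, wp_setN]
  refine wp_loop (fun m ρ => (∀ i a, ρ.real .Y i a = if i = c ∧ a < m then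
        ∑ k ∈ Finset.range d, σ.real .M a k * σ.real .input k 0 else σ.real .Y i a) ∧
    ρ.cells ⊆ room n d s) ?_ (fun m hm ρ hF' hJ => ?_) fun ρ hF' hJ => ?_
  · refine ⟨by simp [fr], ?_⟩
    simp only [tick_cells, writeN_cells]
    refine Finset.insert_subset ?_ (Finset.insert_subset ?_ hcells') <;>
    · simp [hcur]; exact room_nat hcn
  · simp [fn, hs] at hm
    have h1 : ρ.nat .cur 0 0 = c := by rw [hF'.nat .cur (by decide)]; simp [hcur]
    have h2 : ρ.nat .d 0 0 = d := by rw [hF'.nat .d (by decide)]; simp [fn, hd]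
    have h3 : ρ.real .M = σ.real .M := by rw [hF'.real .M (by decide)]; simp [fr]
    have h4 (k : ℕ) (hk : k < d) : ρ.real .X c k = σ.real .input k 0 := by
      rw [hF'.real .X (by decide)]; simp [hX k hk]
    simp only [wp_block_cons, setRreg, wp_setR]
    -- The accumulator holds the partial inner product of row m of the matrix with the new point.
    refine wp_loop (fun q π => π.real .acc 0 0 =
        ∑ k ∈ Finset.range q, σ.real .M m k * σ.real .input k 0 ∧ π.cells ⊆ room n d s)
      ?_ (fun q hq π hG hK => ?_) fun π hG hK => ?_
    · refine ⟨by simp, ?_⟩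
      simp only [tick_cells, writeN_cells, writeR_cells, NExpr.eval]
      exact Finset.insert_subset (room_real hn) (Finset.insert_subset (room_nat hn) hJ.2)
    · have g1 : π.nat .cur 0 0 = c := by rw [hG.nat .cur (by decide)]; simp [h1]
      have g2 : π.nat .a 0 0 = m := by rw [hG.nat .a (by decide)]; simp
      have g3 : π.real .M = σ.real .M := by
        rw [hG.real .M (by decide), ← h3]; funext i j; simp
      have hqd : q < d := by simpa [h2] using hq
      have g4 : π.real .X c q = σ.real .input q 0 := by
        rw [hG.real .X (by decide)]; simp [h4 q hqd]
      simp only [wp_setR]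
      refine ⟨?_, ?_⟩
      · simp [g1, g2, g3, g4, hK.1, Finset.sum_range_succ]
      · simp only [tick_cells, writeN_cells, writeR_cells, NExpr.eval]
        exact Finset.insert_subset (room_real hn) (Finset.insert_subset (room_nat hn) hK.2)
    · have g1 : π.nat .cur 0 0 = c := by rw [hG.nat .cur (by decide)]; simp [h1]
      have g2 : π.nat .a 0 0 = m := by rw [hG.nat .a (by decide)]; simp
      have g3 : π.real .Y = ρ.real .Y := by
        rw [hG.real .Y (by decide)]; funext i j; simp
      simp [h2] at hK
      simp only [wp_block_cons, wp_block_nil, wp_setR]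
      refine ⟨fun i a => ?_, ?_⟩
      · simp only [tick_real, writeR_real, NExpr.eval, nreg, g1, g2, g3, hJ.1, rreg, RExpr.eval, hK.1]
        by_cases hi : i = c
        · by_cases ha : a = m
          · simp [hi, ha]
          · have : a < m + 1 ↔ a < m := by omega
            simp [hi, ha, this]
        · simp [hi]
      · simp only [tick_cells, writeR_cells]
        refine Finset.insert_subset ?_ hK.2
        simp [g1, g2]; exact room_Y hcn hm
  · have h1 : ρ.nat .cur 0 0 = c := by rw [hF'.nat .cur (by decide)]; simp [hcur]
    have gn (v : NVar) (hv : v ≠ .k ∧ v ≠ .a ∧ v ≠ .deadline ∧ v ≠ .role) : ρ.nat v = τ.nat v := by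
      rw [hF'.nat v (by simp [Cmd.wN, block, hv])]
      funext i j; simp [hv]
    have g2 : ρ.nat .role = fun i j => if i = c ∧ j = 0 then 0 else σ.nat .role i j := by
      rw [hF'.nat .role (by decide)]; funext i j; simp [hcur, fn]
    have g3 : ρ.nat .deadline = fun i j => if i = c ∧ j = 0 then σ.nat .due 0 0
        else σ.nat .deadline i j := by
      rw [hF'.nat .deadline (by decide)]; funext i j; simp [hcur, fn]
    have g4 : ρ.real .w = σ.real .w := by
      rw [hF'.real .w (by decide), ← fr .w (by decide)]; rfl
    simp [fn, hs] at hJ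
    simp only [wp_block_cons, wp_block_nil, wp_setN, wp_setR]
    simp [h1, gn, g2, g3, g4, fn, hcnt, hJ.1]
    refine Finset.insert_subset (room_nat hcn) (Finset.insert_subset (room_real hcn)
      (Finset.insert_subset (room_nat hcn) (Finset.insert_subset (room_nat hcn) hJ.2)))

/-! ### Queries -/

/-- The distance of two sketches. -/
noncomputable def sketchDist (s : ℕ) (y z : ℕ → ℝ) : ℝ :=
  Real.sqrt (∑ a ∈ Finset.range s, (y a - z a) * (y a - z a))

/-- The index in `cur` is arbitrary. Calls with a point that has not arrived read stale rows of `Y`,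
but the claims on memory still cover them. -/
theorem query_spec (σ : State) {c : ℕ} (hc : σ.nat .cnt 0 0 = c)
    (hs : σ.nat .s 0 0 = s) (hcn : c ≤ n) (hn : 0 < n) (hcells : σ.cells ⊆ room n d s) :
    wp query (fun τ => (∀ j < c, τ.real .est j 0 =
      sketchDist s (σ.real .Y (σ.nat .cur 0 0)) (σ.real .Y j)) ∧ τ.cells ⊆ room n d s) σ := by
  refine wp_loop (fun m τ => (∀ j < m, τ.real .est j 0 =
      sketchDist s (σ.real .Y (σ.nat .cur 0 0)) (σ.real .Y j)) ∧ τ.cells ⊆ room n d s)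
    ⟨by simp, hcells⟩ (fun m hm τ hF hJ => ?_) fun τ _ hJ => by simpa [hc] using hJ
  have hm : m < c := by simpa [hc] using hm
  have h1 := hF.nat .cur (by decide)
  have h2 := hF.nat .s (by decide)
  have h3 := hF.real .Y (by decide)
  simp only [wp_block_cons, setRreg, setR1, wp_setR]
  refine wp_loop (fun q π => π.real .acc 0 0 = ∑ a ∈ Finset.range q,
      (σ.real .Y (σ.nat .cur 0 0) a - σ.real .Y m a) * (σ.real .Y (σ.nat .cur 0 0) a - σ.real .Y m a) ∧
      π.cells ⊆ room n d s) ?_ (fun q hq π hG hK => ?_) fun π hG hK => ?_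
  · refine ⟨by simp, ?_⟩
    simp only [tick_cells, writeN_cells, writeR_cells, NExpr.eval]
    exact Finset.insert_subset (room_real hn) (Finset.insert_subset (room_nat hn) hJ.2)
  · have g1 : π.nat .cur 0 0 = σ.nat .cur 0 0 := by rw [hG.nat .cur (by decide)]; simp [h1]
    have g2 : π.nat .j 0 0 = m := by rw [hG.nat .j (by decide)]; simp
    have g3 : π.real .Y = σ.real .Y := by
      rw [hG.real .Y (by decide)]; funext i j; simp [h3]
    simp only [wp_setR]
    refine ⟨by simp [g1, g2, g3, hK.1, Finset.sum_range_succ], ?_⟩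
    simp only [tick_cells, writeN_cells, writeR_cells, NExpr.eval]
    exact Finset.insert_subset (room_real hn) (Finset.insert_subset (room_nat hn) hK.2)
  · have g2 : π.nat .j 0 0 = m := by rw [hG.nat .j (by decide)]; simp
    have g3 : π.real .est = τ.real .est := by
      rw [hG.real .est (by decide)]; funext i j; simp
    simp [h2, hs] at hK
    simp only [wp_block_cons, wp_block_nil, wp_setR]
    refine ⟨fun j hj => ?_, ?_⟩
    · by_cases hjm : j = m
      · simp [g2, hjm, hK.1, sketchDist]
      · simp [g2, g3, hjm, hJ.1 j (by omega)]
    · simp [g2]; exact Finset.insert_subset (room_real (by omega)) hK.2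

/-! ### Tentative assignment -/

theorem scan_congr {mk mk' : ℕ → Prop} {gain gain' : ℕ → ℝ} {m : ℕ}
    (h : ∀ j < m, (mk j ↔ mk' j) ∧ gain j = gain' j) : scan mk gain m = scan mk' gain' m := by
  induction m with
  | zero => rfl
  | succ m ih =>
    rw [scan, scan, ih fun j hj => h j (by omega)]
    obtain ⟨h1, h2⟩ := h m (by omega)
    rw [propext h1, h2]

/-- The tentative matching in the memory. -/
def State.tentative (σ : State) : Tentative := ⟨fun i => σ.nat .mate i 0, fun i => σ.real .w i 0⟩

theorem assign_spec (σ : State) {c : ℕ} (hc : σ.nat .cnt 0 0 = c)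
    (hcn : c ≤ n) (hn : 0 < n) (hcells : σ.cells ⊆ room n d s) :
    wp assign (fun τ => State.tentative τ = (State.tentative σ).assign (σ.nat .cur 0 0)
      (scan (fun j => σ.nat .market j 0 = 1) (fun j => σ.real .est j 0 - σ.real .w j 0) c).1
      (fun j => σ.real .est j 0) ∧ τ.cells ⊆ room n d s) σ := by
  simp only [assign, wp_block_cons, setNreg, setRreg, wp_setN, wp_setR]
  set sc := scan (fun j => σ.nat .market j 0 = 1) (fun j => σ.real .est j 0 - σ.real .w j 0)
  -- The two registers are exactly the pair computed by `scan`.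
  refine wp_loop (fun m τ => (τ.nat .best 0 0, τ.real .inc 0 0) = sc m ∧ τ.cells ⊆ room n d s)
    ?_ (fun m hm τ hF hJ => ?_) fun τ hF hJ => ?_
  · refine ⟨by simp [sc, scan], ?_⟩
    simp only [tick_cells, writeN_cells, writeR_cells, NExpr.eval]
    exact Finset.insert_subset (room_real hn) (Finset.insert_subset (room_nat hn) hcells)
  · have h1 : τ.nat .market = σ.nat .market := by rw [hF.nat .market (by decide)]; funext i j; simp
    have h2 : τ.real .est = σ.real .est := by rw [hF.real .est (by decide)]; funext i j; simp
    have h3 : τ.real .w = σ.real .w := by rw [hF.real .w (by decide)]; funext i j; simp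
    obtain ⟨hb, hcl⟩ := hJ
    have hcl' := Finset.insert_subset (room_nat (v := .j) hn) hcl
    have e1 : τ.nat .best 0 0 = (sc m).1 := by rw [← hb]
    have e2 : τ.real .inc 0 0 = (sc m).2 := by rw [← hb]
    have hsc : sc (m + 1) = if σ.nat .market m 0 = 1 ∧ (sc m).2 < σ.real .est m 0 - σ.real .w m 0
        then (m + 1, σ.real .est m 0 - σ.real .w m 0) else sc m := by
      simp only [sc]; rw [scan]; congr
    simp only [wp_ite, wp_block_cons, wp_block_nil, wp_setN, wp_setR, wp_skip]
    refine ⟨fun hmk => ⟨fun hlt => ⟨?_, ?_⟩, fun hlt => ⟨?_, by simpa using hcl'⟩⟩,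
      fun hmk => ⟨?_, by simpa using hcl'⟩⟩
    · simp [h1, h2, h3, e2] at hmk hlt ⊢
      rw [hsc, if_pos ⟨hmk, by linarith⟩]
    · simp only [tick_cells, writeN_cells, writeR_cells, NExpr.eval]
      exact Finset.insert_subset (room_real hn) (Finset.insert_subset (room_nat hn) hcl')
    · simp [h1, h2, h3, e2] at hmk hlt ⊢
      rw [hsc, if_neg, e1]
      rintro ⟨-, h⟩; linarith
    · simp [h1, e1, e2] at hmk ⊢
      rw [hsc, if_neg (fun h => hmk h.1)]
  · have h0 : τ.nat .cur = σ.nat .cur := by rw [hF.nat .cur (by decide)]; funext i j; simp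
    have h1 : τ.nat .mate = σ.nat .mate := by rw [hF.nat .mate (by decide)]; funext i j; simp
    have h2 : τ.real .est = σ.real .est := by rw [hF.real .est (by decide)]; funext i j; simp
    have h3 : τ.real .w = σ.real .w := by rw [hF.real .w (by decide)]; funext i j; simp
    obtain ⟨hb, hcl⟩ := hJ
    have hN : NExpr.eval ((((σ.writeN .best 0 0 0).tick 4).writeR .inc 0 0 0).tick 4) (nreg .cnt) = c := by
      simp [hc]
    have hb : (τ.nat .best 0 0, τ.real .inc 0 0) = sc c := by simpa [hc] using hb
    have e1 : (sc c).1 = τ.nat .best 0 0 := by rw [← hb]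
    have e2 : (sc c).1 ≤ c := by
      rcases (scan_spec (fun j => σ.nat .market j 0 = 1)
        (fun j => σ.real .est j 0 - σ.real .w j 0) c).2.2 with h | ⟨j, hj, -, -, h⟩
      · simp [sc, h]
      · simp only [sc, h]; omega
    simp only [wp_ite, wp_block_cons, wp_block_nil, setN1, setR1, wp_setN, wp_setR, wp_skip]
    refine ⟨fun h => ⟨?_, by simpa using hcl⟩, fun h => ⟨?_, ?_⟩⟩
    · have h : τ.nat .best 0 0 = 0 := by simpa using h
      simp [State.tentative, h1, h3, Tentative.assign, e1, h]
    · have h : τ.nat .best 0 0 ≠ 0 := by simpa using h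
      simp [State.tentative, h0, h1, h2, h3, Tentative.assign, e1, h]
      constructor <;> funext i <;> simp [Function.update_apply]
    · have h : τ.nat .best 0 0 ≠ 0 := by simpa using h
      have hlt : τ.nat .best 0 0 - 1 < n := by omega
      simp
      exact Finset.insert_subset (room_real hlt) (Finset.insert_subset (room_nat hlt)
        (Finset.insert_subset (room_nat hn) hcl))

end FastPostponedGreedy

namespace FastPostponedGreedy
open RealRAM

attribute [local simp] nreg rreg setNreg setRreg nat1 real1 setN1 setR1 NExpr.eval RExpr.eval
  BExpr.holds writeN_nat writeR_real wp_block_nil wp_block_cons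

/-! ### Departures -/

/-- Settling the tentative match of a point whose role is decided. -/
def settle : Cmd := block [
  .ite (.eqN (nat1 .mate (nreg .i)) (.lit 0))
    .skip
    (block [
      setNreg .l (.sub (nat1 .mate (nreg .i)) (.lit 1)),
      .ite (.eqN (nat1 .role (nreg .i)) (.lit 1))
        (block [
          setRreg .p (.add (rreg .p) (real1 .w (nreg .i))),
          setN1 .final (nreg .i) (nat1 .mate (nreg .i)),
          setN1 .role (nreg .l) (.lit 2)])
        (setN1 .role (nreg .l) (.lit 1))]),
  setN1 .market (nreg .i) (.lit 0)]

/-- The body of the loop of `leave`. -/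
def leaveBody : Cmd := .ite (.eqN (nat1 .deadline (nreg .i)) (nreg .now))
  (.seq (.ite (.eqN (nat1 .role (nreg .i)) (.lit 0))
        (block [.flip .coin, setN1 .role (nreg .i) (.add (nreg .coin) (.lit 1))])
        .skip) settle)
  .skip

/-- Separates the decision of a role from `settle`, which uses no coin. -/
theorem leave_eq : leave = .loop .i (nreg .cnt) leaveBody := rfl

/-- `τ` results from `σ` when the point `m` leaves with role `r`. -/
structure Departed (σ : State) (m r : ℕ) (τ : State) : Prop where
  role : ∀ k, τ.nat .role k 0 = if σ.nat .mate m 0 ≠ 0 ∧ k = σ.nat .mate m 0 - 1 then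
    (if r = 1 then 2 else 1) else if k = m then r else σ.nat .role k 0
  final : ∀ k, τ.nat .final k 0 = if σ.nat .mate m 0 ≠ 0 ∧ r = 1 ∧ k = m then σ.nat .mate m 0
    else σ.nat .final k 0
  market : ∀ k, τ.nat .market k 0 = if k = m then 0 else σ.nat .market k 0
  p : τ.real .p 0 0 = σ.real .p 0 0 + if σ.nat .mate m 0 ≠ 0 ∧ r = 1 then σ.real .w m 0 else 0
  cells : ∀ n d s, m < n → σ.nat .mate m 0 ≤ n → σ.cells ⊆ room n d s → τ.cells ⊆ room n d s

theorem settle_spec (σ : State) {m r : ℕ} (hi : σ.nat .i 0 0 = m) (hr : σ.nat .role m 0 = r) :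
    wp settle (Departed σ m r) σ := by
  simp only [settle, wp_block_cons, wp_block_nil, setNreg, setRreg, setN1, wp_ite, wp_skip,
    wp_setN, wp_setR]
  refine ⟨fun h => ?_, fun h => ⟨fun h' => ?_, fun h' => ?_⟩⟩
  · have h : σ.nat .mate m 0 = 0 := by simpa [hi] using h
    constructor <;> simp [h, hi]
    · exact hr
    · intro n d s hm hc; exact Finset.insert_subset (room_nat hm) hc
  · have h : σ.nat .mate m 0 ≠ 0 := by simpa [hi] using h
    have h' : r = 1 := by simpa [hi, hr] using h'
    constructor <;> simp [h, hi, h']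
    · intro k; split_ifs with h1 h2
      · rfl
      · rw [h2, hr, h']
      · rfl
    · intro n d s hm hml hc
      have hl : σ.nat .mate m 0 - 1 < n := by omega
      exact Finset.insert_subset (room_nat hm) (Finset.insert_subset (room_nat hl)
        (Finset.insert_subset (room_nat hm) (Finset.insert_subset (room_real (by omega))
        (Finset.insert_subset (room_nat (by omega)) hc))))
  · have h : σ.nat .mate m 0 ≠ 0 := by simpa [hi] using h
    have h' : r ≠ 1 := by simpa [hi, hr] using h'
    constructor <;> simp [h, hi, h']
    · intro k; split_ifs with h1 h2
      · rfl
      · rw [h2, hr]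
      · rfl
    · intro n d s hm hml hc
      have hl : σ.nat .mate m 0 - 1 < n := by omega
      exact Finset.insert_subset (room_nat hm) (Finset.insert_subset (room_nat hl)
        (Finset.insert_subset (room_nat (by omega)) hc))

theorem leaveBody_stay (σ : State) {m : ℕ} (hi : σ.nat .i 0 0 = m)
    (h : σ.nat .deadline m 0 ≠ σ.nat .now 0 0) :
    wp leaveBody (fun τ => τ.nat = σ.nat ∧ τ.real = σ.real ∧ τ.cells = σ.cells) σ := by
  rw [leaveBody, wp_ite]
  simp [hi, h]

/-- Here ρ is the state after the role of m has been fixed. The lemma expresses the departure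
relative to the state σ before that, so that fresh and predetermined roles are treated alike. -/
theorem settle_of {σ ρ : State} {m r : ℕ} (hi : ρ.nat .i 0 0 = m)
    (hrole : ∀ k, ρ.nat .role k 0 = if k = m then r else σ.nat .role k 0)
    (hmate : ρ.nat .mate = σ.nat .mate) (hfinal : ρ.nat .final = σ.nat .final)
    (hmarket : ρ.nat .market = σ.nat .market) (hreal : ρ.real = σ.real)
    (hcells : ∀ n d s, m < n → σ.cells ⊆ room n d s → ρ.cells ⊆ room n d s) :
    wp settle (Departed σ m r) ρ := by
  refine wp_mono (settle_spec ρ (m := m) (r := r) hi (by simp [hrole])) fun τ hτ => ?_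
  refine ⟨fun k => ?_, fun k => ?_, fun k => ?_, ?_, fun n d s hm hml hc =>
    hτ.cells n d s hm (by rwa [hmate]) (hcells n d s hm hc)⟩
  · rw [hτ.role, hmate, hrole]
    split_ifs <;> rfl
  · rw [hτ.final, hmate, hfinal]
  · rw [hτ.market, hmarket]
  · rw [hτ.p, hmate, hreal]

theorem wp_decide {σ : State} {m c t t' : ℕ} (hi : σ.nat .i 0 0 = m) :
    wp (block [setN1 .role (nreg .i) (.add (nreg .coin) (.lit 1))])
      (wp settle (Departed σ m (c + 1))) (((σ.tick t).writeN .coin 0 0 c).tick t') := by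
  simp only [wp_block_cons, wp_block_nil, setN1, wp_setN]
  refine settle_of (by simp [hi]) (by simp [hi]) ?_ ?_ ?_ (by simp) fun n d s hm hc => ?_
  · funext i j; simp
  · funext i j; simp
  · funext i j; simp
  · simp [hi]
    exact Finset.insert_subset (room_nat hm) (Finset.insert_subset (room_nat (by omega)) hc)

theorem wp_settle_tick {σ : State} {m t : ℕ} (hi : σ.nat .i 0 0 = m) :
    wp settle (Departed σ m (σ.nat .role m 0)) (σ.tick t) := by
  refine settle_of hi (fun k => ?_) rfl rfl rfl rfl fun n d s _ hc => hc
  split_ifs with h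
  · rw [h]; rfl
  · rfl

theorem exec_ite_of_holds {b : BExpr} {c c' : Cmd} {σ : State} (h : b.holds σ) :
    exec (.ite b c c') σ = exec c (σ.tick (1 + b.cost)) := by
  rw [exec, if_pos h]

theorem exec_ite_of_not_holds {b : BExpr} {c c' : Cmd} {σ : State} (h : ¬ b.holds σ) :
    exec (.ite b c c') σ = exec c' (σ.tick (1 + b.cost)) := by
  rw [exec, if_neg h]

theorem tick_tick (σ : State) (a b : ℕ) : (σ.tick a).tick b = σ.tick (a + b) := by
  simp [State.tick, add_assoc]

theorem leaveBody_spec (σ : State) {m : ℕ} (hi : σ.nat .i 0 0 = m)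
    (h : σ.nat .deadline m 0 = σ.nat .now 0 0) (hr : σ.nat .role m 0 ≤ 2) :
    wp leaveBody (fun τ => ∃ r, (r = 1 ∨ r = 2) ∧ (σ.nat .role m 0 = 0 ∨ σ.nat .role m 0 = r) ∧
      Departed σ m r τ) σ := by
  rw [leaveBody, wp_ite]
  refine ⟨fun _ => ?_, fun h' => absurd (by simp [hi, h]) h'⟩
  rw [wp_seq, wp_ite, tick_tick]
  refine ⟨fun h0 => ?_, fun h0 => ?_⟩
  · have h0 : σ.nat .role m 0 = 0 := by simpa [hi] using h0
    rw [wp_block_cons, wp_flip]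
    -- The role is the coin plus one: coin 1 makes a buyer, coin 0 a seller.
    exact ⟨wp_mono (wp_decide hi) fun _ h => wp_mono h fun τ hτ => ⟨2, .inr rfl, .inl h0, hτ⟩,
      wp_mono (wp_decide hi) fun _ h => wp_mono h fun τ hτ => ⟨1, .inl rfl, .inl h0, hτ⟩⟩
  · have h0 : σ.nat .role m 0 ≠ 0 := by simpa [hi] using h0
    rw [wp_skip, tick_tick]
    exact wp_mono (wp_settle_tick hi) fun τ hτ => ⟨_, by omega, .inr rfl, hτ⟩

/-- Roles and p after a departure are functions of the role r of the leaving point, so an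
expectation is a two-point average, or no average at all if the role was known. -/
theorem leaveBody_Ex (σ : State) {m : ℕ} (hi : σ.nat .i 0 0 = m)
    (h : σ.nat .deadline m 0 = σ.nat .now 0 0) (f : State → ℝ≥0∞) (φ : ℕ → ℝ≥0∞)
    (hf : ∀ r τ, Departed σ m r τ → f τ = φ r) :
    Ex (exec leaveBody σ) f =
      if σ.nat .role m 0 = 0 then (φ 1 + φ 2) / 2 else φ (σ.nat .role m 0) := by
  rw [leaveBody, exec_ite_of_holds (by simp [hi, h]), Ex_seq]
  split_ifs with h0
  · rw [exec_ite_of_holds (by simp [hi, h0]), block, Ex_seq, Ex_flip, tick_tick]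
    have key (c t t' : ℕ) : Ex (exec (block [setN1 .role (nreg .i) (.add (nreg .coin) (.lit 1))])
        (((σ.tick t).writeN .coin 0 0 c).tick t')) (fun τ => Ex (exec settle τ) f) = φ (c + 1) :=
      Ex_eq_of_wp (wp_mono (wp_decide hi) fun ρ hρ => Ex_eq_of_wp (wp_mono hρ fun τ hτ => hf _ τ hτ))
    rw [key, key, add_comm]
  · rw [exec_ite_of_not_holds (by simp [hi, h0])]
    refine Ex_eq_of_wp ?_
    rw [wp_skip, tick_tick, tick_tick]
    exact Ex_eq_of_wp (wp_mono (wp_settle_tick hi) fun τ hτ => hf _ τ hτ)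

end FastPostponedGreedy

/-! ### The memory follows the abstract process under every call. -/

namespace FastPostponedGreedy
open RealRAM

attribute [local simp] nreg rreg setNreg setRreg nat1 real1 setN1 setR1 NExpr.eval RExpr.eval
  BExpr.holds writeN_nat writeR_real wp_block_nil wp_block_cons

/-! ### The invariant of the data structure -/

variable {n d s : ℕ}

/-- Coordinates of the points, indexed by natural numbers. -/
noncomputable def Input.coord (I : Input n d) (i k : ℕ) : ℝ :=
  if h : i < n ∧ k < d then I.x ⟨i, h.1⟩ ⟨k, h.2⟩ else 0

/-- The sketch of point `i`. -/
noncomputable def Input.sketch (I : Input n d) (M : ℕ → ℕ → ℝ) (i a : ℕ) : ℝ :=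
  ∑ k ∈ Finset.range d, M a k * I.coord i k

/-- The estimated distances. -/
noncomputable def Input.est (I : Input n d) (s : ℕ) (M : ℕ → ℕ → ℝ) (j i : ℕ) : ℝ :=
  sketchDist s (I.sketch M j) (I.sketch M i)

theorem Input.est_self (I : Input n d) (s : ℕ) (M : ℕ → ℕ → ℝ) (t : ℕ) : I.est s M t t = 0 := by
  simp [Input.est, sketchDist]

theorem sketchDist_congr {y y' z z' : ℕ → ℝ} (hy : ∀ a < s, y a = y' a) (hz : ∀ a < s, z a = z' a) :
    sketchDist s y z = sketchDist s y' z' := by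
  rw [sketchDist, sketchDist]
  congr 1
  refine Finset.sum_congr rfl fun a ha => ?_
  rw [hy a (Finset.mem_range.1 ha), hz a (Finset.mem_range.1 ha)]

/-- The state of the data structure at time `t`, when `c` points have arrived, the points in `L`
have left and the tentative matching is `T`. -/
structure Inv (I : Input n d) (s : ℕ) (M : ℕ → ℕ → ℝ) (t c : ℕ) (L : ℕ → Prop) (T : Tentative)
    (σ : State) : Prop where
  dim : σ.nat .d 0 0 = d
  size : σ.nat .s 0 0 = s
  now : σ.nat .now 0 0 = t
  cnt : σ.nat .cnt 0 0 = c
  matrix : σ.real .M = M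
  deadline : ∀ i < c, σ.nat .deadline i 0 = I.dl i
  market : ∀ i < c, σ.nat .market i 0 = 1 ↔ ¬ L i
  tentative : State.tentative σ = T
  stored : ∀ i < c, ∀ a < s, σ.real .Y i a = I.sketch M i a
  ledger : Ledger n T L (fun i => σ.nat .role i 0) (fun i => σ.nat .final i 0) (σ.real .p 0 0)
  cells : σ.cells ⊆ room n d s

/-- The points that have left before time `t`. -/
def Input.leftN (I : Input n d) (t i : ℕ) : Prop := i < n ∧ I.dl i < t

/-- The state of the data structure between two calls. -/
def Sem (I : Input n d) (s : ℕ) (M : ℕ → ℕ → ℝ) (t : ℕ) (σ : State) : Prop :=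
  Inv I s M t (min t n) (I.leftN t) (tent n I.dl (I.est s M) t) σ

variable {I : Input n d} {M : ℕ → ℕ → ℝ} {t c : ℕ} {L : ℕ → Prop} {T : Tentative} {σ τ : State}

theorem Inv.mate (h : Inv I s M t c L T σ) (i : ℕ) : σ.nat .mate i 0 = T.mate i := by
  rw [← h.tentative]; rfl

theorem Inv.w (h : Inv I s M t c L T σ) (i : ℕ) : σ.real .w i 0 = T.w i := by
  rw [← h.tentative]; rfl

theorem Inv.congr (h : Inv I s M t c L T σ)
    (hn : ∀ v, v = .d ∨ v = .s ∨ v = .now ∨ v = .cnt ∨ v = .deadline ∨ v = .market ∨ v = .mate ∨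
      v = .role ∨ v = .final → τ.nat v = σ.nat v)
    (hr : ∀ v, v = .M ∨ v = .Y ∨ v = .w ∨ v = .p → τ.real v = σ.real v)
    (hc : τ.cells ⊆ room n d s) : Inv I s M t c L T τ := by
  refine ⟨?_, ?_, ?_, ?_, ?_, ?_, ?_, ?_, ?_, ?_, hc⟩
  · rw [hn _ (by simp), h.dim]
  · rw [hn _ (by simp), h.size]
  · rw [hn _ (by simp), h.now]
  · rw [hn _ (by simp), h.cnt]
  · rw [hr _ (by simp), h.matrix]
  · rw [hn _ (by simp)]; exact h.deadline
  · rw [hn _ (by simp)]; exact h.market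
  · rw [State.tentative, hn _ (by simp), hr _ (by simp)]; exact h.tentative
  · rw [hr _ (by simp)]; exact h.stored
  · rw [hn _ (by simp), hn _ (by simp), hr _ (by simp)]; exact h.ledger

/-- Roles and finalized matches of `σ` are unchanged in `τ`. -/
def Extends (σ τ : State) : Prop :=
  (∀ k, σ.nat .role k 0 ≠ 0 → τ.nat .role k 0 = σ.nat .role k 0) ∧
  ∀ k, σ.nat .final k 0 ≠ 0 → τ.nat .final k 0 = σ.nat .final k 0

theorem Extends.trans {ρ : State} (h : Extends σ τ) (h' : Extends τ ρ) : Extends σ ρ :=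
  ⟨fun k hk => (h'.1 k (by rwa [h.1 k hk])).trans (h.1 k hk),
    fun k hk => (h'.2 k (by rwa [h.2 k hk])).trans (h.2 k hk)⟩

/-- `σ` and `τ` have the same books. -/
structure SameBooks (σ τ : State) : Prop where
  role : ∀ k, τ.nat .role k 0 = σ.nat .role k 0
  final : ∀ k, τ.nat .final k 0 = σ.nat .final k 0
  p : τ.real .p 0 0 = σ.real .p 0 0

theorem SameBooks.extends (h : SameBooks σ τ) : Extends σ τ :=
  ⟨fun k _ => h.role k, fun k _ => h.final k⟩

theorem SameBooks.trans {ρ : State} (h : SameBooks σ τ) (h' : SameBooks τ ρ) : SameBooks σ ρ :=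
  ⟨fun k => (h'.role k).trans (h.role k), fun k => (h'.final k).trans (h.final k), h'.p.trans h.p⟩

theorem Input.lt_of_leftN {i : ℕ} (h : I.leftN t i) : i < t := (I.lt_dl h.1).trans h.2

/-- A point that has not arrived has not left and is nobody's tentative buyer. Hence the reset of
its role in `arrive` revokes nothing. -/
theorem Sem.role_eq_zero (h : Sem I s M t σ) {i : ℕ} (hi : t ≤ i) : σ.nat .role i 0 = 0 := by
  by_contra h0
  rcases h.ledger.pending i h0 with h1 | ⟨j, -, hj⟩
  · have := Input.lt_of_leftN h1; omega
  · have := (tent_mate (I.est_self s M) hj).2.1; omega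

theorem Sem.final_eq_zero (h : Sem I s M t σ) {i : ℕ} (hi : t ≤ i) : σ.nat .final i 0 = 0 := by
  by_contra h0
  have := Input.lt_of_leftN (h.ledger.of_final i h0).1; omega

theorem Sem.arrive (h : Sem I s M t σ) (ht : t < n) :
    wp arrive (fun τ => Inv I s M t (t + 1) (I.leftN t) (tent n I.dl (I.est s M) t) τ ∧
      τ.nat .cur 0 0 = t ∧ SameBooks σ τ) (load (I.x ⟨t, ht⟩) (I.deadline ⟨t, ht⟩) σ) := by
  obtain ⟨h1, -, h3, h4, h5⟩ := load_spec (n := n) (s := s) (I.x ⟨t, ht⟩) (I.deadline ⟨t, ht⟩) σ (by omega)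
  have hcnt : σ.nat .cnt 0 0 = t := by rw [h.cnt]; exact min_eq_left ht.le
  have hmin : min t n = t := min_eq_left ht.le
  set σ' := load (I.x ⟨t, ht⟩) (I.deadline ⟨t, ht⟩) σ
  have hn (v : NVar) (hv : v ≠ .due) : σ'.nat v = σ.nat v := by
    rw [h1, writeN_nat_of_ne _ _ _ _ hv]
  have hcoord (k : ℕ) (hk : k < d) : σ'.real .input k 0 = I.coord t k := by
    rw [h4 ⟨k, hk⟩, Input.coord, dif_pos ⟨ht, hk⟩]
  refine wp_of_frame (wp_mono (arrive_spec σ' (c := t) (by rw [hn _ (by decide), hcnt])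
    (by rw [hn _ (by decide), h.dim]) (by rw [hn _ (by decide), h.size]) ht (h5 h.cells)) ?_)
  rintro τ ⟨k1, k2, k3, k4, k5, k6, k7, k8, k9, k10⟩ hF
  have hrole (i : ℕ) : τ.nat .role i 0 = σ.nat .role i 0 := by
    rw [k4, hn _ (by decide)]; split_ifs with hi
    · rw [h.role_eq_zero hi.ge]
    · rfl
  have hfinal (i : ℕ) : τ.nat .final i 0 = σ.nat .final i 0 := by
    rw [k6, hn _ (by decide)]; split_ifs with hi
    · rw [h.final_eq_zero hi.ge]
    · rfl
  have hp : τ.real .p 0 0 = σ.real .p 0 0 := by rw [hF.real .p (by decide), h3 _ (by decide)]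
  refine ⟨⟨?_, ?_, ?_, k2, ?_, fun i hi => ?_, fun i hi => ?_, ?_, fun i hi a ha => ?_, ?_, k10⟩, k1,
    hrole, hfinal, hp⟩
  · rw [hF.nat .d (by decide), hn _ (by decide), h.dim]
  · rw [hF.nat .s (by decide), hn _ (by decide), h.size]
  · rw [hF.nat .now (by decide), hn _ (by decide), h.now]
  · rw [hF.real .M (by decide), h3 _ (by decide), h.matrix]
  · rw [k3, hn .deadline (by decide), h1]
    split_ifs with hit
    · simp [hit, Input.dl, ht]
    · exact h.deadline i (by omega)
  · rw [k7, hn _ (by decide)]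
    split_ifs with hit
    -- The new point is in the market, because its deadline exceeds its arrival time.
    · simp only [true_iff]
      rintro ⟨-, h'⟩
      have := I.lt_dl ht
      rw [hit] at h'; omega
    · exact h.market i (by omega)
  · rw [← h.tentative, State.tentative, State.tentative]
    congr 1
    · funext i
      rw [k5, hn _ (by decide)]; split_ifs with hi
      -- The zeros written for the new point are those of the abstract process, where it is still
      -- untouched.
      · rw [h.mate, (tent_unarrived (I.est_self s M) hi.ge).1]
      · rfl
    · funext i
      rw [k8, h3 _ (by decide)]; split_ifs with hi
      · rw [h.w, (tent_unarrived (I.est_self s M) hi.ge).2]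
      · rfl
  · rw [k9]
    split_ifs with hit
    · rw [Input.sketch, hit.1]
      refine Finset.sum_congr rfl fun k hk => ?_
      rw [h3 .M (by decide), h.matrix, hcoord k (Finset.mem_range.1 hk)]
    · rw [h3 .Y (by decide)]
      exact h.stored i (by omega) a ha
  · simp only [hrole, hfinal, hp]
    exact h.ledger

/-- The points that have left at time `t` when the first `m` points have been looked at. -/
def Input.leaving (I : Input n d) (t m i : ℕ) : Prop := i < n ∧ (I.dl i < t ∨ I.dl i = t ∧ i < m)

theorem Input.leaving_zero (i : ℕ) : I.leaving t 0 i ↔ I.leftN t i := by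
  simp [Input.leaving, Input.leftN]

/-- A point with deadline t arrived before t, so the loop over the arrived points misses no
departure. -/
theorem Input.leaving_last (hc : c = min (t + 1) n) (i : ℕ) : I.leaving t c i ↔ I.leftN (t + 1) i := by
  simp only [Input.leaving, Input.leftN]
  refine and_congr_right fun hi => ?_
  have := I.lt_dl hi
  omega

/-- One step of the loop of `leave`. -/
theorem Inv.leaveBody {m : ℕ}
    (h : Inv I s M t c (I.leaving t m) (tent n I.dl (I.est s M) t) σ)
    (hm : m < c) (hc : c ≤ n) :
    wp leaveBody (fun τ => Inv I s M t c (I.leaving t (m + 1)) (tent n I.dl (I.est s M) t) τ ∧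
      Extends σ τ ∧ τ.nat .cur = σ.nat .cur) ((σ.writeN .i 0 0 m).tick 1) := by
  set σ' := (σ.writeN .i 0 0 m).tick 1
  have he := I.est_self s M
  have hn (v : NVar) (hv : v ≠ .i) : σ'.nat v = σ.nat v := by
    simp only [σ', tick_nat]; exact writeN_nat_of_ne _ _ _ _ hv
  have hi : σ'.nat .i 0 0 = m := by simp [σ']
  have hcells : σ'.cells ⊆ room n d s := Finset.insert_subset (room_nat (by omega)) h.cells
  by_cases hd : I.dl m = t
  · refine wp_of_frame (wp_mono (leaveBody_spec σ' hi ?_ ?_) ?_)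
    · rw [hn _ (by decide), hn _ (by decide), h.now, h.deadline m hm, hd]
    · rw [hn _ (by decide)]; exact h.ledger.role_le m
    rintro τ ⟨r, hr, hr0, hD⟩ hF
    have hmate : σ'.nat .mate m 0 = (tent n I.dl (I.est s M) t).mate m := by
      rw [hn _ (by decide), h.mate]
    obtain ⟨d1, d2, d3, d4, d5⟩ := hD
    simp only [hmate] at d1 d2 d4 d5
    simp only [hn .role (by decide), hn .final (by decide), hn .market (by decide)] at d1 d2 d3 hr0
    have hw : σ'.real .w m 0 = (tent n I.dl (I.est s M) t).w m := h.w m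
    rw [hw] at d4
    obtain ⟨l1, l2, l3⟩ := h.ledger.leave (i := m) (r := r) (by omega)
      (by rintro ⟨-, h'⟩; omega) hr hr0 (fun j hj hjm => tent_mate_inj he hj hjm)
      -- Departures run in the order of the index, and a later point has a deadline at least t; so
      -- no point after m has left yet, even among those that leave at the same time.
      (fun l hl => (tent_mate he hl).1) (fun l hl hL => by
        have := I.dl_mono hl.le hL.1; have := hL.2; omega) (tent_mate_zero he) d1 d2 d4
    refine ⟨⟨?_, ?_, ?_, ?_, ?_, ?_, fun i hi => ?_, ?_, ?_, l1.congr (fun i => ?_) fun _ _ => ⟨rfl, rfl⟩,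
      d5 n d s (by omega) ?_ hcells⟩, ⟨l2, l3⟩, ?_⟩
    · rw [hF.nat .d (by decide), hn _ (by decide), h.dim]
    · rw [hF.nat .s (by decide), hn _ (by decide), h.size]
    · rw [hF.nat .now (by decide), hn _ (by decide), h.now]
    · rw [hF.nat .cnt (by decide), hn _ (by decide), h.cnt]
    · rw [hF.real .M (by decide)]; exact h.matrix
    · rw [hF.nat .deadline (by decide), hn _ (by decide)]; exact h.deadline
    · rw [d3]
      split_ifs with him
      · simp only [false_iff, not_not, him]
        exact ⟨by omega, by omega⟩
      · rw [h.market i hi, Input.leaving, Input.leaving, not_iff_not]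
        refine and_congr_right fun _ => ?_
        omega
    · rw [← h.tentative, State.tentative, State.tentative, hF.nat .mate (by decide),
        hF.real .w (by decide), hn _ (by decide)]; rfl
    · rw [hF.real .Y (by decide)]; exact h.stored
    · simp only [Input.leaving]
      constructor
      · rintro (h' | rfl)
        · exact ⟨h'.1, by have := h'.2; omega⟩
        · exact ⟨by omega, by omega⟩
      · rintro ⟨h1, h2⟩
        by_cases him : i = m
        · exact .inr him
        · exact .inl ⟨h1, by omega⟩
    -- The partner is an actual point, so writing its role stays inside `room`.
    · rcases Nat.eq_zero_or_eq_succ_pred ((tent n I.dl (I.est s M) t).mate m) with h0 | h0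
      · omega
      · have := (tent_mate he h0).2.2.1; omega
    · rw [hF.nat .cur (by decide), hn _ (by decide)]
  · refine wp_mono (leaveBody_stay σ' hi ?_) ?_
    · rw [hn _ (by decide), hn _ (by decide), h.now, h.deadline m hm]; exact hd
    rintro τ ⟨e1, e2, e3⟩
    have hL : I.leaving t m = I.leaving t (m + 1) := by
      funext i
      simp only [Input.leaving, eq_iff_iff]
      refine and_congr_right fun _ => or_congr_right ?_
      refine and_congr_right fun hit => ?_
      have : i ≠ m := by rintro rfl; exact hd hit
      omega
    have e4 (v : NVar) (hv : v ≠ .i) : τ.nat v = σ.nat v := by rw [e1, hn v hv]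
    refine ⟨hL ▸ h.congr (fun v hv => e4 v ?_) (fun v _ => by rw [e2]; rfl) (e3 ▸ hcells),
      ⟨fun k _ => ?_, fun k _ => ?_⟩, e4 _ (by decide)⟩
    · rintro rfl; simp at hv
    · rw [e4 _ (by decide)]
    · rw [e4 _ (by decide)]

theorem Inv.leave (h : Inv I s M t c (I.leftN t) (tent n I.dl (I.est s M) t) σ)
    (hc : c = min (t + 1) n) :
    wp leave (fun τ => Inv I s M t c (I.leftN (t + 1)) (tent n I.dl (I.est s M) t) τ ∧
      Extends σ τ ∧ τ.nat .cur = σ.nat .cur) σ := by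
  have e0 : I.leftN t = I.leaving t 0 := funext fun i => propext (Input.leaving_zero i).symm
  have e1 : I.leaving t c = I.leftN (t + 1) := funext fun i => propext (Input.leaving_last hc i)
  rw [leave_eq, ← e1]
  rw [e0] at h
  refine wp_loop_of (fun m τ => Inv I s M t c (I.leaving t m) (tent n I.dl (I.est s M) t) τ ∧
      Extends σ τ ∧ τ.nat .cur = σ.nat .cur) ⟨h.congr (fun _ _ => rfl) (fun _ _ => rfl) h.cells,
        ⟨fun _ _ => rfl, fun _ _ => rfl⟩, rfl⟩ (fun m hm τ hτ => ?_) fun τ hτ => ?_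
  · have hm : m < c := by simpa [h.cnt] using hm
    exact wp_mono (hτ.1.leaveBody hm (by omega)) fun ρ hρ =>
      ⟨hρ.1, hτ.2.1.trans hρ.2.1, hρ.2.2.trans hτ.2.2⟩
  · simpa [h.cnt] using hτ

/-- A query leaves everything but the estimates unchanged. -/
theorem Inv.query (h : Inv I s M t c L T σ) (hc : c ≤ n) (hn : 0 < n) :
    wp query (fun τ => Inv I s M t c L T τ ∧ SameBooks σ τ ∧ τ.nat .cur = σ.nat .cur ∧
      (σ.nat .cur 0 0 < c → ∀ j < c, τ.real .est j 0 = I.est s M (σ.nat .cur 0 0) j)) σ := by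
  refine wp_of_frame (wp_mono (query_spec σ h.cnt h.size hc hn h.cells) ?_)
  rintro τ ⟨h1, h2⟩ hF
  have hN (v : NVar) (hv : v ≠ .j ∧ v ≠ .a) : τ.nat v = σ.nat v :=
    hF.nat v (by simp [FastPostponedGreedy.query, Cmd.wN, block, hv])
  have hR (v : RVar) (hv : v ≠ .acc ∧ v ≠ .est) : τ.real v = σ.real v :=
    hF.real v (by simp [FastPostponedGreedy.query, Cmd.wR, block, hv])
  refine ⟨h.congr (fun v hv => hN v ?_) (fun v hv => hR v ?_) h2, ⟨?_, ?_, ?_⟩, hN _ (by decide),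
    fun hcur j hj => ?_⟩
  · rcases hv with rfl | rfl | rfl | rfl | rfl | rfl | rfl | rfl | rfl <;> decide
  · rcases hv with rfl | rfl | rfl | rfl <;> decide
  · rw [hN _ (by decide)]; simp
  · rw [hN _ (by decide)]; simp
  · rw [hR _ (by decide)]
  · rw [h1 j hj]
    exact sketchDist_congr (h.stored _ hcur) (h.stored j hj)

theorem Tentative.assign_congr {b : ℕ} {e e' : ℕ → ℝ} (hb : b ≤ c) (he : ∀ j < c, e j = e' j) :
    T.assign t b e = T.assign t b e' := by
  rw [Tentative.assign, Tentative.assign]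
  split_ifs with h
  · rfl
  · rw [he (b - 1) (by omega)]

theorem scan_le (mk : ℕ → Prop) (gain : ℕ → ℝ) (m : ℕ) : (scan mk gain m).1 ≤ m := by
  rcases (scan_spec mk gain m).2.2 with h | ⟨j, hj, -, -, h⟩
  · simp [h]
  · rw [h]; exact hj

theorem Inv.assign (ht : t < n)
    (h : Inv I s M t (t + 1) (I.leftN (t + 1)) (tent n I.dl (I.est s M) t) σ)
    (hcur : σ.nat .cur 0 0 = t) (hest : ∀ j < t + 1, σ.real .est j 0 = I.est s M t j) :
    wp assign (fun τ => Inv I s M t (t + 1) (I.leftN (t + 1)) (tent n I.dl (I.est s M) (t + 1)) τ ∧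
      SameBooks σ τ) σ := by
  refine wp_of_frame (wp_mono (assign_spec σ h.cnt ht (by omega) h.cells) ?_)
  rintro τ ⟨h1, h2⟩ hF
  have hN (v : NVar) (hv : v ≠ .j ∧ v ≠ .best ∧ v ≠ .mate) : τ.nat v = σ.nat v :=
    hF.nat v (by simp [FastPostponedGreedy.assign, Cmd.wN, block, hv])
  have hR (v : RVar) (hv : v ≠ .inc ∧ v ≠ .w) : τ.real v = σ.real v :=
    hF.real v (by simp [FastPostponedGreedy.assign, Cmd.wR, block, hv])
  have hT : State.tentative τ = tent n I.dl (I.est s M) (t + 1) := by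
    rw [h1, h.tentative, hcur, tent, if_pos ht]
    -- Departures at time t have already been processed, so the market flag says that the deadline
    -- exceeds t, the condition used in `tent`.
    have : scan (fun j => σ.nat .market j 0 = 1) (fun j => σ.real .est j 0 - σ.real .w j 0) (t + 1) =
        scan (fun j => t < I.dl j) (fun j => I.est s M t j - (tent n I.dl (I.est s M) t).w j) (t + 1) := by
      refine scan_congr fun j hj => ⟨?_, by rw [hest j hj, h.w]⟩
      rw [h.market j hj, Input.leftN]
      have : j < n := by omega
      omega
    rw [this]
    exact Tentative.assign_congr (scan_le _ _ _) hest
  have hbooks : SameBooks σ τ := ⟨by rw [hN _ (by decide)]; simp, by rw [hN _ (by decide)]; simp,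
    by rw [hR _ (by decide)]⟩
  refine ⟨⟨?_, ?_, ?_, ?_, ?_, ?_, ?_, hT, ?_, ?_, h2⟩, hbooks⟩
  · rw [hN _ (by decide), h.dim]
  · rw [hN _ (by decide), h.size]
  · rw [hN _ (by decide), h.now]
  · rw [hN _ (by decide), h.cnt]
  · rw [hR _ (by decide), h.matrix]
  · rw [hN _ (by decide)]; exact h.deadline
  · rw [hN _ (by decide)]; exact h.market
  · rw [hR _ (by decide)]; exact h.stored
  · rw [hN _ (by decide), hN _ (by decide), hR _ (by decide)]
    exact h.ledger.congr (fun _ => Iff.rfl) fun i hi =>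
      tent_frozen (I.est_self s M) (Nat.lt_succ_iff.1 hi.2)

theorem Inv.advanceClock (h : Inv I s M t c L T σ) (hn : 0 < n) :
    wp advanceClock (fun τ => Inv I s M (t + 1) c L T τ ∧ SameBooks σ τ) σ := by
  simp only [FastPostponedGreedy.advanceClock, setNreg, wp_setN]
  refine ⟨⟨by simp [h.dim], by simp [h.size], by simp [h.now], by simp [h.cnt], by simp [h.matrix],
    by simpa using h.deadline, by simpa using h.market, ?_, by simpa using h.stored,
    by simpa using h.ledger, Finset.insert_subset (room_nat hn) h.cells⟩,
    by simp, by simp, by simp⟩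
  rw [← h.tentative]
  simp [State.tentative]

/-! ### Calls -/

/-- The time after a call at time `t`. -/
def Op.next (t : ℕ) : Op → ℕ
  | .advance => t + 1
  | .query _ => t
  | .totalWeight => t

theorem elapsed_cons (op : Op) (h : List Op) : elapsed (op :: h) = op.next (elapsed h) := by
  cases op <;> rfl

/-- The commands of `Update` that follow `leave`. -/
def settleArrival : Cmd := block [query, assign, FastPostponedGreedy.advanceClock]

theorem update_eq : update = .seq arrive (.seq leave settleArrival) := rfl

theorem idle_eq : idle = .seq leave (block [FastPostponedGreedy.advanceClock]) := rfl

theorem Inv.settleArrival (ht : t < n)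
    (h : Inv I s M t (t + 1) (I.leftN (t + 1)) (tent n I.dl (I.est s M) t) σ)
    (hcur : σ.nat .cur 0 0 = t) :
    wp settleArrival (fun τ => Sem I s M (t + 1) τ ∧ SameBooks σ τ) σ := by
  rw [FastPostponedGreedy.settleArrival, wp_block_cons]
  refine wp_mono (h.query ht (by omega)) ?_
  rintro τ ⟨h1, h2, h3, h4⟩
  rw [wp_block_cons]
  refine wp_mono (h1.assign ht (by rw [h3, hcur]) (by simpa [hcur] using h4)) ?_
  rintro ρ ⟨h5, h6⟩
  rw [wp_block_cons]
  refine wp_mono (h5.advanceClock (by omega)) ?_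
  rintro π ⟨h7, h8⟩
  rw [wp_block_nil]
  have h9 := (h2.trans h6).trans h8
  refine ⟨?_, h9.role, h9.final, h9.p⟩
  rw [Sem, min_eq_left (by omega)]
  exact h7.congr (fun _ _ => rfl) (fun _ _ => rfl) h7.cells

/-- After the last arrival both the number of arrived points and the tentative matching stand still;
only the clock moves. -/
theorem Sem.idle_clock (hn : 0 < n) (ht : n ≤ t)
    (h : Inv I s M t (min t n) (I.leftN (t + 1)) (tent n I.dl (I.est s M) t) σ) :
    wp (block [FastPostponedGreedy.advanceClock]) (fun τ => Sem I s M (t + 1) τ ∧ SameBooks σ τ) σ := by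
  rw [wp_block_cons]
  refine wp_mono (h.advanceClock hn) ?_
  rintro τ ⟨h1, h2⟩
  rw [wp_block_nil]
  refine ⟨?_, h2.role, h2.final, h2.p⟩
  have e1 : min (t + 1) n = min t n := by omega
  have e2 : tent n I.dl (I.est s M) (t + 1) = tent n I.dl (I.est s M) t := by
    rw [tent, if_neg (by omega)]
  rw [Sem, e1, e2]
  exact h1.congr (fun _ _ => rfl) (fun _ _ => rfl) h1.cells

theorem Sem.query (h : Sem I s M t σ) (hn : 0 < n) (i : ℕ) :
    ∀ τ ∈ (call I t (.query i) σ).support, Sem I s M t τ ∧ SameBooks σ τ ∧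
      (i < min t n → ∀ j < min t n, τ.real .est j 0 = I.est s M i j) := by
  have h' : Sem I s M t (σ.writeN .cur 0 0 i) :=
    h.congr (fun v hv => writeN_nat_of_ne _ _ _ _ (by rintro rfl; simp at hv)) (fun _ _ => rfl)
      (Finset.insert_subset (room_nat hn) h.cells)
  intro τ hτ
  obtain ⟨h1, h2, -, h4⟩ := Inv.query h' (min_le_right _ _) hn τ hτ
  refine ⟨h1, ⟨fun k => ?_, fun k => ?_, h2.p⟩, by simpa using h4⟩
  · rw [h2.role]; simp
  · rw [h2.final]; simp

theorem Sem.totalWeight (h : Sem I s M t σ) (hn : 0 < n) :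
    ∀ τ ∈ (call I t .totalWeight σ).support, Sem I s M t τ ∧ SameBooks σ τ ∧
      τ.real .out 0 0 = σ.real .p 0 0 := by
  have : wp FastPostponedGreedy.totalWeight (fun τ => Sem I s M t τ ∧ SameBooks σ τ ∧ τ.real .out 0 0 = σ.real .p 0 0) σ := by
    rw [FastPostponedGreedy.totalWeight, setRreg, wp_setR]
    refine ⟨h.congr (fun _ _ => rfl) (fun v hv => ?_)
      (Finset.insert_subset (room_real hn) h.cells), ⟨fun _ => rfl, fun _ => rfl, ?_⟩, ?_⟩
    · rw [tick_real, writeR_real_of_ne _ _ _ _ (by rintro rfl; simp at hv)]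
    · simp
    · simp
  exact this

theorem Sem.call (h : Sem I s M t σ) (hn : 0 < n) (op : Op) :
    ∀ τ ∈ (call I t op σ).support, Sem I s M (op.next t) τ ∧ Extends σ τ := by
  cases op with
  | query i => exact fun τ hτ => ⟨(h.query hn i τ hτ).1, (h.query hn i τ hτ).2.1.extends⟩
  | totalWeight => exact fun τ hτ => ⟨(h.totalWeight hn τ hτ).1, (h.totalWeight hn τ hτ).2.1.extends⟩
  | advance =>
    simp only [FastPostponedGreedy.call, Op.next]
    split_ifs with ht
    · change wp update _ _
      rw [update_eq, wp_seq]
      refine wp_mono (h.arrive ht) fun τ hτ => ?_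
      rw [wp_seq]
      refine wp_mono (hτ.1.leave (by omega)) fun ρ hρ => ?_
      refine wp_mono (hρ.1.settleArrival ht (by rw [hρ.2.2, hτ.2.1])) fun π hπ => ?_
      exact ⟨hπ.1, (hτ.2.2.extends.trans hρ.2.1).trans hπ.2.extends⟩
    · change wp idle _ _
      rw [idle_eq, wp_seq]
      refine wp_mono (Inv.leave h (by omega)) fun ρ hρ => ?_
      refine wp_mono (Sem.idle_clock hn (by omega) hρ.1) fun π hπ => ?_
      exact ⟨hπ.1, hρ.2.1.trans hπ.2.extends⟩

theorem Sem.run {σ₀ : State} (h0 : Sem I s M 0 σ₀) (hn : 0 < n) (h : List Op) :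
    ∀ σ ∈ (run I σ₀ h).support, Sem I s M (elapsed h) σ := by
  induction h with
  | nil => simpa [FastPostponedGreedy.run, elapsed] using h0
  | cons op h ih =>
    intro τ hτ
    simp only [FastPostponedGreedy.run, PMF.mem_support_bind_iff] at hτ
    obtain ⟨σ, hσ, hτ⟩ := hτ
    rw [elapsed_cons]
    exact ((ih σ hσ).call hn op τ hτ).1

end FastPostponedGreedy

namespace FastPostponedGreedy
open RealRAM

variable {n d s : ℕ} {I : Input n d} {M : ℕ → ℕ → ℝ} {t c : ℕ} {T : Tentative} {σ τ : State}

/-! ### Expectations over the roles -/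

/-- The conditional probability of the role of a seller, for a point with role `r`. -/
noncomputable def sellerProb (r : ℕ) : ℝ≥0∞ := if r = 0 then 2⁻¹ else if r = 1 then 1 else 0

/-- The conditional probability of the role of a buyer, for a point with role `r`. -/
noncomputable def buyerProb (r : ℕ) : ℝ≥0∞ := if r = 0 then 2⁻¹ else if r = 1 then 0 else 1

/-- Each point is a seller or a buyer with equal probabilities, and the expected matching value
is `P`. -/
structure Balanced (μ : PMF State) (P : ℝ≥0∞) : Prop where
  seller : ∀ k, Ex μ (fun σ => sellerProb (σ.nat .role k 0)) = 2⁻¹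
  buyer : ∀ k, Ex μ (fun σ => buyerProb (σ.nat .role k 0)) = 2⁻¹
  value : Ex μ (fun σ => ENNReal.ofReal (σ.real .p 0 0)) = P

/-- Everything except `leave` keeps the books in every outcome, so only departures need a
probabilistic argument. -/
theorem Balanced.bind_same {μ : PMF State} {P : ℝ≥0∞} (h : Balanced μ P) {k : State → PMF State}
    (hk : ∀ σ ∈ μ.support, ∀ τ ∈ (k σ).support, SameBooks σ τ) : Balanced (μ.bind k) P := by
  have key (f : State → ℝ≥0∞) (hf : ∀ σ τ, SameBooks σ τ → f τ = f σ) : Ex (μ.bind k) f = Ex μ f := by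
    rw [Ex_bind]
    refine Ex_congr fun σ hσ => ?_
    exact (Ex_congr fun τ hτ => hf σ τ (hk σ hσ τ hτ)).trans (Ex_const _ _)
  refine ⟨fun i => ?_, fun i => ?_, ?_⟩
  · rw [key _ fun σ τ h => by rw [h.role], h.seller]
  · rw [key _ fun σ τ h => by rw [h.role], h.buyer]
  · rw [key _ fun σ τ h => by rw [h.p], h.value]

theorem half_add_half (x : ℝ≥0∞) : (x + x) / 2 = x := by
  rw [ENNReal.add_div, ENNReal.add_halves]

theorem Inv.p_nonneg {L : ℕ → Prop} (h : Inv I s M t c L (tent n I.dl (I.est s M) t) σ) :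
    0 ≤ σ.real .p 0 0 := by
  classical
  rw [h.ledger.value]
  refine Finset.sum_nonneg fun i _ => ?_
  split_ifs
  · exact tent_w_nonneg _ _
  · exact le_rfl

open Classical in
/-- The expected matching value due to the points in `L`. -/
noncomputable def expectedValue (n : ℕ) (T : Tentative) (L : ℕ → Prop) : ℝ≥0∞ :=
  ∑ i ∈ Finset.range n, if L i then 2⁻¹ * ENNReal.ofReal (T.w i) else 0

theorem expectedValue_insert {L L' : ℕ → Prop} {m : ℕ} (hm : m < n) (hL : ¬ L m)
    (hL' : ∀ i, L' i ↔ L i ∨ i = m) :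
    expectedValue n T L' = expectedValue n T L + 2⁻¹ * ENNReal.ofReal (T.w m) := by
  classical
  rw [expectedValue, expectedValue, ← Finset.sum_erase_add _ _ (Finset.mem_range.2 hm),
    ← Finset.sum_erase_add (a := m) (Finset.range n) _ (Finset.mem_range.2 hm),
    if_pos ((hL' m).2 (.inr rfl)), if_neg hL, add_zero]
  congr 1
  refine Finset.sum_congr rfl fun i hi => ?_
  simp [hL', Finset.ne_of_mem_erase hi]

/-- The conditional probabilities `sellerProb` and `buyerProb` of m are martingales under its fair
coin. Its partner takes the mirrored role, so its probability of selling becomes that of m buying,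
again 1/2 on average. The value p grows by that of m exactly if m sells, hence by half of it in
expectation. -/
theorem Balanced.leaveBody {μ : PMF State} {m : ℕ} (hm : m < c) (hc : c ≤ n)
    (hInv : ∀ σ ∈ μ.support, Inv I s M t c (I.leaving t m) (tent n I.dl (I.est s M) t) σ)
    (h : Balanced μ (expectedValue n (tent n I.dl (I.est s M) t) (I.leaving t m))) :
    Balanced (μ.bind fun σ => exec leaveBody ((σ.writeN .i 0 0 m).tick 1))
      (expectedValue n (tent n I.dl (I.est s M) t) (I.leaving t (m + 1))) := by
  have he := I.est_self s M
  have hn (σ : State) (v : NVar) (hv : v ≠ .i) :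
      ((σ.writeN .i 0 0 m).tick 1).nat v = σ.nat v := by
    simp only [tick_nat]; exact writeN_nat_of_ne _ _ _ _ hv
  have hi (σ : State) : ((σ.writeN .i 0 0 m).tick 1).nat .i 0 0 = m := by simp [writeN_nat]
  by_cases hd : I.dl m = t
  · have hE (f : State → ℝ≥0∞) (φ : State → ℕ → ℝ≥0∞) (σ : State) (hσ : σ ∈ μ.support)
        (hf : ∀ r τ, Departed ((σ.writeN .i 0 0 m).tick 1) m r τ → f τ = φ σ r) :
        Ex (exec FastPostponedGreedy.leaveBody ((σ.writeN .i 0 0 m).tick 1)) f =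
        if σ.nat .role m 0 = 0 then (φ σ 1 + φ σ 2) / 2 else φ σ (σ.nat .role m 0) := by
      have h' := hInv σ hσ
      rw [leaveBody_Ex _ (hi σ) (by
        rw [hn _ _ (by decide), hn _ _ (by decide), h'.now, h'.deadline m hm, hd]) f (φ σ) hf,
        hn _ _ (by decide)]
    have hmate (σ : State) (hσ : σ ∈ μ.support) : ((σ.writeN .i 0 0 m).tick 1).nat .mate m 0 =
        (tent n I.dl (I.est s M) t).mate m := by rw [hn _ _ (by decide), (hInv σ hσ).mate]
    -- Sellers and buyers are symmetric: the claim is proved for a pair of functions that are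
    -- exchanged by swapping the roles 1 and 2, and is then used in both directions.
    have hpt (p : ℕ → ℝ≥0∞) (q : ℕ → ℝ≥0∞) (hp : (p 1 + p 2) / 2 = p 0) (hq1 : p 2 = q 1)
        (hq2 : p 1 = q 2) (hq0 : p 0 = q 0) (k : ℕ)
        (h1 : ∀ k, Ex μ (fun σ => p (σ.nat .role k 0)) = 2⁻¹)
        (h2 : ∀ k, Ex μ (fun σ => q (σ.nat .role k 0)) = 2⁻¹) :
        Ex (μ.bind fun σ => exec FastPostponedGreedy.leaveBody ((σ.writeN .i 0 0 m).tick 1))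
          (fun σ => p (σ.nat .role k 0)) = 2⁻¹ := by
      rw [Ex_bind]
      have hrole (σ : State) (hσ : σ ∈ μ.support) := hE (fun σ => p (σ.nat .role k 0))
        (fun σ r => p (if (tent n I.dl (I.est s M) t).mate m ≠ 0 ∧
          k = (tent n I.dl (I.est s M) t).mate m - 1 then (if r = 1 then 2 else 1)
          else if k = m then r else σ.nat .role k 0)) σ hσ
          (fun r τ hτ => by rw [hτ.role, hmate σ hσ, hn _ _ (by decide)])
      by_cases hk : (tent n I.dl (I.est s M) t).mate m ≠ 0 ∧
          k = (tent n I.dl (I.est s M) t).mate m - 1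
      · rw [← h2 m]
        refine Ex_congr fun σ hσ => ?_
        rw [hrole σ hσ]
        have h3 := (hInv σ hσ).ledger.role_le m
        simp only [if_pos hk]
        split_ifs with h4 h5 h6
        · omega
        · rw [h4, ← hq0, ← hp, add_comm]
        · rw [h6, hq1]
        · have : σ.nat .role m 0 = 2 := by omega
          rw [this, hq2]
      · simp only [if_neg hk] at hrole
        by_cases hkm : k = m
        · rw [← h1 m]
          refine Ex_congr fun σ hσ => ?_
          rw [hrole σ hσ]
          simp only [if_pos hkm]
          split_ifs with h4
          · rw [hp, h4]
          · rfl
        · rw [← h1 k]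
          refine Ex_congr fun σ hσ => ?_
          rw [hrole σ hσ]
          simp only [if_neg hkm, half_add_half, ite_self]
    refine ⟨fun k => ?_, fun k => ?_, ?_⟩
    · exact hpt sellerProb buyerProb (by simp [sellerProb])
        (by simp [sellerProb, buyerProb]) (by simp [sellerProb, buyerProb])
        (by simp [sellerProb, buyerProb]) k h.seller h.buyer
    · exact hpt buyerProb sellerProb (by simp [buyerProb])
        (by simp [sellerProb, buyerProb]) (by simp [sellerProb, buyerProb])
        (by simp [sellerProb, buyerProb]) k h.buyer h.seller
    -- The factor one half of the new term is written as the expected `sellerProb` of m, which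
    -- allows a comparison state by state.
    · rw [expectedValue_insert (L := I.leaving t m) (m := m) (by omega) (by rintro ⟨-, h'⟩; omega)
        (fun i => ?_), ← h.value, ← h.seller m, Ex_bind, ← Ex_mul_right, ← Ex_add]
      · refine Ex_congr fun σ hσ => ?_
        rw [hE _ (fun σ r => ENNReal.ofReal (σ.real .p 0 0 +
          if (tent n I.dl (I.est s M) t).mate m ≠ 0 ∧ r = 1 then
          (tent n I.dl (I.est s M) t).w m else 0)) σ hσ]
        · have hp := (hInv σ hσ).p_nonneg
          have hw := tent_w_nonneg (n := n) (dl := I.dl) (e := I.est s M) t m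
          have h3 := (hInv σ hσ).ledger.role_le m
          by_cases hm0 : (tent n I.dl (I.est s M) t).mate m = 0
          · simp [hm0, tent_mate_zero he hm0, half_add_half]
          · have h2 : (2 : ℕ) ≠ 1 := by decide
            simp only [ne_eq, hm0, not_false_eq_true, true_and, if_true, h2, if_false, add_zero,
              ENNReal.ofReal_add hp hw]
            split_ifs with h4 h5
            · rw [h4, sellerProb, if_pos rfl, add_right_comm, ENNReal.add_div, half_add_half,
                ENNReal.div_eq_inv_mul]
            · rw [h5, sellerProb, if_neg (by decide), if_pos rfl, one_mul, ENNReal.ofReal_add hp hw]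
            · simp [sellerProb, h4, h5]
        · intro r τ hτ
          rw [hτ.p, hmate σ hσ]
          have := (hInv σ hσ).w m
          simp only [tick_real, writeN_real, this]
      · simp only [Input.leaving]
        constructor
        · rintro ⟨h1, h2⟩
          by_cases him : i = m
          · exact .inr him
          · exact .inl ⟨h1, by omega⟩
        · rintro (h' | rfl)
          · exact ⟨h'.1, by have := h'.2; omega⟩
          · exact ⟨by omega, by omega⟩
  · have hL : I.leaving t m = I.leaving t (m + 1) := by
      funext i
      simp only [Input.leaving, eq_iff_iff]
      refine and_congr_right fun _ => or_congr_right ?_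
      refine and_congr_right fun hit => ?_
      have : i ≠ m := by rintro rfl; exact hd hit
      omega
    rw [← hL]
    refine h.bind_same fun σ hσ τ hτ => ?_
    have h' := hInv σ hσ
    obtain ⟨e1, e2, -⟩ := leaveBody_stay _ (hi σ) (by
      rw [hn _ _ (by decide), hn _ _ (by decide), h'.now, h'.deadline m hm]; exact hd) τ hτ
    refine ⟨fun k => ?_, fun k => ?_, ?_⟩
    · rw [e1, hn _ _ (by decide)]
    · rw [e1, hn _ _ (by decide)]
    · rw [e2]; rfl

theorem Balanced.leave {μ : PMF State} (hc : c = min (t + 1) n)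
    (hInv : ∀ σ ∈ μ.support, Inv I s M t c (I.leftN t) (tent n I.dl (I.est s M) t) σ)
    (h : Balanced μ (expectedValue n (tent n I.dl (I.est s M) t) (I.leftN t))) :
    Balanced (μ.bind (exec leave))
      (expectedValue n (tent n I.dl (I.est s M) t) (I.leftN (t + 1))) := by
  have e0 : I.leftN t = I.leaving t 0 := funext fun i => propext (Input.leaving_zero i).symm
  have e1 : I.leaving t c = I.leftN (t + 1) := funext fun i => propext (Input.leaving_last hc i)
  rw [e0] at h hInv
  let body : ℕ → State → PMF State := fun m τ =>
    exec FastPostponedGreedy.leaveBody ((τ.writeN .i 0 0 m).tick 1)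
  -- The 4 is the time spent on the loop header: one unit for the loop and three for reading the
  -- register `cnt`.
  have key (m : ℕ) (hm : m ≤ c) : (∀ τ ∈ (μ.bind fun σ => iterate body (σ.tick 4) m).support,
      Inv I s M t c (I.leaving t m) (tent n I.dl (I.est s M) t) τ) ∧
      Balanced (μ.bind fun σ => iterate body (σ.tick 4) m)
        (expectedValue n (tent n I.dl (I.est s M) t) (I.leaving t m)) := by
    induction m with
    | zero =>
      refine ⟨fun τ hτ => ?_, h.bind_same fun σ _ τ hτ => ?_⟩
      · simp only [iterate, PMF.mem_support_bind_iff, PMF.mem_support_pure_iff] at hτ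
        obtain ⟨σ, hσ, rfl⟩ := hτ
        exact (hInv σ hσ).congr (fun _ _ => rfl) (fun _ _ => rfl) (hInv σ hσ).cells
      · simp only [iterate, PMF.mem_support_pure_iff] at hτ
        subst hτ
        exact ⟨fun _ => rfl, fun _ => rfl, rfl⟩
    | succ m ih =>
      obtain ⟨ih1, ih2⟩ := ih (by omega)
      have : (μ.bind fun σ => iterate body (σ.tick 4) (m + 1)) =
          (μ.bind fun σ => iterate body (σ.tick 4) m).bind (body m) := by
        rw [PMF.bind_bind]; rfl
      rw [this]
      refine ⟨fun τ hτ => ?_, ih2.leaveBody (by omega) (by omega) ih1⟩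
      simp only [PMF.mem_support_bind_iff] at hτ
      obtain ⟨σ, hσ, hτ⟩ := hτ
      exact ((ih1 σ (by simpa only [PMF.mem_support_bind_iff] using hσ)).leaveBody
        (by omega) (by omega) τ hτ).1
  have hk := (key c le_rfl).2
  -- The number of iterations is known to be c only on the support, so the laws are compared term by
  -- term.
  have e2 : μ.bind (exec FastPostponedGreedy.leave) = μ.bind fun σ => iterate body (σ.tick 4) c := by
    ext τ
    simp only [PMF.bind_apply]
    refine tsum_congr fun σ => ?_
    by_cases hσ : μ σ = 0
    · simp [hσ]
    · have := (hInv σ ((PMF.mem_support_iff _ _).2 hσ)).cnt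
      rw [leave_eq, exec]
      simp only [nreg, NExpr.eval, this, NExpr.cost]
      rfl
  rw [e2, ← e1]
  exact hk

theorem expectedValue_frozen :
    expectedValue n (tent n I.dl (I.est s M) t) (I.leftN (t + 1)) =
      expectedValue n (tent n I.dl (I.est s M) (t + 1)) (I.leftN (t + 1)) := by
  refine Finset.sum_congr rfl fun i _ => ?_
  split_ifs with hi
  · rw [(tent_frozen (I.est_self s M) (Nat.lt_succ_iff.1 hi.2)).2]
  · rfl

theorem bind_seq (μ : PMF State) (a b : Cmd) :
    μ.bind (exec (.seq a b)) = (μ.bind (exec a)).bind (exec b) := by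
  rw [PMF.bind_bind]; rfl

theorem bind_congr {μ : PMF State} {k k' : State → PMF State} (h : ∀ σ, k σ = k' σ) :
    μ.bind k = μ.bind k' := by rw [funext h]

theorem Balanced.call {μ : PMF State} (hn : 0 < n) (op : Op) (hSem : ∀ σ ∈ μ.support, Sem I s M t σ)
    (h : Balanced μ (expectedValue n (tent n I.dl (I.est s M) t) (I.leftN t))) :
    Balanced (μ.bind (call I t op))
      (expectedValue n (tent n I.dl (I.est s M) (op.next t)) (I.leftN (op.next t))) := by
  cases op with
  | query i => exact h.bind_same fun σ hσ τ hτ => ((hSem σ hσ).query hn i τ hτ).2.1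
  | totalWeight => exact h.bind_same fun σ hσ τ hτ => ((hSem σ hσ).totalWeight hn τ hτ).2.1
  | advance =>
    simp only [Op.next]
    rw [← expectedValue_frozen]
    by_cases ht : t < n
    · have e : μ.bind (FastPostponedGreedy.call I t .advance) =
          ((μ.bind fun σ => exec arrive (load (I.x ⟨t, ht⟩) (I.deadline ⟨t, ht⟩) σ)).bind
            (exec FastPostponedGreedy.leave)).bind (exec FastPostponedGreedy.settleArrival) := by
        rw [PMF.bind_bind, PMF.bind_bind]
        refine bind_congr fun σ => ?_
        simp only [FastPostponedGreedy.call, dif_pos ht, update_eq, exec]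
      rw [e]
      have h1 : ∀ τ ∈ (μ.bind fun σ =>
          exec arrive (load (I.x ⟨t, ht⟩) (I.deadline ⟨t, ht⟩) σ)).support,
          Inv I s M t (t + 1) (I.leftN t) (tent n I.dl (I.est s M) t) τ ∧ τ.nat .cur 0 0 = t := by
        intro τ hτ
        simp only [PMF.mem_support_bind_iff] at hτ
        obtain ⟨σ, hσ, hτ⟩ := hτ
        have := (hSem σ hσ).arrive ht τ hτ
        exact ⟨this.1, this.2.1⟩
      refine ((h.bind_same fun σ hσ τ hτ => ((hSem σ hσ).arrive ht τ hτ).2.2).leave (c := t + 1)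
        (by omega) fun τ hτ => (h1 τ hτ).1).bind_same fun σ hσ τ hτ => ?_
      rw [PMF.mem_support_bind_iff] at hσ
      obtain ⟨ρ, hρ, hσ⟩ := hσ
      have := (h1 ρ hρ).1.leave (by omega) σ hσ
      exact (this.1.settleArrival ht (by rw [this.2.2, (h1 ρ hρ).2]) τ hτ).2
    · have e : μ.bind (FastPostponedGreedy.call I t .advance) =
          (μ.bind (exec FastPostponedGreedy.leave)).bind
            (exec (block [FastPostponedGreedy.advanceClock])) := by
        rw [← bind_seq, ← idle_eq]
        refine bind_congr fun σ => ?_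
        simp only [FastPostponedGreedy.call, dif_neg ht]
      rw [e]
      refine (h.leave (c := min t n) (by omega) hSem).bind_same fun σ hσ τ hτ => ?_
      rw [PMF.mem_support_bind_iff] at hσ
      obtain ⟨ρ, hρ, hσ⟩ := hσ
      have := Inv.leave (hSem ρ hρ) (by omega) σ hσ
      exact (Sem.idle_clock hn (by omega) this.1 τ hτ).2

theorem Balanced.run {σ₀ : State} (h0 : Sem I s M 0 σ₀) (hn : 0 < n) (h : List Op) :
    Balanced (run I σ₀ h)
      (expectedValue n (tent n I.dl (I.est s M) (elapsed h)) (I.leftN (elapsed h))) := by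
  induction h with
  | nil =>
    have hp : σ₀.real .p 0 0 = 0 := by
      rw [h0.ledger.value]
      exact Finset.sum_eq_zero fun i _ => if_neg fun h => by simpa using Input.lt_of_leftN h.1
    refine ⟨fun k => ?_, fun k => ?_, ?_⟩
    · rw [FastPostponedGreedy.run, Ex_pure, h0.role_eq_zero (Nat.zero_le k)]; rfl
    · rw [FastPostponedGreedy.run, Ex_pure, h0.role_eq_zero (Nat.zero_le k)]; rfl
    · rw [FastPostponedGreedy.run, Ex_pure, hp, ENNReal.ofReal_zero]
      exact (Finset.sum_eq_zero fun i _ => if_neg fun h => by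
        simpa [elapsed] using Input.lt_of_leftN h).symm
  | cons op h ih =>
    rw [elapsed_cons]
    exact ih.call hn op (h0.run hn h)

end FastPostponedGreedy

/-! ### Soundness, resources and competitiveness for a fixed matrix. -/

namespace FastPostponedGreedy
open RealRAM

variable {n d s : ℕ} {I : Input n d} {M : ℕ → ℕ → ℝ} {t c : ℕ} {T : Tentative} {σ τ : State}

/-! ### Soundness -/

theorem mem_matched {e : Fin n × Fin n} :
    e ∈ matched n σ ↔ σ.nat .final e.1 0 = e.2 + 1 := by
  simp [matched]

theorem Sem.mem_matched (h : Sem I s M t σ) {e : Fin n × Fin n} (he : e ∈ matched n σ) :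
    I.leftN t e.1 ∧ role σ e.1 = 1 ∧ role σ e.2 = 2 ∧
      (tent n I.dl (I.est s M) t).mate e.1 = e.2 + 1 := by
  have hf := FastPostponedGreedy.mem_matched.1 he
  obtain ⟨h1, h2⟩ := h.ledger.of_final e.1 (by rw [hf]; omega)
  have h3 := (h.ledger.final_eq e.1 h1 h2).symm.trans hf
  exact ⟨h1, h2, h.ledger.buyer e.1 h1 h2 _ h3, h3⟩

/-- A shared seller forces the same mate, a shared buyer contradicts injectivity of the tentative
matching, and no point is both seller and buyer because it has a single role. -/
theorem Sem.isMatching (h : Sem I s M t σ) : I.IsMatching (matched n σ) := by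
  have hs := I.est_self s M
  refine ⟨fun e he => ?_, fun e he f hf hne => ?_⟩
  · obtain ⟨-, -, -, h4⟩ := h.mem_matched he
    obtain ⟨h5, -, -, h6, -⟩ := tent_mate hs h4
    exact ⟨h5, by rwa [← I.dl_fin]⟩
  · obtain ⟨-, e2, e3, e4⟩ := h.mem_matched he
    obtain ⟨-, f2, f3, f4⟩ := h.mem_matched hf
    have h1 : e.1 ≠ f.1 := fun h1 => hne <| by
      refine Prod.ext h1 (Fin.ext ?_)
      rw [h1, f4] at e4; omega
    refine ⟨h1, fun h' => ?_, fun h' => ?_, fun h' => ?_⟩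
    · rw [h', f3] at e2; omega
    · rw [h', f2] at e3; omega
    · refine h1 (Fin.ext (tent_mate_inj hs (?_ : (tent n I.dl (I.est s M) t).mate e.1 ≠ 0) ?_))
      · rw [e4]; omega
      · rw [e4, f4, h']

/-- Bounds for the loop registers. -/
def loopBound (n d s : ℕ) : NVar → ℕ
  | .s => s
  | .d => d
  | _ => n

theorem arrive_cost : arrive.cost (loopBound n d s) ≤ 200 * ((s + 1) * (n + d + 1)) := by
  simp [arrive, block, Cmd.cost, setNreg, setN1, setR1, setRreg, nreg, rreg, NExpr.cost,
    RExpr.cost, real1, loopBound]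
  nlinarith [Nat.zero_le (s * n), Nat.zero_le (s * d)]

theorem leave_cost : leave.cost (loopBound n d s) ≤ 200 * ((s + 1) * (n + d + 1)) := by
  simp [leave, block, Cmd.cost, setNreg, setN1, setRreg, nreg, rreg, NExpr.cost,
    RExpr.cost, BExpr.cost, real1, nat1, loopBound]
  nlinarith [Nat.zero_le (s * n), Nat.zero_le (s * d)]

theorem query_cost : query.cost (loopBound n d s) ≤ 200 * ((s + 1) * (n + d + 1)) := by
  simp [query, block, Cmd.cost, setR1, setRreg, nreg, rreg, NExpr.cost,
    RExpr.cost, loopBound]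
  nlinarith [Nat.zero_le (s * n), Nat.zero_le (s * d)]

theorem settleArrival_cost :
    settleArrival.cost (loopBound n d s) ≤ 400 * ((s + 1) * (n + d + 1)) := by
  have := query_cost (n := n) (d := d) (s := s)
  simp [settleArrival, block, Cmd.cost]
  simp [assign, block, Cmd.cost, setNreg, setN1, setR1, setRreg, nreg, rreg, NExpr.cost,
    RExpr.cost, BExpr.cost, real1, nat1, loopBound, FastPostponedGreedy.advanceClock]
  nlinarith [Nat.zero_le (s * n), Nat.zero_le (s * d)]

theorem regLoops_arrive : arrive.RegLoops := by
  simp [arrive, block, Cmd.RegLoops, setNreg, setN1, setR1, setRreg]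

theorem regLoops_leave : leave.RegLoops := by
  simp [leave, block, Cmd.RegLoops, setNreg, setN1, setRreg]

theorem regLoops_query : query.RegLoops := by
  simp [query, block, Cmd.RegLoops, setR1, setRreg]

theorem regLoops_settleArrival : settleArrival.RegLoops := by
  simp [settleArrival, assign, query, advanceClock, block, Cmd.RegLoops, setNreg, setN1, setR1,
    setRreg]

theorem wp_time_of {c : Cmd} {B : ℕ} (hc : c.RegLoops) (hw : ∀ u ∈ c.loopRegs, u ∉ c.wN)
    (hr : ∀ u ∈ c.loopRegs, u = .s ∨ u = .d ∨ u = .cnt)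
    (hd : σ.nat .d 0 0 = d) (hs : σ.nat .s 0 0 = s) (hn : σ.nat .cnt 0 0 ≤ n)
    (hB : c.cost (loopBound n d s) ≤ B) :
    wp c (fun τ => τ.time ≤ σ.time + B) σ := by
  refine wp_mono (wp_time (loopBound n d s) c hc σ (fun u hu => ?_) hw) fun τ hτ => by omega
  rcases hr u hu with rfl | rfl | rfl
  · exact hs.le
  · exact hd.le
  · exact hn

/-- Upper bound for the running time of a call. -/
def callBound (n d s : ℕ) : Op → ℕ
  | .totalWeight => 200
  | _ => 1000 * ((s + 1) * (n + d + 1))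

theorem time_call_le (h : Sem I s M t σ) (hn : 0 < n) (op : Op) :
    ∀ τ ∈ (call I t op σ).support, τ.time ≤ σ.time + callBound n d s op := by
  have hleave {c : ℕ} {ρ : State} {L : ℕ → Prop} {T : Tentative} (hc : c ≤ n)
      (hρ : Inv I s M t c L T ρ) :
      wp leave (fun τ => τ.time ≤ ρ.time + 200 * ((s + 1) * (n + d + 1))) ρ :=
    wp_time_of regLoops_leave (by decide) (by decide) hρ.dim hρ.size (by rw [hρ.cnt]; exact hc)
      leave_cost
  cases op with
  | totalWeight =>
    intro τ hτ
    have : wp totalWeight (fun τ => τ.time ≤ σ.time + callBound n d s .totalWeight) σ := by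
      simp [callBound, FastPostponedGreedy.totalWeight, setRreg, rreg, NExpr.cost, RExpr.cost]
    exact this τ hτ
  | query i =>
    intro τ hτ
    have : wp query (fun τ => τ.time ≤ (σ.writeN .cur 0 0 i).time + _) (σ.writeN .cur 0 0 i) :=
      wp_time_of (n := n) (d := d) (s := s) regLoops_query (by decide) (by decide)
        (by simpa [writeN_nat] using h.dim) (by simpa [writeN_nat] using h.size)
        (by simp [writeN_nat, h.cnt]) query_cost
    have := this τ hτ
    simp only [writeN_time, callBound] at this ⊢
    omega
  | advance =>
    simp only [FastPostponedGreedy.call]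
    split_ifs with ht
    · change wp update _ _
      have ha : wp arrive (fun τ => τ.time ≤ σ.time + 200 * ((s + 1) * (n + d + 1)))
          (load (I.x ⟨t, ht⟩) (I.deadline ⟨t, ht⟩) σ) := by
        obtain ⟨h1, h2, -⟩ := load_spec (n := n) (s := s) (I.x ⟨t, ht⟩) (I.deadline ⟨t, ht⟩) σ hn
        rw [← h2]
        exact wp_time_of regLoops_arrive (by decide) (by decide)
          (by rw [h1]; simpa [writeN_nat] using h.dim) (by rw [h1]; simpa [writeN_nat] using h.size)
          (by rw [h1]; simp [writeN_nat, h.cnt]) arrive_cost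
      rw [update_eq, wp_seq]
      refine wp_mono (wp_and ha (h.arrive ht)) fun τ hτ => ?_
      rw [wp_seq]
      refine wp_mono (wp_and (hleave ht hτ.2.1) (hτ.2.1.leave (by omega))) fun ρ hρ => ?_
      refine wp_mono (wp_time_of (n := n) regLoops_settleArrival (by decide) (by decide) hρ.2.1.dim
        hρ.2.1.size (by rw [hρ.2.1.cnt]; exact ht) settleArrival_cost) fun π hπ => ?_
      have h1 := hτ.1
      have h2 := hρ.1
      simp only [callBound]
      linarith [Nat.zero_le ((s + 1) * (n + d + 1))]
    · change wp idle _ _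
      rw [idle_eq, wp_seq]
      refine wp_mono (hleave (min_le_right _ _) h) fun ρ hρ => ?_
      have h1 : 1 ≤ (s + 1) * (n + d + 1) := Nat.mul_pos (by omega) (by omega)
      simp [wp_block_cons, wp_block_nil, callBound, FastPostponedGreedy.advanceClock, setNreg, nreg, NExpr.cost]
      omega

theorem Sem.sound {C ε δ : ℝ} {h : List Op} (hS : Sem I s M (elapsed h) σ) (hn : 2 ≤ n)
    (hL : 2000 * ((s : ℝ) + 1) ≤ C * (ε⁻¹ ^ 2 * Real.log (n / δ))) (hC : 2000 ≤ C) :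
    Sound C ε δ I h σ := by
  have hn0 : 0 < n := by omega
  have hmul : 2000 * ((s : ℝ) + 1) * (n + d) ≤ C * (ε⁻¹ ^ 2 * (n + d) * Real.log (n / δ)) := by
    have : C * (ε⁻¹ ^ 2 * (n + d) * Real.log (n / δ)) =
      C * (ε⁻¹ ^ 2 * Real.log (n / δ)) * (n + d) := by ring
    rw [this]
    gcongr
  have hn2 : (2 : ℝ) ≤ n := by exact_mod_cast hn
  have hd0 : (0 : ℝ) ≤ d := Nat.cast_nonneg d
  have hs0 : (0 : ℝ) ≤ s := Nat.cast_nonneg s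
  -- The 1000 doubles to 2000 because n + d + 1 is at most 2(n + d).
  have htime : (1000 : ℝ) * ((s + 1) * (n + d + 1)) ≤ C * (ε⁻¹ ^ 2 * (n + d) * Real.log (n / δ)) := by
    refine le_trans ?_ hmul
    nlinarith [mul_nonneg (add_nonneg hs0 zero_le_one) (by linarith : (0:ℝ) ≤ n + d - 1)]
  refine ⟨?_, hS.isMatching, fun e he => ?_, fun e he => ?_, fun i hi => ?_, fun op τ hτ => ?_,
    fun op τ hτ => ?_⟩
  · have h1 : (σ.space : ℝ) ≤ 32 * n + s * d + n * d + n * s + d := by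
      exact_mod_cast (Finset.card_le_card hS.cells).trans (room_card n d s)
    have h2 : (n : ℝ) * d ≤ C * (n * d) := by
      nlinarith [mul_nonneg (by linarith : (0:ℝ) ≤ n) hd0]
    nlinarith [mul_nonneg hs0 hd0, mul_nonneg hs0 (by linarith : (0:ℝ) ≤ n)]
  · exact ⟨(hS.mem_matched he).2.1, (hS.mem_matched he).2.2.1⟩
  · have := (hS.mem_matched he).1.2
    rwa [I.dl_fin] at this
  · have h1 := hS.ledger.decided i ⟨i.2, by rwa [I.dl_fin]⟩
    have h2 := hS.ledger.role_le i
    simp only [role]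
    omega
  · have h1 := time_call_le hS hn0 op τ hτ
    have h2 : (τ.time : ℝ) ≤ σ.time + (callBound n d s op : ℕ) := by exact_mod_cast h1
    refine h2.trans (add_le_add_right ?_ _)
    cases op with
    | totalWeight => simp only [timeBound, callBound]; push_cast; linarith
    | query i => simp only [timeBound, callBound]; push_cast; exact htime
    | advance => simp only [timeBound, callBound]; push_cast; exact htime
  · have h1 := (hS.call hn0 op τ hτ).2
    refine ⟨fun e he => ?_, fun i hi => h1.1 i hi⟩
    rw [FastPostponedGreedy.mem_matched] at he ⊢
    rw [h1.2 _ (by omega), he]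

/-! ### Competitiveness -/

/-- All estimates are accurate. -/
def Accurate (η : ℝ) (I : Input n d) (s : ℕ) (M : ℕ → ℕ → ℝ) : Prop :=
  ∀ i j : Fin n, (1 - η) * dist (I.x j) (I.x i) ≤ I.est s M i j ∧
    I.est s M i j ≤ (1 + η) * dist (I.x j) (I.x i)

theorem Accurate.mono {η ε : ℝ} (h : Accurate η I s M) (hη : η ≤ ε) : Accurate ε I s M :=
  fun i j => ⟨le_trans (by gcongr) (h i j).1, (h i j).2.trans (by gcongr)⟩

theorem Accurate.queryAccurate {ε : ℝ} {σ₀ : State} (h : Accurate ε I s M) (h0 : Sem I s M 0 σ₀)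
    (hn : 0 < n) (hist : List Op) : QueryAccurate ε I σ₀ hist := by
  intro σ hσ i hi τ hτ j hj
  have hS := h0.run hn hist σ hσ
  rw [((hS.query hn i) τ hτ).2.2 (lt_min hi i.2) j (lt_min hj j.2)]
  exact h i j

/-- The value of a matched seller copy is the estimate of its current mate, and for a seller that
has left this mate is the finalized one; unmatched sellers contribute zero on both sides. -/
theorem Sem.p_eq (h : Sem I s M t σ) :
    σ.real .p 0 0 = ∑ e ∈ matched n σ, I.est s M e.2 e.1 := by
  classical
  have hs := I.est_self s M
  rw [h.ledger.value, matched, Finset.sum_filter, ← Finset.univ_product_univ,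
    Finset.sum_product, ← Fin.sum_univ_eq_sum_range (fun i => if I.leftN t i ∧ σ.nat .role i 0 = 1
      then (tent n I.dl (I.est s M) t).w i else 0)]
  refine Finset.sum_congr rfl fun i _ => ?_
  split_ifs with hi
  · have hf := h.ledger.final_eq i hi.1 hi.2
    rcases Nat.eq_zero_or_eq_succ_pred ((tent n I.dl (I.est s M) t).mate i) with h0 | h0
    · rw [tent_mate_zero hs h0]
      refine (Finset.sum_eq_zero fun j _ => if_neg ?_).symm
      simp only [hf, h0]; omega
    · obtain ⟨-, -, h1, -, h2⟩ := tent_mate hs h0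
      rw [h2, Finset.sum_eq_single (⟨_, h1⟩ : Fin n)]
      · rw [if_pos]
        simp only [hf]; exact h0
      · intro j _ hj
        refine if_neg fun h' => hj (Fin.ext ?_)
        simp only [hf] at h'
        simp only; omega
      · simp
  · refine (Finset.sum_eq_zero fun j _ => if_neg fun h' => ?_).symm
    exact hi (h.ledger.of_final i (by simp only at h'; omega))

theorem Accurate.p_bounds {η : ℝ} (hA : Accurate η I s M) (h : Sem I s M t σ) :
    (1 - η) * I.weight (matched n σ) ≤ σ.real .p 0 0 ∧
      σ.real .p 0 0 ≤ (1 + η) * I.weight (matched n σ) := by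
  rw [h.p_eq, Input.weight, Finset.mul_sum, Finset.mul_sum]
  exact ⟨Finset.sum_le_sum fun e _ => (hA e.2 e.1).1, Finset.sum_le_sum fun e _ => (hA e.2 e.1).2⟩

/-- The two factors 2 meet here: greedy bounds (1 - η) times the optimum by twice the tentative
value W of the points that have left, and the coins keep W / 2 in expectation. -/
theorem Accurate.opt_le {η : ℝ} (hA : Accurate η I s M) (hη : η < 1) (t : ℕ) :
    ENNReal.ofReal ((1 - η) / 4 * I.opt t) ≤
      expectedValue n (tent n I.dl (I.est s M) t) (I.leftN t) := by
  classical
  set W := ∑ i : Fin n, if I.left t i then (tent n I.dl (I.est s M) t).w i else 0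
  have h1 : (1 - η) * I.opt t ≤ 2 * W := by
    rw [← le_div_iff₀' (by linarith)]
    -- The empty matching shows that the supremum is over a nonempty set.
    refine csSup_le ⟨0, ∅, by simp [Input.IsMatching], by simp, by simp [Input.weight]⟩ ?_
    rintro r ⟨S, hS, hl, rfl⟩
    rw [le_div_iff₀' (by linarith)]
    refine le_trans ?_ (tent_competitive I (I.est_self s M) hS hl)
    rw [Input.weight, Finset.mul_sum]
    exact Finset.sum_le_sum fun e _ => (hA e.2 e.1).1
  have h2 : expectedValue n (tent n I.dl (I.est s M) t) (I.leftN t) = ENNReal.ofReal (2⁻¹ * W) := by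
    rw [expectedValue, ← Fin.sum_univ_eq_sum_range (fun i => if I.leftN t i then
      2⁻¹ * ENNReal.ofReal ((tent n I.dl (I.est s M) t).w i) else 0), Finset.mul_sum,
      ENNReal.ofReal_sum_of_nonneg]
    · refine Finset.sum_congr rfl fun i _ => ?_
      have : I.leftN t i ↔ I.left t i := by simp [Input.leftN, Input.left, I.dl_fin]
      by_cases hi : I.left t i
      · rw [if_pos (this.2 hi), if_pos hi, ENNReal.ofReal_mul (by norm_num),
          ENNReal.ofReal_inv_of_pos (by norm_num)]
        simp
      · rw [if_neg (fun h => hi (this.1 h)), if_neg hi]; simp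
    · intro i _
      have := tent_w_nonneg (n := n) (dl := I.dl) (e := I.est s M) t i
      split_ifs <;> positivity
  rw [h2]
  exact ENNReal.ofReal_le_ofReal (by linarith)

/-- Since p is at most 1 + ε/2 times the weight, the bound for the weight follows from (1 + ε/2)(1 -
ε) ≤ 1 - ε/2. This is why accuracy ε/2 is required. -/
theorem Accurate.competitive {ε : ℝ} {σ₀ : State} (hε : 0 < ε) (hε1 : ε < 1)
    (hA : Accurate (ε / 2) I s M) (h0 : Sem I s M 0 σ₀) (hn : 0 < n) (h : List Op) :
    TotalWeightCompetitive ε I σ₀ h := by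
  have hrun := h0.run hn h
  have hSem : ∀ τ ∈ (run I σ₀ (.totalWeight :: h)).support,
      Sem I s M (elapsed h) τ ∧ τ.real .out 0 0 = τ.real .p 0 0 := by
    intro τ hτ
    simp only [FastPostponedGreedy.run, PMF.mem_support_bind_iff] at hτ
    obtain ⟨σ, hσ, hτ⟩ := hτ
    obtain ⟨h1, h2, h3⟩ := (hrun σ hσ).totalWeight hn τ hτ
    exact ⟨h1, by rw [h3, h2.p]⟩
  have hE := (Balanced.run h0 hn (.totalWeight :: h)).value
  have hopt := hA.opt_le (by linarith) (elapsed h)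
  have hopt0 : 0 ≤ I.opt (elapsed h) := by
    refine Real.sSup_nonneg ?_
    rintro r ⟨S, -, -, rfl⟩
    exact Finset.sum_nonneg fun _ _ => dist_nonneg
  rw [show elapsed (.totalWeight :: h) = elapsed h from rfl] at hE
  rw [← hE] at hopt
  refine ⟨fun τ hτ => ?_, ?_, ?_⟩
  · rw [(hSem τ hτ).2]
    exact (hA.mono (by linarith)).p_bounds (hSem τ hτ).1
  · refine le_trans (ENNReal.ofReal_le_ofReal ?_) (hopt.trans (Ex_mono fun τ hτ => ?_))
    · gcongr; linarith
    · simp only [(hSem τ hτ).2, le_refl]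
  · have h1 : ENNReal.ofReal ((1 - ε / 2) / 4 * I.opt (elapsed h)) ≤ ENNReal.ofReal (1 + ε / 2) *
        expect (run I σ₀ (.totalWeight :: h)) (fun τ => I.weight (matched n τ)) := by
      refine hopt.trans ?_
      have : expect (run I σ₀ (.totalWeight :: h)) (fun τ => I.weight (matched n τ)) =
        Ex (run I σ₀ (.totalWeight :: h)) (fun τ => ENNReal.ofReal (I.weight (matched n τ))) := rfl
      rw [this, ← Ex_mul_left]
      refine Ex_mono fun τ hτ => ?_
      rw [← ENNReal.ofReal_mul (by linarith)]
      exact ENNReal.ofReal_le_ofReal (hA.p_bounds (hSem τ hτ).1).2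
    have h2 : ENNReal.ofReal (1 + ε / 2) * ENNReal.ofReal ((1 - ε) / 4 * I.opt (elapsed h)) ≤
        ENNReal.ofReal ((1 - ε / 2) / 4 * I.opt (elapsed h)) := by
      rw [← ENNReal.ofReal_mul (by linarith)]
      refine ENNReal.ofReal_le_ofReal ?_
      have : (1 + ε / 2) * (1 - ε) ≤ 1 - ε / 2 := by nlinarith
      nlinarith
    exact (ENNReal.mul_le_mul_iff_right (by simp; linarith) ENNReal.ofReal_ne_top).1 (h2.trans h1)

end FastPostponedGreedy

namespace FastPostponedGreedy
open RealRAM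

/-! ### Random signed sums -/

/-- The average of `G (x ± a 0 ± … ± a (m - 1))` over all signs. -/
noncomputable def signAvg (a : ℕ → ℝ) : ℕ → (ℝ → ℝ) → ℝ → ℝ
  | 0, G, x => G x
  | m + 1, G, x => signAvg a m (fun y => (G (y + a m) + G (y - a m)) / 2) x

variable {a : ℕ → ℝ}

theorem signAvg_mono {G H : ℝ → ℝ} (h : ∀ x, G x ≤ H x) (m : ℕ) (x : ℝ) :
    signAvg a m G x ≤ signAvg a m H x := by
  induction m generalizing G H with
  | zero => exact h x
  | succ m ih => exact ih fun y => by linarith [h (y + a m), h (y - a m)]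

theorem signAvg_nonneg {G : ℝ → ℝ} (h : ∀ x, 0 ≤ G x) (m : ℕ) (x : ℝ) : 0 ≤ signAvg a m G x := by
  induction m generalizing G with
  | zero => exact h x
  | succ m ih => exact ih fun y => by linarith [h (y + a m), h (y - a m)]

theorem signAvg_linear (G H : ℝ → ℝ) (b c : ℝ) (m : ℕ) (x : ℝ) :
    signAvg a m (fun y => b * G y + c * H y) x = b * signAvg a m G x + c * signAvg a m H x := by
  induction m generalizing G H with
  | zero => rfl
  | succ m ih =>
    rw [signAvg, signAvg, signAvg, ← ih]
    congr 1
    funext y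
    ring

theorem signAvg_mul (G : ℝ → ℝ) (b : ℝ) (m : ℕ) (x : ℝ) :
    signAvg a m (fun y => b * G y) x = b * signAvg a m G x := by
  simpa using signAvg_linear (a := a) G G b 0 m x

theorem signAvg_quadratic (b c : ℝ) (m : ℕ) (x : ℝ) :
    signAvg a m (fun y => b + c * y ^ 2) x = b + c * (x ^ 2 + ∑ k ∈ Finset.range m, a k ^ 2) := by
  induction m generalizing b with
  | zero => simp [signAvg]
  | succ m ih =>
    rw [signAvg]
    have : (fun y => (b + c * (y + a m) ^ 2 + (b + c * (y - a m) ^ 2)) / 2) =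
        fun y => (b + c * a m ^ 2) + c * y ^ 2 := by funext y; ring
    rw [this, ih, Finset.sum_range_succ]
    ring

/-- The right side is the value obtained when the sign is replaced by a standard Gaussian. The
comparison uses cosh z ≤ exp(z²/2) and 1 - u ≤ exp(-u). -/
theorem exp_sq_step {l b x : ℝ} (hl : 0 ≤ l) (hb : 2 * l * b ^ 2 < 1) :
    (Real.exp (l * (x + b) ^ 2) + Real.exp (l * (x - b) ^ 2)) / 2 ≤
      (Real.sqrt (1 - 2 * l * b ^ 2))⁻¹ * Real.exp (l / (1 - 2 * l * b ^ 2) * x ^ 2) := by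
  have hu : 0 < 1 - 2 * l * b ^ 2 := by linarith
  have h1 : (Real.exp (l * (x + b) ^ 2) + Real.exp (l * (x - b) ^ 2)) / 2 =
      Real.exp (l * b ^ 2) * (Real.exp (l * x ^ 2) * Real.cosh (2 * l * x * b)) := by
    rw [Real.cosh_eq, ← mul_assoc, ← Real.exp_add, mul_div_assoc', mul_add, ← Real.exp_add,
      ← Real.exp_add]
    ring_nf
  have h2 : Real.exp (l * b ^ 2) ≤ (Real.sqrt (1 - 2 * l * b ^ 2))⁻¹ := by
    rw [← inv_inv (Real.exp _), ← Real.exp_neg]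
    refine inv_anti₀ (Real.sqrt_pos.2 hu) (Real.sqrt_le_iff.2 ⟨(Real.exp_pos _).le, ?_⟩)
    rw [← Real.exp_nat_mul]
    have := Real.add_one_le_exp (((2 : ℕ) : ℝ) * -(l * b ^ 2))
    push_cast at this ⊢
    linarith
  have h3 : Real.exp (l * x ^ 2) * Real.cosh (2 * l * x * b) ≤
      Real.exp (l / (1 - 2 * l * b ^ 2) * x ^ 2) := by
    refine (mul_le_mul_of_nonneg_left (Real.cosh_le_exp_half_sq _) (Real.exp_pos _).le).trans ?_
    rw [← Real.exp_add]
    refine Real.exp_le_exp.2 ?_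
    have h4 : l * (1 + 2 * l * b ^ 2) ≤ l / (1 - 2 * l * b ^ 2) := by
      rw [le_div_iff₀ hu]
      nlinarith [sq_nonneg (2 * l * b ^ 2)]
    have := mul_le_mul_of_nonneg_right h4 (sq_nonneg x)
    nlinarith
  rw [h1]
  exact mul_le_mul h2 h3 (by positivity) (by positivity)

/-- The functions exp(l y²) are closed under the Gaussian step, up to a factor, so the signs can be
averaged out one by one while l changes. -/
theorem signAvg_exp_sq {l : ℝ} (hl : 0 ≤ l) (m : ℕ) (x : ℝ)
    (h : 2 * l * ∑ k ∈ Finset.range m, a k ^ 2 < 1) :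
    signAvg a m (fun y => Real.exp (l * y ^ 2)) x ≤
      (Real.sqrt (1 - 2 * l * ∑ k ∈ Finset.range m, a k ^ 2))⁻¹ *
        Real.exp (l / (1 - 2 * l * ∑ k ∈ Finset.range m, a k ^ 2) * x ^ 2) := by
  induction m generalizing l with
  | zero => simp [signAvg]
  | succ m ih =>
    rw [Finset.sum_range_succ] at h ⊢
    set V := ∑ k ∈ Finset.range m, a k ^ 2
    have hV : 0 ≤ V := Finset.sum_nonneg fun k _ => sq_nonneg _
    have hb : 2 * l * a m ^ 2 < 1 := by nlinarith [mul_nonneg hl hV]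
    have hu : 0 < 1 - 2 * l * a m ^ 2 := by linarith
    -- Variances add: the normalizing factors of two successive steps multiply to that of the
    -- combined variance.
    have e1 : (1 - 2 * l * a m ^ 2) * (1 - 2 * (l / (1 - 2 * l * a m ^ 2)) * V) =
        1 - 2 * l * (V + a m ^ 2) := by
      field_simp
      ring
    have h' : 2 * (l / (1 - 2 * l * a m ^ 2)) * V < 1 := by
      have : 0 < (1 - 2 * l * a m ^ 2) * (1 - 2 * (l / (1 - 2 * l * a m ^ 2)) * V) := by
        rw [e1]; linarith
      have := pos_of_mul_pos_right this hu.le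
      linarith
    rw [signAvg]
    refine (signAvg_mono (fun y => exp_sq_step hl hb) m x).trans ?_
    rw [signAvg_mul]
    refine (mul_le_mul_of_nonneg_left (ih (div_nonneg hl hu.le) h') (by positivity)).trans (le_of_eq ?_)
    rw [← mul_assoc, ← mul_inv, ← Real.sqrt_mul hu.le, e1, div_div, e1]

/-- An expansion to second order whose remainder has a bounded expectation. It allows l of either
sign, as both tails require. -/
theorem exp_le_of_abs {l x : ℝ} (hl : |l| ≤ 1 / 8) (hx : 0 ≤ x) :
    Real.exp (l * x) ≤ 1 + l * x + 128 * l ^ 2 * Real.exp (1 / 4 * x) := by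
  have h1 : Real.exp (l * x) ≤ 1 + l * x + (l * x) ^ 2 * Real.exp |l * x| := by
    have hsq := sq_nonneg (l * x)
    have hone : 1 ≤ Real.exp |l * x| := Real.one_le_exp (abs_nonneg _)
    by_cases h : |l * x| ≤ 1
    · have := (abs_le.1 (Real.abs_exp_sub_one_sub_id_le h)).2
      nlinarith
    · rcases le_total 0 (l * x) with h0 | h0
      · rw [abs_of_nonneg h0] at h ⊢
        have h2 : 1 ≤ (l * x) ^ 2 := by nlinarith
        linarith [mul_le_mul_of_nonneg_right h2 (Real.exp_pos (l * x)).le]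
      · have : Real.exp (l * x) ≤ 1 := Real.exp_le_one_iff.2 h0
        rw [abs_of_nonpos h0] at h hone ⊢
        nlinarith
  -- The constant comes from (x/8)²/2 ≤ exp(x/8).
  have h2 : x ^ 2 ≤ 128 * Real.exp (1 / 8 * x) := by
    have := Real.quadratic_le_exp_of_nonneg (x := 1 / 8 * x) (by positivity)
    nlinarith
  have h3 : Real.exp |l * x| ≤ Real.exp (1 / 8 * x) := by
    rw [abs_mul, abs_of_nonneg hx]
    exact Real.exp_le_exp.2 (mul_le_mul_of_nonneg_right hl hx)
  have h4 : (l * x) ^ 2 * Real.exp |l * x| ≤ l ^ 2 * (128 * Real.exp (1 / 8 * x)) * Real.exp (1 / 8 * x) := by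
    rw [mul_pow]
    gcongr
  have h5 : Real.exp (1 / 4 * x) = Real.exp (1 / 8 * x) * Real.exp (1 / 8 * x) := by
    rw [← Real.exp_add]; ring_nf
  rw [h5]
  linarith

/-- The moment generating function of the centred square of a random signed sum. -/
theorem signAvg_exp_le {l : ℝ} {m : ℕ} (hV : 0 < ∑ k ∈ Finset.range m, a k ^ 2)
    (hl : |l * ∑ k ∈ Finset.range m, a k ^ 2| ≤ 1 / 8) :
    signAvg a m (fun y => Real.exp (l * y ^ 2)) 0 ≤
      Real.exp (l * (∑ k ∈ Finset.range m, a k ^ 2) +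
        200 * (l * ∑ k ∈ Finset.range m, a k ^ 2) ^ 2) := by
  set V := ∑ k ∈ Finset.range m, a k ^ 2 with hVdef
  have h1 (y : ℝ) : Real.exp (l * y ^ 2) ≤
      1 * (1 + l * y ^ 2) + 128 * (l * V) ^ 2 * Real.exp (1 / (4 * V) * y ^ 2) := by
    have := exp_le_of_abs hl (x := y ^ 2 / V) (by positivity)
    have e1 : l * V * (y ^ 2 / V) = l * y ^ 2 := by field_simp
    have e2 : 1 / 4 * (y ^ 2 / V) = 1 / (4 * V) * y ^ 2 := by field_simp
    rw [e1, e2] at this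
    linarith
  -- At this parameter the Gaussian bound is √2. With the factor 128 the quadratic term is at most
  -- 192, rounded up to 200.
  have h2 : signAvg a m (fun y => Real.exp (1 / (4 * V) * y ^ 2)) 0 ≤ 3 / 2 := by
    have e1 : 2 * (1 / (4 * V)) * V = 1 / 2 := by field_simp; norm_num
    refine (signAvg_exp_sq (by positivity) m 0 (by rw [← hVdef, e1]; norm_num)).trans ?_
    rw [← hVdef, e1]
    have h3 : (2 / 3 : ℝ) ≤ Real.sqrt (1 - 1 / 2) := Real.le_sqrt_of_sq_le (by norm_num)
    simp only [ne_eq, OfNat.ofNat_ne_zero, not_false_eq_true, zero_pow, mul_zero, Real.exp_zero,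
      mul_one]
    calc _ ≤ (2 / 3 : ℝ)⁻¹ := inv_anti₀ (by norm_num) h3
      _ = 3 / 2 := by norm_num
  refine (signAvg_mono h1 m 0).trans ?_
  rw [signAvg_linear, signAvg_quadratic]
  have h4 := Real.add_one_le_exp (l * V + 200 * (l * V) ^ 2)
  have h5 := mul_le_mul_of_nonneg_left h2 (by positivity : 0 ≤ 128 * (l * V) ^ 2)
  nlinarith [sq_nonneg (l * V)]

end FastPostponedGreedy

/-! ### The random matrix and the state that `init` leaves behind. -/

namespace FastPostponedGreedy
open RealRAM

attribute [local simp] nreg rreg setNreg setRreg nat1 real1 setN1 setR1 NExpr.eval RExpr.eval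
  BExpr.holds writeN_nat writeR_real wp_block_nil wp_block_cons

variable {n d s : ℕ} {σ τ : State}

/-! ### The law of the sketching matrix -/

/-- Drawing an entry of the matrix. -/
def drawEntry : Cmd := block [
  .flip .coin,
  .ite (.eqN (nreg .coin) (.lit 1))
    (.setR .M (nreg .a) (nreg .k) (rreg .scale))
    (.setR .M (nreg .a) (nreg .k) (.sub (.lit 0) (rreg .scale)))]

/-- Drawing a row of the matrix. -/
def drawRow : Cmd := .loop .k (nreg .d) drawEntry

/-- Drawing the matrix. -/
def drawMatrix : Cmd := .loop .a (nreg .s) drawRow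

/-- The part of `Init` that does not depend on coins. -/
def prepare (K : ℕ) : List Cmd := [
  setRreg .p (.lit 0),
  setNreg .now (.lit 0),
  setNreg .cnt (.lit 0),
  .ceil .s (.div
    (.mul (.lit K) (.log (.div (.ofN (nreg .n)) (rreg .delta))))
    (.mul (rreg .eps) (rreg .eps))),
  setRreg .scale (.div (.lit 1) (.sqrt (.ofN (nreg .s))))]

theorem drawEntry_Ex (v : ℕ → ℝ) {c : ℝ} {r q : ℕ} (hr : σ.nat .a 0 0 = r) (hq : σ.nat .k 0 0 = q)
    (hc : σ.real .scale 0 0 = c) {G : ℝ → ℝ} (hG : ∀ x, 0 ≤ G x) :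
    Ex (exec drawEntry σ)
      (fun τ => ENNReal.ofReal (G (∑ k ∈ Finset.range (q + 1), τ.real .M r k * v k))) =
    ENNReal.ofReal ((G (∑ k ∈ Finset.range q, σ.real .M r k * v k + c * v q) +
      G (∑ k ∈ Finset.range q, σ.real .M r k * v k - c * v q)) / 2) := by
  have hsum (τ : State) (x : ℝ)
      (h : ∀ k, τ.real .M r k = if k = q then x else σ.real .M r k) :
      ∑ k ∈ Finset.range (q + 1), τ.real .M r k * v k =
        ∑ k ∈ Finset.range q, σ.real .M r k * v k + x * v q := by
    rw [Finset.sum_range_succ, h q, if_pos rfl]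
    congr 1
    refine Finset.sum_congr rfl fun k hk => ?_
    rw [h k, if_neg (Finset.mem_range.1 hk).ne]
  rw [drawEntry, block, Ex_seq, Ex_flip]
  rw [Ex_eq_of_wp (x := ENNReal.ofReal (G (∑ k ∈ Finset.range q, σ.real .M r k * v k + c * v q))),
    Ex_eq_of_wp (x := ENNReal.ofReal (G (∑ k ∈ Finset.range q, σ.real .M r k * v k - c * v q))),
    ← ENNReal.ofReal_add (hG _) (hG _), ENNReal.ofReal_div_of_pos (by norm_num)]
  · norm_num
  · simp only [wp_block_cons, wp_block_nil, wp_ite, wp_setR]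
    refine ⟨fun h => absurd h (by simp), fun _ => ?_⟩
    rw [hsum _ (-c) (by simp [hr, hq, hc])]
    ring_nf
  · simp only [wp_block_cons, wp_block_nil, wp_ite, wp_setR]
    refine ⟨fun _ => ?_, fun h => absurd (by simp) h⟩
    rw [hsum _ c (by simp [hr, hq, hc])]

/-- Conditioning on all entries but the last replaces G by its average over one sign, which is the
recursion of `signAvg`. -/
theorem drawRow_Ex (v : ℕ → ℝ) {c : ℝ} {r : ℕ} (hr : σ.nat .a 0 0 = r) (hd : σ.nat .d 0 0 = d)
    (hc : σ.real .scale 0 0 = c) {G : ℝ → ℝ} (hG : ∀ x, 0 ≤ G x) :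
    Ex (exec drawRow σ)
      (fun τ => ENNReal.ofReal (G (∑ k ∈ Finset.range d, τ.real .M r k * v k))) =
    ENNReal.ofReal (signAvg (fun k => c * v k) d G 0) := by
  let body : ℕ → State → PMF State := fun m τ => exec drawEntry ((τ.writeN .k 0 0 m).tick 1)
  have hinv (ρ : State) (h1 : ρ.nat .a 0 0 = r) (h2 : ρ.real .scale 0 0 = c) (q : ℕ) :
      ∀ τ ∈ (iterate body ρ q).support, τ.nat .a 0 0 = r ∧ τ.real .scale 0 0 = c := by
    refine iterate_induction (fun _ τ => τ.nat .a 0 0 = r ∧ τ.real .scale 0 0 = c) ⟨h1, h2⟩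
      fun k _ τ hτ π hπ => ?_
    have hF := wp_frame drawEntry _ π hπ
    rw [hF.nat .a (by decide), hF.real .scale (by decide)]
    simpa using hτ
  have key (ρ : State) (h1 : ρ.nat .a 0 0 = r) (h2 : ρ.real .scale 0 0 = c) (q : ℕ) :
      Ex (iterate body ρ q) (fun τ => ENNReal.ofReal (G (∑ k ∈ Finset.range q, τ.real .M r k * v k))) =
      ENNReal.ofReal (signAvg (fun k => c * v k) q G 0) := by
    induction q generalizing G with
    | zero => simp [iterate, Ex_pure, signAvg]
    | succ q ih =>
      rw [Ex_iterate_succ, signAvg, ← ih fun x => by linarith [hG (x + c * v q), hG (x - c * v q)]]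
      refine Ex_congr fun τ hτ => ?_
      obtain ⟨h3, h4⟩ := hinv ρ h1 h2 q τ hτ
      exact drawEntry_Ex v (by simpa using h3) (by simp) (by simpa using h4) hG
  have := key (σ.tick 4) hr hc d
  rw [drawRow, exec]
  simp only [nreg, NExpr.eval, hd, NExpr.cost]
  exact this

/-- Independence of the rows in operational form: drawing row m leaves the earlier rows alone, and
its exponential moment does not depend on them, so the moments multiply. -/
theorem drawMatrix_Ex (v : ℕ → ℝ) {c l : ℝ} (hs : σ.nat .s 0 0 = s) (hd : σ.nat .d 0 0 = d)
    (hc : σ.real .scale 0 0 = c) :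
    Ex (exec drawMatrix σ) (fun τ => ENNReal.ofReal (Real.exp (l * ∑ a ∈ Finset.range s,
      (∑ k ∈ Finset.range d, τ.real .M a k * v k) ^ 2))) =
    ENNReal.ofReal (signAvg (fun k => c * v k) d (fun y => Real.exp (l * y ^ 2)) 0 ^ s) := by
  let body : ℕ → State → PMF State := fun m τ => exec drawRow ((τ.writeN .a 0 0 m).tick 1)
  have hinv (ρ : State) (h1 : ρ.nat .d 0 0 = d) (h2 : ρ.real .scale 0 0 = c) (q : ℕ) :
      ∀ τ ∈ (iterate body ρ q).support, τ.nat .d 0 0 = d ∧ τ.real .scale 0 0 = c := by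
    refine iterate_induction (fun _ τ => τ.nat .d 0 0 = d ∧ τ.real .scale 0 0 = c) ⟨h1, h2⟩
      fun k _ τ hτ π hπ => ?_
    have hF := wp_frame drawRow _ π hπ
    rw [hF.nat .d (by decide), hF.real .scale (by decide)]
    simpa using hτ
  have hrow (ρ : State) (m : ℕ) (hm : ρ.nat .a 0 0 = m) :
      wp drawRow (fun τ => ∀ a < m, ∀ k, τ.real .M a k = ρ.real .M a k) ρ := by
    refine wp_loop (fun _ τ => ∀ a < m, ∀ k, τ.real .M a k = ρ.real .M a k) (fun _ _ _ => rfl)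
      (fun q _ τ hF hτ => ?_) fun τ _ h => h
    have ha : τ.nat .a 0 0 = m := by rw [hF.nat .a (by decide), hm]
    simp only [drawEntry, wp_block_cons, wp_block_nil, wp_flip, wp_ite, wp_setR]
    refine ⟨⟨fun _ a ham k => ?_, fun _ a ham k => ?_⟩, ⟨fun _ a ham k => ?_, fun _ a ham k => ?_⟩⟩ <;>
    · have hne : a ≠ m := ham.ne
      simp [ha, hne, hτ a ham k]
  have key (ρ : State) (h1 : ρ.nat .d 0 0 = d) (h2 : ρ.real .scale 0 0 = c) (m : ℕ) :
      Ex (iterate body ρ m) (fun τ => ENNReal.ofReal (Real.exp (l * ∑ a ∈ Finset.range m,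
        (∑ k ∈ Finset.range d, τ.real .M a k * v k) ^ 2))) =
      ENNReal.ofReal (signAvg (fun k => c * v k) d (fun y => Real.exp (l * y ^ 2)) 0 ^ m) := by
    induction m with
    | zero => simp [iterate, Ex_pure]
    | succ m ih =>
      rw [Ex_iterate_succ, pow_succ, ENNReal.ofReal_mul (pow_nonneg
        (signAvg_nonneg (fun _ => (Real.exp_pos _).le) _ _) _), ← ih, ← Ex_mul_right]
      refine Ex_congr fun τ hτ => ?_
      obtain ⟨h3, h4⟩ := hinv ρ h1 h2 m τ hτ
      rw [← drawRow_Ex (σ := (τ.writeN .a 0 0 m).tick 1) v (r := m) (by simp) (by simpa using h3)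
        (by simpa using h4) (fun y => (Real.exp_pos (l * y ^ 2)).le), ← Ex_mul_left]
      refine Ex_congr fun π hπ => ?_
      have h5 := hrow _ m (by simp) π hπ
      rw [← ENNReal.ofReal_mul (Real.exp_pos _).le, ← Real.exp_add, Finset.sum_range_succ, mul_add]
      congr 4
      refine Finset.sum_congr rfl fun a ha => ?_
      congr 1
      refine Finset.sum_congr rfl fun k _ => ?_
      rw [h5 a (Finset.mem_range.1 ha)]
      simp
  have := key (σ.tick 4) hd hc s
  rw [drawMatrix, exec]
  simp only [nreg, NExpr.eval, hs, NExpr.cost]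
  exact this

/-! ### The state after `Init` -/

/-- The sketch dimension. -/
noncomputable def sketchDim (K n : ℕ) (ε δ : ℝ) : ℕ := ⌈K * Real.log (n / δ) / (ε * ε)⌉₊

/-- The machine before `Init`. -/
noncomputable def initial (n d : ℕ) (ε δ : ℝ) : State :=
  (((State.blank.writeN .n 0 0 n).writeN .d 0 0 d).writeR .eps 0 0 ε).writeR .delta 0 0 δ

/-- The state when the drawing of the matrix begins. -/
structure Prepared (K n d : ℕ) (ε δ : ℝ) (σ : State) : Prop where
  dim : σ.nat .d 0 0 = d
  size : σ.nat .s 0 0 = sketchDim K n ε δ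
  now : σ.nat .now 0 0 = 0
  cnt : σ.nat .cnt 0 0 = 0
  p : σ.real .p 0 0 = 0
  scale : σ.real .scale 0 0 = 1 / Real.sqrt (sketchDim K n ε δ)
  nat : ∀ v, v = .mate ∨ v = .role ∨ v = .final → σ.nat v = fun _ _ => 0
  real : σ.real .w = fun _ _ => 0
  time : σ.time ≤ 100
  cells : ∀ s, 0 < n → σ.cells ⊆ room n d s

/-- All commands before the drawing are deterministic and lead to a single state; the trailing
`skip` comes from `block`. -/
theorem exec_init (K n d : ℕ) (ε δ : ℝ) : ∃ σ, Prepared K n d ε δ σ ∧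
    initLaw K n d ε δ = (exec drawMatrix σ).bind (exec .skip) := by
  have e : initLaw K n d ε δ = exec (block (prepare K ++ [drawMatrix])) (initial n d ε δ) := rfl
  simp only [prepare, List.cons_append, List.nil_append, block, exec, PMF.pure_bind, setNreg,
    setRreg] at e
  refine ⟨_, ?_, e⟩
  constructor
  · simp [initial]
  · simp [initial, sketchDim]
  · simp
  · simp
  · simp
  · simp [initial, sketchDim]
  · rintro v (rfl | rfl | rfl) <;> funext i j <;> simp [initial, State.blank]
  · funext i j; simp [initial, State.blank]
  · simp [initial, State.blank, NExpr.cost, RExpr.cost]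
  · intro s hn
    have hN (v : NVar) : (Sum.inl v, 0, 0) ∈ room n d s := room_nat hn
    have hR (v : RVar) : (Sum.inr v, 0, 0) ∈ room n d s := room_real hn
    simp [initial, State.blank, Finset.insert_subset_iff, hN, hR]

theorem wp_drawMatrix {K : ℕ} {ε δ : ℝ} (h : Prepared K n d ε δ σ) (hn : 0 < n) :
    wp drawMatrix (fun τ => τ.cells ⊆ room n d (sketchDim K n ε δ)) σ := by
  set s := sketchDim K n ε δ
  refine wp_loop (fun _ τ => τ.cells ⊆ room n d s) (h.cells s hn) (fun m hm τ hF hτ => ?_)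
    fun _ _ h => h
  have hm : m < s := by simpa [h.size] using hm
  refine wp_loop (fun _ τ => τ.cells ⊆ room n d s) (Finset.insert_subset (room_nat hn) hτ)
    (fun q hq ρ hG hρ => ?_) fun _ _ h => h
  have hd : τ.nat .d 0 0 = d := by rw [hF.nat .d (by decide), h.dim]
  have hq : q < d := by simpa [hd] using hq
  have ha : ρ.nat .a 0 0 = m := by rw [hG.nat .a (by decide)]; simp
  have hcell := Finset.insert_subset (room_nat (v := .coin) hn)
    (Finset.insert_subset (room_nat (v := .k) hn) hρ)
  have hMc := Finset.insert_subset (room_M hm hq) hcell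
  simp only [drawEntry, wp_block_cons, wp_block_nil, wp_flip, wp_ite, wp_setR]
  refine ⟨⟨fun _ => ?_, fun _ => ?_⟩, ⟨fun _ => ?_, fun _ => ?_⟩⟩ <;>
  · simpa [ha] using hMc

theorem drawMatrix_cost : drawMatrix.cost (loopBound n d s) ≤ 100 * (s + 1) * (d + 1) := by
  simp [drawMatrix, drawRow, drawEntry, block, Cmd.cost, nreg, rreg, NExpr.cost,
    RExpr.cost, BExpr.cost, loopBound]
  nlinarith [Nat.zero_le (s * d)]

theorem regLoops_drawMatrix : drawMatrix.RegLoops := by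
  simp [drawMatrix, drawRow, drawEntry, block, Cmd.RegLoops, nreg]

theorem init_support {K : ℕ} {ε δ : ℝ} (hn : 0 < n) {σ₀ : State}
    (hσ : σ₀ ∈ (initLaw K n d ε δ).support) :
    (∀ I : Input n d, Sem I (sketchDim K n ε δ) (σ₀.real .M) 0 σ₀) ∧
      σ₀.time ≤ 300 * (sketchDim K n ε δ + 1) * (d + 1) := by
  obtain ⟨σ, hP, e⟩ := exec_init K n d ε δ
  rw [e] at hσ
  simp only [exec, PMF.mem_support_bind_iff, PMF.mem_support_pure_iff] at hσ
  obtain ⟨τ, hτ, rfl⟩ := hσ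
  have hF := wp_frame drawMatrix σ τ hτ
  refine ⟨fun I => ?_, ?_⟩
  · have hz : min 0 n = 0 := Nat.zero_min n
    have hL (i : ℕ) : ¬ I.leftN 0 i := fun h => by simpa using Input.lt_of_leftN h
    rw [Sem, hz]
    have h1 : τ.nat .mate = fun _ _ => 0 := by rw [hF.nat .mate (by decide), hP.nat _ (by simp)]
    have h2 : τ.nat .role = fun _ _ => 0 := by rw [hF.nat .role (by decide), hP.nat _ (by simp)]
    have h3 : τ.nat .final = fun _ _ => 0 := by rw [hF.nat .final (by decide), hP.nat _ (by simp)]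
    have h4 : τ.real .w = fun _ _ => 0 := by rw [hF.real .w (by decide), hP.real]
    have h5 : τ.real .p 0 0 = 0 := by rw [hF.real .p (by decide), hP.p]
    refine ⟨?_, ?_, ?_, ?_, rfl, by simp, by simp, ?_, by simp, ?_, wp_drawMatrix hP hn τ hτ⟩
    · rw [tick_nat, hF.nat .d (by decide), hP.dim]
    · rw [tick_nat, hF.nat .s (by decide), hP.size]
    · rw [tick_nat, hF.nat .now (by decide), hP.now]
    · rw [tick_nat, hF.nat .cnt (by decide), hP.cnt]
    · simp [State.tentative, h1, h4, tent]
    · simp only [tick_nat, tick_real, h2, h3, h5]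
      exact ⟨by simp, fun i hi => absurd hi (hL i), by simp, fun i hi => absurd hi (hL i),
        fun i hi => absurd hi (hL i), by simp, by simp⟩
  · have h1 := wp_time_of (n := n) regLoops_drawMatrix (by decide) (by decide) hP.dim hP.size
      (by rw [hP.cnt]; omega) drawMatrix_cost τ hτ
    have h2 := hP.time
    simp only [tick_time] at h1 ⊢
    nlinarith [Nat.zero_le (sketchDim K n ε δ * d)]

end FastPostponedGreedy

namespace FastPostponedGreedy
open RealRAM

variable {n d s : ℕ}

/-! ### Accuracy of the sketches -/

theorem initLaw_Ex (K : ℕ) (ε δ : ℝ) (v : ℕ → ℝ) (l : ℝ) :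
    Ex (initLaw K n d ε δ) (fun τ => ENNReal.ofReal (Real.exp
      (l * ∑ a ∈ Finset.range (sketchDim K n ε δ), (∑ k ∈ Finset.range d, τ.real .M a k * v k) ^ 2))) =
    ENNReal.ofReal (signAvg (fun k => 1 / Real.sqrt (sketchDim K n ε δ) * v k) d
      (fun y => Real.exp (l * y ^ 2)) 0 ^ sketchDim K n ε δ) := by
  obtain ⟨σ, hP, e⟩ := exec_init K n d ε δ
  rw [e, Ex_bind, ← drawMatrix_Ex v hP.size hP.dim hP.scale]
  refine Ex_congr fun τ _ => ?_
  rw [exec, Ex_pure]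
  rfl

/-- The probability that a sketch distorts the squared norm of `v` by more than the factor `1 ± η`. -/
theorem sketch_concentration (K : ℕ) {ε δ η : ℝ} (hη : 0 < η) (hη1 : η ≤ 1) (v : ℕ → ℝ)
    (hs : 0 < sketchDim K n ε δ) (hv : 0 < ∑ k ∈ Finset.range d, v k ^ 2) :
    (initLaw K n d ε δ).toOuterMeasure {σ |
      ¬ ((1 - η) * ∑ k ∈ Finset.range d, v k ^ 2 ≤ ∑ a ∈ Finset.range (sketchDim K n ε δ),
          (∑ k ∈ Finset.range d, σ.real .M a k * v k) ^ 2 ∧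
        ∑ a ∈ Finset.range (sketchDim K n ε δ), (∑ k ∈ Finset.range d, σ.real .M a k * v k) ^ 2 ≤
          (1 + η) * ∑ k ∈ Finset.range d, v k ^ 2)} ≤
    ENNReal.ofReal (2 * Real.exp (-(sketchDim K n ε δ * η ^ 2 / 800))) := by
  set s := sketchDim K n ε δ
  set D := ∑ k ∈ Finset.range d, v k ^ 2
  set Q : State → ℝ := fun σ => ∑ a ∈ Finset.range s, (∑ k ∈ Finset.range d, σ.real .M a k * v k) ^ 2
  have hs' : (0 : ℝ) < s := Nat.cast_pos.2 hs
  have hV : ∑ k ∈ Finset.range d, (1 / Real.sqrt s * v k) ^ 2 = D / s := by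
    simp only [mul_pow, div_pow, one_pow, Real.sq_sqrt hs'.le]
    rw [← Finset.mul_sum]
    ring
  have hV0 : 0 < D / s := by positivity
  -- Chernoff's bound, with l normalized by the variance D / s of a row. The choices l = ±η/400 with
  -- c = 1 ± η minimize 200 l² - |l| η and give the exponent -η²/800 per row for both tails.
  have main (l c : ℝ) (hl : |l| ≤ 1 / 8) (hc : l + 200 * l ^ 2 - l * c = -(η ^ 2 / 800)) :
      Ex (initLaw K n d ε δ) (fun σ => ENNReal.ofReal (Real.exp (l * s / D * (Q σ - c * D)))) ≤
      ENNReal.ofReal (Real.exp (-(s * η ^ 2 / 800))) := by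
    have e1 : l * s / D * (D / s) = l := by field_simp
    have h1 : signAvg (fun k => 1 / Real.sqrt s * v k) d (fun y => Real.exp (l * s / D * y ^ 2)) 0 ≤
        Real.exp (l + 200 * l ^ 2) := by
      have := signAvg_exp_le (a := fun k => 1 / Real.sqrt s * v k) (l := l * s / D) (m := d)
        (by rw [hV]; exact hV0) (by rw [hV, e1]; exact hl)
      rwa [hV, e1] at this
    have h2 (σ : State) : ENNReal.ofReal (Real.exp (l * s / D * (Q σ - c * D))) =
        ENNReal.ofReal (Real.exp (l * s / D * Q σ)) * ENNReal.ofReal (Real.exp (-(l * s * c))) := by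
      rw [← ENNReal.ofReal_mul (Real.exp_pos _).le, ← Real.exp_add]
      congr 2
      field_simp
      ring
    simp only [h2]
    rw [Ex_mul_right, initLaw_Ex, ← ENNReal.ofReal_mul
      (pow_nonneg (signAvg_nonneg (fun _ => (Real.exp_pos _).le) _ _) _)]
    refine ENNReal.ofReal_le_ofReal ?_
    refine (mul_le_mul_of_nonneg_right (pow_le_pow_left₀
      (signAvg_nonneg (fun _ => (Real.exp_pos _).le) _ _) h1 s) (Real.exp_pos _).le).trans ?_
    rw [← Real.exp_nat_mul, ← Real.exp_add]
    refine Real.exp_le_exp.2 (le_of_eq ?_)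
    linear_combination (s : ℝ) * hc
  have hup := main (η / 400) (1 + η) (by rw [abs_of_pos (by positivity)]; linarith) (by ring)
  have hlo := main (-(η / 400)) (1 - η) (by rw [abs_neg, abs_of_pos (by positivity)]; linarith)
    (by ring)
  rw [two_mul, ENNReal.ofReal_add (Real.exp_pos _).le (Real.exp_pos _).le]
  refine (toOuterMeasure_le_Ex _ _ (fun σ =>
    ENNReal.ofReal (Real.exp (η / 400 * s / D * (Q σ - (1 + η) * D))) +
    ENNReal.ofReal (Real.exp (-(η / 400) * s / D * (Q σ - (1 - η) * D)))) ?_).trans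
    ((Ex_add _ _ _).le.trans (add_le_add hup hlo))
  intro σ _ hσ
  have hσ' : Q σ < (1 - η) * D ∨ (1 + η) * D < Q σ := by
    by_contra h
    push Not at h
    exact hσ h
  have one_le {x : ℝ} (hx : 0 ≤ x) : 1 ≤ ENNReal.ofReal (Real.exp x) := by
    rw [← ENNReal.ofReal_one]
    exact ENNReal.ofReal_le_ofReal (Real.one_le_exp hx)
  rcases hσ' with h | h
  · refine le_trans (one_le ?_) le_add_self
    have : 0 ≤ (η / 400) * s / D * ((1 - η) * D - Q σ) := mul_nonneg (by positivity) (by linarith)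
    linarith [show -(η / 400) * s / D * (Q σ - (1 - η) * D) =
      (η / 400) * s / D * ((1 - η) * D - Q σ) by ring]
  · exact le_trans (one_le (mul_nonneg (by positivity) (by linarith))) le_self_add

theorem dist_sq_eq (I : Input n d) (i j : Fin n) :
    dist (I.x j) (I.x i) ^ 2 = ∑ k ∈ Finset.range d, (I.coord i k - I.coord j k) ^ 2 := by
  rw [EuclideanSpace.dist_eq, Real.sq_sqrt (Finset.sum_nonneg fun _ _ => sq_nonneg _),
    ← Fin.sum_univ_eq_sum_range (fun k => (I.coord i k - I.coord j k) ^ 2)]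
  refine Finset.sum_congr rfl fun k _ => ?_
  simp only [Input.coord, Fin.is_lt, and_self, dif_pos, Fin.eta, Real.dist_eq, sq_abs]
  ring

theorem est_eq (I : Input n d) (s : ℕ) (M : ℕ → ℕ → ℝ) (i j : ℕ) :
    I.est s M i j = Real.sqrt (∑ a ∈ Finset.range s,
      (∑ k ∈ Finset.range d, M a k * (I.coord i k - I.coord j k)) ^ 2) := by
  rw [Input.est, sketchDist]
  congr 1
  refine Finset.sum_congr rfl fun a _ => ?_
  rw [Input.sketch, Input.sketch, ← Finset.sum_sub_distrib, ← sq]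
  congr 1
  exact Finset.sum_congr rfl fun k _ => by ring

/-- Nothing is lost in passing from squared norms to norms, because (1 - η)² ≤ 1 - η and 1 + η ≤ (1
+ η)². -/
theorem sqrt_bounds {η D Q : ℝ} (hη : 0 < η) (hη1 : η ≤ 1) (hD : 0 ≤ D)
    (h1 : (1 - η) * D ^ 2 ≤ Q) (h2 : Q ≤ (1 + η) * D ^ 2) :
    (1 - η) * D ≤ Real.sqrt Q ∧ Real.sqrt Q ≤ (1 + η) * D := by
  constructor
  · refine Real.le_sqrt_of_sq_le (le_trans ?_ h1)
    rw [mul_pow]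
    gcongr
    nlinarith
  · refine Real.sqrt_le_iff.2 ⟨by positivity, h2.trans ?_⟩
    rw [mul_pow]
    gcongr
    nlinarith

theorem pair_failure (I : Input n d) (K : ℕ) {ε δ η : ℝ} (hη : 0 < η) (hη1 : η ≤ 1)
    (hs : 0 < sketchDim K n ε δ) (i j : Fin n) :
    (initLaw K n d ε δ).toOuterMeasure {σ |
      ¬ ((1 - η) * dist (I.x j) (I.x i) ≤ I.est (sketchDim K n ε δ) (σ.real .M) i j ∧
        I.est (sketchDim K n ε δ) (σ.real .M) i j ≤ (1 + η) * dist (I.x j) (I.x i))} ≤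
    ENNReal.ofReal (2 * Real.exp (-(sketchDim K n ε δ * η ^ 2 / 800))) := by
  -- Coinciding points are estimated exactly; the concentration bound needs a nonzero difference.
  by_cases h0 : dist (I.x j) (I.x i) = 0
  · have hz : ∀ k ∈ Finset.range d, I.coord i k - I.coord j k = 0 := by
      have := dist_sq_eq I i j
      rw [h0, zero_pow two_ne_zero, eq_comm, Finset.sum_eq_zero_iff_of_nonneg
        fun _ _ => sq_nonneg _] at this
      exact fun k hk => by simpa using this k hk
    have he (M : ℕ → ℕ → ℝ) : I.est (sketchDim K n ε δ) M i j = 0 := by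
      rw [est_eq, Finset.sum_eq_zero, Real.sqrt_zero]
      intro a _
      rw [Finset.sum_eq_zero, zero_pow two_ne_zero]
      intro k hk
      rw [hz k hk, mul_zero]
    simp [h0, he]
  · have hpos : 0 < ∑ k ∈ Finset.range d, (I.coord i k - I.coord j k) ^ 2 := by
      rw [← dist_sq_eq]
      have := dist_nonneg (x := I.x j) (y := I.x i)
      positivity
    refine le_trans (MeasureTheory.measure_mono fun σ hσ => ?_)
      (sketch_concentration K hη hη1 (fun k => I.coord i k - I.coord j k) hs hpos)
    refine fun h => hσ ?_
    rw [← dist_sq_eq] at h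
    rw [est_eq]
    exact sqrt_bounds hη hη1 dist_nonneg h.1 h.2

theorem accurate_probability (I : Input n d) (K : ℕ) {ε δ η p : ℝ} (hη : 0 < η) (hη1 : η ≤ 1)
    (hs : 0 < sketchDim K n ε δ) (hp : n * n * (2 * Real.exp (-(sketchDim K n ε δ * η ^ 2 / 800))) ≤ p) :
    ENNReal.ofReal (1 - p) ≤ (initLaw K n d ε δ).toOuterMeasure
      {σ | Accurate η I (sketchDim K n ε δ) (σ.real .M)} := by
  set μ := initLaw K n d ε δ
  set G := {σ : State | Accurate η I (sketchDim K n ε δ) (σ.real .M)}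
  have hp0 : 0 ≤ p := le_trans (by positivity) hp
  have h1 : μ.toOuterMeasure Gᶜ ≤ ENNReal.ofReal p := by
    have hsub : Gᶜ ⊆ ⋃ q : Fin n × Fin n, {σ |
      ¬ ((1 - η) * dist (I.x q.2) (I.x q.1) ≤ I.est (sketchDim K n ε δ) (σ.real .M) q.1 q.2 ∧
        I.est (sketchDim K n ε δ) (σ.real .M) q.1 q.2 ≤ (1 + η) * dist (I.x q.2) (I.x q.1))} := by
      intro σ hσ
      simp only [G, Accurate, Set.mem_compl_iff, Set.mem_ofPred_eq] at hσ
      push Not at hσ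
      obtain ⟨i, j, h⟩ := hσ
      refine Set.mem_iUnion.2 ⟨(i, j), fun h' => ?_⟩
      exact absurd (h h'.1) (not_lt.2 h'.2)
    refine (MeasureTheory.measure_mono hsub).trans ((MeasureTheory.measure_iUnion_fintype_le _ _).trans ?_)
    refine (Finset.sum_le_sum fun q _ => pair_failure I K hη hη1 hs q.1 q.2).trans ?_
    rw [Finset.sum_const, Finset.card_univ, Fintype.card_prod, Fintype.card_fin, ← ENNReal.ofReal_nsmul]
    refine ENNReal.ofReal_le_ofReal ?_
    rw [nsmul_eq_mul]
    push_cast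
    exact hp
  have h2 : 1 ≤ μ.toOuterMeasure G + μ.toOuterMeasure Gᶜ := by
    have : μ.toOuterMeasure Set.univ = 1 := (PMF.toOuterMeasure_apply_eq_one_iff _ _).2 (Set.subset_univ _)
    rw [← this, ← Set.union_compl_self G]
    exact MeasureTheory.measure_union_le _ _
  rw [ENNReal.ofReal_sub _ hp0, ENNReal.ofReal_one]
  exact tsub_le_iff_right.2 (h2.trans (by gcongr))

end FastPostponedGreedy

/-! ### Choice of the constants and conclusion. -/

theorem mainTheorem4 :
    ∃ (K : ℕ) (C : ℝ), ∀ (n d : ℕ) (ε δ : ℝ), 2 ≤ n → 1 ≤ d → 0 < ε → ε < 1 → 0 < δ → δ < 1 →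
      (∀ σ₀ ∈ (FastPostponedGreedy.initLaw K n d ε δ).support,
        (σ₀.time : ℝ) ≤ C * (ε⁻¹ ^ 2 * d * Real.log (n / δ))) ∧
      ∀ I : FastPostponedGreedy.Input n d,
        (∀ σ₀ ∈ (FastPostponedGreedy.initLaw K n d ε δ).support,
          ∀ h : List FastPostponedGreedy.Op,
            ∀ σ ∈ (FastPostponedGreedy.run I σ₀ h).support,
              FastPostponedGreedy.Sound C ε δ I h σ) ∧
        ENNReal.ofReal (1 - δ) ≤
          (FastPostponedGreedy.initLaw K n d ε δ).toOuterMeasure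
            {σ₀ | ∀ h : List FastPostponedGreedy.Op,
              FastPostponedGreedy.QueryAccurate ε I σ₀ h ∧
              FastPostponedGreedy.TotalWeightCompetitive ε I σ₀ h} := by
  open FastPostponedGreedy in
  -- 9600 = 3 · 3200, where 1/3200 = (1/2)²/800 is the Chernoff exponent at accuracy ε/2; this makes
  -- one tail at most (δ/n)³. With L ≥ 1/2, rounding up and adding one give s + 1 ≤ 9600 L + 2 ≤
  -- 9604 L.
  refine ⟨9600, 2000 * 9604, fun n d ε δ hn hd hε hε1 hδ hδ1 => ?_⟩
  have hn0 : 0 < n := by omega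
  have hn2 : (2 : ℝ) ≤ n := by exact_mod_cast hn
  have hd1 : (1 : ℝ) ≤ d := by exact_mod_cast hd
  have hratio : 2 ≤ n / δ := by
    rw [le_div_iff₀ hδ]
    nlinarith
  have hlog : 1 / 2 ≤ Real.log (n / δ) := by
    have h1 := Real.log_two_gt_d9
    have h2 := Real.log_le_log (by norm_num) hratio
    linarith
  have hinv : 1 ≤ ε⁻¹ ^ 2 := one_le_pow₀ (one_le_inv₀ hε |>.2 hε1.le)
  set L := ε⁻¹ ^ 2 * Real.log (n / δ) with hLdef
  have hL : 1 / 2 ≤ L := by nlinarith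
  have hdim : 9600 * Real.log (n / δ) / (ε * ε) = 9600 * L := by
    rw [hLdef]; field_simp
  set s := sketchDim 9600 n ε δ with hsdef
  have hs1 : 9600 * L ≤ s := by
    rw [← hdim, hsdef, sketchDim]; exact_mod_cast Nat.le_ceil _
  have hs2 : (s : ℝ) + 1 ≤ 9604 * L := by
    have : (s : ℝ) < 9600 * L + 1 := by
      rw [hsdef, sketchDim]
      have := Nat.ceil_lt_add_one (a := 9600 * Real.log (n / δ) / (ε * ε))
        (by rw [hdim]; positivity)
      rw [← hdim]
      exact_mod_cast this
    linarith
  have hspos : 0 < s := by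
    have : (0 : ℝ) < s := by linarith
    exact_mod_cast this
  refine ⟨fun σ₀ hσ => ?_, fun I => ⟨fun σ₀ hσ h σ hσ' => ?_, ?_⟩⟩
  · have h1 : (σ₀.time : ℝ) ≤ 300 * (s + 1) * (d + 1) := by
      exact_mod_cast (init_support hn0 hσ).2
    have h2 : (300 : ℝ) * (s + 1) * (d + 1) ≤ 600 * ((s + 1) * d) := by
      nlinarith [mul_nonneg (by positivity : (0 : ℝ) ≤ s + 1) (by linarith : (0 : ℝ) ≤ d - 1)]
    have h3 : ((s : ℝ) + 1) * d ≤ 9604 * L * d := by gcongr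
    have h4 : ε⁻¹ ^ 2 * d * Real.log (n / δ) = L * d := by rw [hLdef]; ring
    rw [h4]
    have : 0 ≤ L * d := by positivity
    linarith
  · exact (((init_support hn0 hσ).1 I).run hn0 h σ hσ').sound hn (by linarith) (by norm_num)
  · have hp : n * n * (2 * Real.exp (-(s * (ε / 2) ^ 2 / 800))) ≤ δ := by
      have h1 : 3 * Real.log (n / δ) ≤ s * (ε / 2) ^ 2 / 800 := by
        have : 9600 * L * ε ^ 2 = 9600 * Real.log (n / δ) := by rw [hLdef]; field_simp
        nlinarith [mul_le_mul_of_nonneg_right hs1 (sq_nonneg ε)]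
      have h2 : Real.exp (-(s * (ε / 2) ^ 2 / 800)) ≤ (δ / n) ^ 3 := by
        refine (Real.exp_le_exp.2 (neg_le_neg h1)).trans (le_of_eq ?_)
        rw [← mul_neg, ← Real.log_inv, inv_div]
        have : (3 : ℝ) = ((3 : ℕ) : ℝ) := by norm_num
        rw [this, Real.exp_nat_mul, Real.exp_log (by positivity)]
      refine (mul_le_mul_of_nonneg_left (mul_le_mul_of_nonneg_left h2 (by norm_num))
        (by positivity)).trans ?_
      -- The third power beats the n² pairs, and n ≥ 2 absorbs the factor 2 for the two tails.
      have : (n : ℝ) * n * (2 * (δ / n) ^ 3) = δ * (δ * δ) * (2 / n) := by field_simp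
      rw [this]
      have h3 : (2 : ℝ) / n ≤ 1 := (div_le_one (by linarith)).2 hn2
      have h4 : δ * δ ≤ 1 := by nlinarith
      calc δ * (δ * δ) * (2 / n) ≤ δ * 1 * 1 := by gcongr
        _ = δ := by ring
    refine (accurate_probability I 9600 (η := ε / 2) (by positivity) (by linarith) hspos hp).trans ?_
    -- Inclusion of the events is needed only on the support, where `init_support` supplies the
    -- initial invariant.
    refine PMF.toOuterMeasure_mono _ fun σ₀ hσ => fun h => ?_
    have hS := (init_support hn0 hσ.2).1 I
    have hA : Accurate (ε / 2) I s (σ₀.real .M) := hσ.1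
    exact ⟨(hA.mono (by linarith)).queryAccurate hS hn0 h, hA.competitive hε hε1 hS hn0 h⟩
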